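/- **Protocol.** In each of $N_{\rm em}$ rounds Alice draws uniformly random bits $b^{(1)},b^{(2)},b^{(3)}$ and sends three pulses in the state $\bigotimes_{u=1}^3\hat\rho^{\,b^{(u)}}_{S_u}$; she keeps systems $R_u$ such that $|\psi_{b}\rangle_{S_uR_u}$ purifies $\hat\rho^{\,b}_{S_u}$. An eavesdropper (Eve) applies an arbitrary joint isometry to all pulses, keeps a quantum system $E$, and forwards three optical pulses per round to Bob. Bob uses a one-bit-delay Mach–Zehnder interferometer with 50:50 beam splitters and two photon-number-resolving detectors; time slot $j\in\{1,2\}$ interferes pulse $j$ (long arm) with pulse $j+1$ (short arm). A round is detected if exactly one photon in total is found in the slots $1,2$; the slot $j$ and the clicking detector $d\in\{0,1\}$ are recorded. Each detected round is independently a code round (probability $t\in(0,1)$) or a sample round (probability $1-t$). The sets of code and sample rounds, the slots $j$, and in the sample rounds the bits $d$ and $b^{(j)}\oplus b^{(j+1)}$ are announced; these are the public data. The sifted keys $\kappa_A=(b^{(j)}\oplus b^{(j+1)})$ and $\kappa_B=(d)$ are formed from the $N_{\rm code}$ code rounds. Alice sends a syndrome of $\kappa_A$ encrypted with $N_{\rm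 EC}$ pre-shared secret bits (the code may depend on the public data), from which Bob computes a reconciled key $\kappa_B^{\rm rec}$. They compare $\zeta'$-bit values of a random universal$_2$ hash function on $\kappa_A$ and $\kappa_B^{\rm rec}$, encrypted with $\zeta'$ pre-shared secret bits, and abort on a mismatch. Finally both apply a publicly announced random universal$_2$ hash function with output length $N_{\rm fin}=N_{\rm code}-N_{\rm PA}$ to obtain $k_A,k_B$; they abort if this is not positive. Aborting means $N_{\rm fin}=0$. The net key length is $\ell=N_{\rm fin}-N_{\rm EC}-\zeta'$. **Security.** Let $\hat\rho^{\rm fin}_{ABE|n}$ be the state of the final keys and of all of Eve's (quantum and public classical) systems given $N_{\rm fin}=n$, and $\hat\rho^{\rm ideal}_{ABE|n}=2^{-n}\sum_{k\in\{0,1\}^n}|k,k\rangle\langle k,k|_{AB}\otimes{\rm tr}_{AB}\,\hat\rho^{\rm fin}_{ABE|n}$. The protocol is $\epsilon_{\rm sec}$-secure against an attack if $\frac12\sum_{n\ge0}\Pr[N_{\rm fin}=n]\,\|\hat\rho^{\rm ideal}_{ABE|n}-\hat\rho^{\rm fin}_{ABE|n}\|_1\le\epsilon_{\rm sec}$. **Phase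 errors.** In the virtual protocol Alice prepares $\bigotimes_{u=1}^3 2^{-1/2}\sum_{b}\hat H|b\rangle_{A_u}|\psi_b\rangle_{S_uR_u}$ ($\hat H$ the Hadamard matrix) in each round. In the code rounds she measures $A_1,A_2,A_3$ in the $Z$ basis, obtaining $z_1,z_2,z_3$, and Bob, instead of interfering the pulses $j$ and $j+1$ in slot $j$, measures which of them contains the photon. A phase error occurs if the photon is in pulse $j$ and $z_{j+1}=1$, or in pulse $j+1$ and $z_j=1$. All other rounds are as in the actual protocol (Alice measures in the $X$ basis). $N_{\rm ph}$ is the number of phase errors in the code rounds. **Claim.** Let $h(x)=-x\log_2x-(1-x)\log_2(1-x)$ for $0\le x\le1/2$ and $h(x)=1$ for $x>1/2$. Let $\zeta>0$ be real, $\zeta'\ge1$ an integer, $0\le\epsilon\le1$, let $N^{\rm U}_{\rm ph}\ge0$ be a function of the public data, and set $$N_{\rm PA}=\left\lceil N_{\rm code}\,h\!\left(\frac{N^{\rm U}_{\rm ph}}{N_{\rm code}}\right)+\zeta\right\rceil .$$ Then, for public data for which $N_{\rm code}[1-h(N^{\rm U}_{\rm ph}/N_{\rm code})]-\zeta\ge0$,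 the net length of the key generated when the verification succeeds is $$\ell=\left\lfloor N_{\rm code}\left[1-h\!\left(\frac{N^{\rm U}_{\rm ph}}{N_{\rm code}}\right)\right]-\zeta\right\rfloor-N_{\rm EC}-\zeta',$$ and against every attack of Eve for which $\Pr[N_{\rm ph}>N^{\rm U}_{\rm ph}]\le\epsilon$ the protocol is $\epsilon_{\rm sec}$-secure with $$\epsilon_{\rm sec}=2^{-\zeta'}+\sqrt2\,\sqrt{\epsilon+2^{-\zeta}} .$$ In particular, if this bound on $N_{\rm ph}$ holds regardless of Eve's attack, the protocol is $\epsilon_{\rm sec}$-secure. -/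

import Mathlib

open scoped NNReal ENNReal

noncomputable section

namespace DPSQKD

/-! ### Hilbert spaces, trace norm, classical-quantum operators -/

/-- The Hilbert space `ℓ²(ι) ⊗ E` of square-summable `E`-valued families. -/
abbrev L2 (ι : Type*) (E : Type*) [NormedAddCommGroup E] := lp (fun _ : ι => E) 2

section Operators

variable {H : Type*} [NormedAddCommGroup H] [InnerProductSpace ℂ H] [CompleteSpace H]

/-- The trace `∑ₑ ⟨e, A e⟩` (over an orthonormal basis) of a positive operator, in `[0, ∞]`. -/
def opTrace (A : H →L[ℂ] H) : ℝ≥0∞ :=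
  ∑' e : (exists_hilbertBasis ℂ H).choose, ENNReal.ofReal (inner ℂ (e : H) (A e)).re

/-- The 1-norm `‖A‖₁ = tr √(A† A)`. -/
def traceNorm (A : H →L[ℂ] H) : ℝ≥0∞ := opTrace (CFC.abs A)

/-- The operator `∑ᵢ |i⟩⟨i| ⊗ Xᵢ` on `ℂ^ι ⊗ H`, where `|i⟩` is the standard basis of `ℂ^ι`. -/
def cqOp {ι : Type*} [Fintype ι] (X : ι → H →L[ℂ] H) :
    PiLp 2 (fun _ : ι => H) →L[ℂ] PiLp 2 (fun _ : ι => H) :=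
  ((PiLp.continuousLinearEquiv 2 ℂ (fun _ : ι => H)).symm :
      (ι → H) →L[ℂ] PiLp 2 (fun _ : ι => H)) ∘L
    ContinuousLinearMap.pi (fun i => X i ∘L PiLp.proj 2 (fun _ : ι => H) i)

end Operators

/-- The function `h`: binary entropy on `[0, 1/2]`, and `1` above `1/2`. -/
def entropyFn (x : ℝ) : ℝ :=
  if x ≤ 1 / 2 then -x * Real.logb 2 x - (1 - x) * Real.logb 2 (1 - x) else 1

/-- A randomly chosen function `α → β` is universal₂ if any two distinct inputs collide
with probability at most `1 / |β|`. -/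
def IsUniversal₂ {α β : Type*} [Fintype β] (p : PMF (α → β)) : Prop :=
  ∀ x y : α, x ≠ y → p.toOuterMeasure {f | f x = f y} ≤ ((Fintype.card β : ℝ≥0∞))⁻¹

/-! ### Alice's source and Eve's attack -/

/-- Alice's source. A pulse lives in `ℓ²(S)`, and `state u b` is a purification
`|ψ_b⟩ ∈ ℓ²(S) ⊗ ℓ²(R)` of the state `ρ^b_{S_u}` of the `u`-th pulse of a block for the bit `b`.
The purifying system stays in Alice's laboratory. -/
structure Source (S R : Type*) where
  state : Fin 3 → ZMod 2 → L2 (S × R) ℂ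
  norm_state : ∀ u b, ‖state u b‖ = 1

/-- The bits `b_A` of all `N` blocks of three pulses. -/
abbrev Bits (N : ℕ) := Fin N → Fin 3 → ZMod 2

lemma summable_pi_prod {ι κ : Type*} [Fintype ι] (f : ι → κ → ℝ)
    (h0 : ∀ i k, 0 ≤ f i k) (hf : ∀ i, Summable (f i)) :
    Summable (fun s : ι → κ => ∏ i, f i (s i)) := by
  classical
  refine summable_of_sum_le (c := ∏ i, ∑' k, f i k)
    (fun s => Finset.prod_nonneg fun i _ => h0 i _) fun F => ?_
  calc ∑ s ∈ F, ∏ i, f i (s i)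
      ≤ ∑ s ∈ Fintype.piFinset (fun i => F.image (fun s => s i)), ∏ i, f i (s i) := by
        refine Finset.sum_le_sum_of_subset_of_nonneg ?_
          (fun s _ _ => Finset.prod_nonneg fun i _ => h0 i _)
        intro s hs
        rw [Fintype.mem_piFinset]
        exact fun i => Finset.mem_image_of_mem (fun s => s i) hs
    _ = ∏ i, ∑ k ∈ F.image (fun s => s i), f i k := by
        rw [Finset.prod_univ_sum]
    _ ≤ ∏ i, ∑' k, f i k :=
        Finset.prod_le_prod (fun i _ => Finset.sum_nonneg fun k _ => h0 i k)
          (fun i _ => (hf i).sum_le_tsum _ (fun k _ => h0 i k))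

lemma memℓp_jointInput {S R : Type*} {N : ℕ} (src : Source S R) (b : Bits N)
    (r : Fin N → Fin 3 → R) :
    Memℓp (fun s : Fin N → Fin 3 → S => ∏ i, ∏ u, src.state u (b i u) (s i u, r i u)) 2 := by
  refine memℓp_gen ?_
  have key : ∀ i u, Summable (fun s : S => ‖src.state u (b i u) (s, r i u)‖ ^ 2) := by
    intro i u
    have h1 := (lp.memℓp (src.state u (b i u))).summable (by norm_num)
    have h2 := h1.comp_injective (Prod.mk_left_injective (r i u) (α := S))
    simpa [Function.comp_def] using h2
  have h3 := summable_pi_prod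
    (fun i (s : Fin 3 → S) => ∏ u, ‖src.state u (b i u) (s u, r i u)‖ ^ 2)
    (fun i s => Finset.prod_nonneg fun u _ => by positivity)
    (fun i => summable_pi_prod (fun u (s : S) => ‖src.state u (b i u) (s, r i u)‖ ^ 2)
      (fun u s => by positivity) (fun u => key i u))
  simpa [norm_prod, Finset.prod_pow] using h3

/-- The component `⟨r|` on the purifying systems of `⨂_{i,u} |ψ_{b_{i,u}}⟩`: an (unnormalized)
vector of the emitted pulses of all `N` blocks. -/
def jointInput {S R : Type*} {N : ℕ} (src : Source S R) (b : Bits N)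
    (r : Fin N → Fin 3 → R) : L2 (Fin N → Fin 3 → S) ℂ :=
  ⟨fun s => ∏ i, ∏ u, src.state u (b i u) (s i u, r i u), memℓp_jointInput src b r⟩

/-- A general coherent attack: an isometry from all the emitted pulses to all the optical pulses
entering Bob's interferometer, in the photon-number basis (`N` blocks of three pulses), and Eve's
quantum system `H`, which she keeps until the end of the protocol. Losses and noise, including an
inefficiency and dark counts common to Bob's detectors, are attributed to the attack. -/
abbrev Attack (S : Type*) (N : ℕ) (H : Type*) [NormedAddCommGroup H] [InnerProductSpace ℂ H] :=
  L2 (Fin N → Fin 3 → S) ℂ →ₗᵢ[ℂ] L2 (Fin N → Fin 3 → ℕ) H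

/-! ### Bob's interferometer and detectors -/

/-- Photon numbers `(short arm, long arm)` of the three pulses of a block after the first
beam splitter of the interferometer. -/
abbrev Arms := Fin 3 → ℕ × ℕ

/-- The amplitude with which a 50:50 beam splitter (with vacuum in the other input port) splits
`m + n` photons into `m` in the short arm and `n` in the long arm. -/
def bsAmp (p : ℕ × ℕ) : ℝ := √(((p.1 + p.2).choose p.1 : ℝ) / 2 ^ (p.1 + p.2))

/-- Number of photons reaching the detectors in the first and second time slots. The slot `j`
combines the long arm of the pulse `j` with the short arm of the pulse `j + 1`; here `j : Fin 2`,
and the two pulses are `j.castSucc, j.succ : Fin 3`. -/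
def monitored (a : Arms) : ℕ := ∑ j : Fin 2, ((a j.castSucc).2 + (a j.succ).1)

/-- The result of the measurement of one block.
* `click j m k`: the round is detected, at the time slot `j`. If the two arms interfere at the
  second beam splitter, `m` is the detector `d` that clicks (the raw key bit). If instead the arm
  of the photon is measured, `m = 0` stands for the pulse `j` (long arm) and `m = 1` for the
  pulse `j + 1` (short arm). The pair `k` holds the photon numbers of the short arm of the first
  pulse and of the long arm of the third pulse, which only reach the slots 0 and 3.
* `noClick a`: the round is not detected. -/
inductive Outcome where
  | click (j : Fin 2) (m : ZMod 2) (k : ℕ × ℕ)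
  | noClick (a : Arms) (ha : monitored a ≠ 1)

/-- The photon numbers in the arms when the only monitored photon is found in the slot `j`, coming
from the long arm of the pulse `j` (`c = 0`) or from the short arm of the pulse `j + 1` (`c = 1`). -/
def onePhoton (j : Fin 2) (c : ZMod 2) (k : ℕ × ℕ) : Arms := fun u =>
  (if u = 0 then k.1 else if c = 1 ∧ u = j.succ then 1 else 0,
   if u = 2 then k.2 else if c = 0 ∧ u = j.castSucc then 1 else 0)

/-- The two arm configurations that are superposed in an outcome (just one if undetected). -/
def Outcome.config : Outcome → ZMod 2 → Arms
  | .click j _ k, c => onePhoton j c k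
  | .noClick a _, _ => a

/-- Amplitudes of the arm configurations for the interferometric measurement: the detector `d`
clicks with the amplitude functional `(⟨c = 0| + (-1)^d ⟨c = 1|) / √2`. -/
def Outcome.interfere : Outcome → ZMod 2 → ℂ
  | .click _ d _, c => (-1) ^ (d.val * c.val) / (√2 : ℝ)
  | .noClick _ _, c => if c = 0 then 1 else 0

/-- Amplitudes of the arm configurations for the measurement of the arm of the photon. -/
def Outcome.whichArm : Outcome → ZMod 2 → ℂ
  | .click _ m _, c => if c = m then 1 else 0
  | .noClick _ _, c => if c = 0 then 1 else 0

section States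

variable {S R H : Type*} [NormedAddCommGroup H] [InnerProductSpace ℂ H] {N : ℕ}

/-- Eve's unnormalized vector for the bits `b`, the component `r` of the purifying systems and
the photon numbers `a` in the arms of the interferometer. -/
def armVec (src : Source S R) (V : Attack S N H) (b : Bits N) (r : Fin N → Fin 3 → R)
    (a : Fin N → Arms) : H :=
  ((∏ i, ∏ u, bsAmp (a i u) : ℝ) : ℂ) •
    (V (jointInput src b r) : (Fin N → Fin 3 → ℕ) → H) (fun i u => (a i u).1 + (a i u).2)

/-- Eve's unnormalized vector in the actual protocol, for Alice's bits `b` and Bob's measurement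
results `o`. -/
def actualVec (src : Source S R) (V : Attack S N H) (b : Bits N) (r : Fin N → Fin 3 → R)
    (o : Fin N → Outcome) : H :=
  ∑ c : Fin N → ZMod 2, (∏ i, (o i).interfere (c i)) •
    armVec src V b r (fun i => (o i).config (c i))

end States

/-! ### Public data -/

/-- What Alice and Bob announce about a round: it is undetected, a code round with its time slot,
or a sample round with its time slot and Alice's and Bob's sample bits. -/
inductive RoundRecord where
  | undetected
  | code (j : Fin 2)
  | sample (j : Fin 2) (a b : ZMod 2)
  deriving DecidableEq, Fintype

/-- The experimentally available data: the sets of code and sample rounds, the time slots, and both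
sample sequences. -/
abbrev Transcript (N : ℕ) := Fin N → RoundRecord

/-- Whether a round is a code round. -/
def RoundRecord.isCode : RoundRecord → Bool
  | .code _ => true
  | _ => false

/-- The code set. -/
def codeSet {N : ℕ} (τ : Transcript N) : Finset (Fin N) :=
  Finset.univ.filter (fun i => (τ i).isCode = true)

/-- `N_code`. -/
def nCode {N : ℕ} (τ : Transcript N) : ℕ := (codeSet τ).card

/-- Bit strings indexed by the code rounds. -/
abbrev Sifted {N : ℕ} (τ : Transcript N) := codeSet τ → ZMod 2

/-- Bit strings of length `n`. -/
abbrev Key (n : ℕ) := Fin n → ZMod 2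

/-- The public record of one round, from Alice's bits `x` of the block, Bob's result `o`, and Bob's
random choice `f` between code (`true`) and sample (`false`). -/
def roundRecord (x : Fin 3 → ZMod 2) (o : Outcome) (f : Bool) : RoundRecord :=
  match o with
  | .noClick _ _ => .undetected
  | .click j d _ => if f then .code j else .sample j (x j.castSucc + x j.succ) d

/-- The public record of all rounds. -/
def transcript {N : ℕ} (x : Bits N) (o : Fin N → Outcome) (f : Fin N → Bool) : Transcript N :=
  fun i => roundRecord (x i) (o i) (f i)

/-- The probability of the choices `f`: a round is assigned to code with probability `t`. (The
choice is immaterial in undetected rounds.) -/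
def coinWeight {N : ℕ} (t : ℝ) (f : Fin N → Bool) : ℝ := ∏ i, if f i then t else 1 - t

/-- Alice's sifted key: the bits `b^{(j)} ⊕ b^{(j+1)}` of the code rounds. -/
def siftedA {N : ℕ} (τ : Transcript N) (b : Bits N) : Sifted τ := fun i =>
  match τ i with
  | .code j => b i j.castSucc + b i j.succ
  | _ => 0

/-- Bob's sifted key: the raw key bits `d` of the code rounds. -/
def siftedB {N : ℕ} (τ : Transcript N) (o : Fin N → Outcome) : Sifted τ := fun i =>
  match o i with
  | .click _ d _ => d
  | .noClick _ _ => 0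

/-! ### The protocol -/

/-- The parameters of the protocol with `N` emitted blocks and verification hashes of `ζ'` bits. -/
structure Protocol (N ζ' : ℕ) where
  /-- probability of the code rounds -/
  t : ℝ
  t_pos : 0 < t
  t_lt_one : t < 1
  /-- `N_EC`, the length of the syndrome -/
  nEC : Transcript N → ℕ
  /-- the syndrome of Alice's sifted key -/
  syndrome : ∀ τ : Transcript N, Sifted τ → Key (nEC τ)
  /-- Bob's reconciled key, from the syndrome and his sifted key -/
  decode : ∀ τ : Transcript N, Key (nEC τ) → Sifted τ → Sifted τ
  /-- the random hash function for the verification of error correction -/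
  verHash : ∀ τ : Transcript N, PMF (Sifted τ → Key ζ')
  verHash_universal : ∀ τ : Transcript N, IsUniversal₂ (verHash τ)
  /-- `N_PA`, the number of bits sacrificed in privacy amplification -/
  nPA : Transcript N → ℕ
  /-- the random hash function for privacy amplification to `n` bits -/
  paHash : ∀ (τ : Transcript N) (n : ℕ), PMF (Sifted τ → Key n)
  paHash_universal : ∀ (τ : Transcript N) (n : ℕ), n ≤ nCode τ → IsUniversal₂ (paHash τ n)

namespace Protocol

variable {N ζ' : ℕ} (P : Protocol N ζ')

/-- The length `N_code - N_PA` of the final key if the verification succeeds. It is `0`, that is,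
the protocol aborts, if `N_PA` exceeds `N_code`. -/
def finLen (τ : Transcript N) : ℕ := nCode τ - P.nPA τ

/-- The net length `ℓ = N_fin - N_EC - ζ'` of the key. -/
def netLength (τ : Transcript N) : ℤ := (P.finLen τ : ℤ) - P.nEC τ - ζ'

/-- Bob's reconciled key. -/
def reconciled (τ : Transcript N) (κA κB : Sifted τ) : Sifted τ :=
  P.decode τ (P.syndrome τ κA) κB

/-- The classical registers that are public, hence in Eve's hands, at the end of the protocol: the
transcript, the encrypted syndrome, the verification hash function, the encrypted hash value of
Alice's sifted key, whether the verification succeeded, and the privacy amplification function. -/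
abbrev Public (n : ℕ) :=
  Σ τ : Transcript N, Key (P.nEC τ) × (Sifted τ → Key ζ') × Key ζ' × Bool × (Sifted τ → Key n)

variable {S R H : Type*} [NormedAddCommGroup H] [InnerProductSpace ℂ H] [CompleteSpace H]

open Classical in
/-- The final state given `N_fin = n`, times `Pr[N_fin = n]`: the component
`Pr[N_fin = n] Pr[k_A, k_B, public | n] ρ_E(k_A, k_B, public)` on Eve's quantum system. The sum
runs over Alice's bits, all systems that are neither Alice's keys, Bob's keys nor Eve's, Bob's
measurement results, his choice of code and sample rounds, and the pre-shared secret keys `p₁`,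
`p₂` that encrypt the syndrome and the hash value by one-time pads. -/
def finBlock (src : Source S R) (V : Attack S N H) (n : ℕ) :
    Key n × Key n × P.Public n → H →L[ℂ] H
  | (kA, kB, ⟨τ, s, F, v, acc, G⟩) =>
    ∑' w : Bits N × (Fin N → Fin 3 → R) × (Fin N → Outcome),
      ∑ f : Fin N → Bool, ∑ p₁ : Key (P.nEC τ), ∑ p₂ : Key ζ',
        let b := w.1
        let r := w.2.1
        let o := w.2.2
        let κA := siftedA τ b
        let κrec := P.reconciled τ κA (siftedB τ o)
        let weight : ℝ := (1 / 2) ^ (3 * N) * coinWeight P.t f * (1 / 2) ^ P.nEC τ * (1 / 2) ^ ζ' *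
          (P.verHash τ F).toReal * (P.paHash τ n G).toReal
        if transcript b o f = τ ∧ s = P.syndrome τ κA + p₁ ∧ v = F κA + p₂ ∧
            acc = decide (F κA = F κrec) ∧ n = (if acc then P.finLen τ else 0) ∧
            kA = G κA ∧ kB = G κrec then
          (weight : ℂ) • InnerProductSpace.rankOne ℂ (actualVec src V b r o) (actualVec src V b r o)
        else 0

open Classical in
/-- The corresponding ideal state `2⁻ⁿ ∑ₖ |k,k⟩⟨k,k| ⊗ tr_{AB}(ρ^fin)`, times `Pr[N_fin = n]`. -/
def idealBlock (src : Source S R) (V : Attack S N H) (n : ℕ) :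
    Key n × Key n × P.Public n → H →L[ℂ] H
  | (kA, kB, e) =>
    if kA = kB then
      ((1 / 2 : ℂ) ^ n) • ∑ k : Key n × Key n, P.finBlock src V n (k.1, k.2, e)
    else 0

/-- Security against the attack `V`:
`(1/2) ∑_{n ≥ 0} Pr[N_fin = n] ‖ρ^ideal_{ABE|n} - ρ^fin_{ABE|n}‖₁ ≤ ε_sec`. -/
def IsSecure (src : Source S R) (V : Attack S N H) (εsec : ℝ) : Prop :=
  (1 / 2 : ℝ≥0∞) * ∑' n : ℕ,
    traceNorm (cqOp (P.idealBlock src V n) - cqOp (P.finBlock src V n)) ≤ ENNReal.ofReal εsec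

end Protocol

/-! ### Phase errors -/

section PhaseErrors

variable {S R H : Type*} [NormedAddCommGroup H] [InnerProductSpace ℂ H] {N : ℕ}

/-- Amplitude `⟨x|` on Alice's three qubits of a block in the state
`⨂_u 2^{-1/2} ∑_{b_u} (Hadamard |b_u⟩) ⊗ |ψ_{b_u}⟩`, as the coefficient of `⨂_u |ψ_{b_u}⟩`: in the
`Z` basis in the code rounds, and in the `X` basis in the other rounds. -/
def aliceAmp (isCode : Bool) (x b : Fin 3 → ZMod 2) : ℂ :=
  ∏ u, (1 / (√2 : ℝ) : ℂ) *
    (if isCode then (-1) ^ ((x u).val * (b u).val) / (√2 : ℝ) else if x u = b u then 1 else 0)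

/-- Eve's unnormalized vector in the virtual protocol, with code rounds `C`: there Alice measures
her qubits in the `Z` basis and Bob measures which of the two pulses contains the photon. All other
rounds are as in the actual protocol. -/
def virtualVec (src : Source S R) (V : Attack S N H) (C : Fin N → Bool) (x : Bits N)
    (r : Fin N → Fin 3 → R) (o : Fin N → Outcome) : H :=
  ∑ b : Bits N, ∑ c : Fin N → ZMod 2,
    ((∏ i, aliceAmp (C i) (x i) (b i)) *
      ∏ i, (if C i then (o i).whichArm (c i) else (o i).interfere (c i))) •
    armVec src V b r (fun i => (o i).config (c i))

/-- A phase error: Alice finds `z_{j+1} = 1` while the photon is in the pulse `j`, or `z_j = 1` while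
it is in the pulse `j + 1`. -/
def IsPhaseError (z : Fin 3 → ZMod 2) : Outcome → Prop
  | .click j m _ => if m = 0 then z j.succ = 1 else z j.castSucc = 1
  | .noClick _ _ => False

open Classical in
/-- The number `N_ph` of phase errors in the code rounds. -/
def nPh (τ : Transcript N) (z : Bits N) (o : Fin N → Outcome) : ℕ :=
  ((codeSet τ).filter (fun i => IsPhaseError (z i) (o i))).card

open Classical in
/-- `Pr[N_ph > N_ph^U]` under the attack `V`, where `N_ph^U` is a function of the public data. -/
def phaseErrorProb (src : Source S R) (V : Attack S N H) (t : ℝ)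
    (NphU : Transcript N → ℝ≥0) : ℝ≥0∞ :=
  ∑ f : Fin N → Bool,
    ∑' w : Bits N × (Fin N → Fin 3 → R) × (Fin N → Outcome),
      let τ := transcript w.1 w.2.2 f
      if (NphU τ : ℝ) < nPh τ w.1 w.2.2 then
        ENNReal.ofReal
          (coinWeight t f * ‖virtualVec src V (fun i => (τ i).isCode) w.1 w.2.1 w.2.2‖ ^ 2)
      else 0

end PhaseErrors

end DPSQKD

end

open DPSQKD

/-! By duality, the trace distance from the ideal state is controlled by tests: Eve's unnormalized
states are weighted sums of rank-one operators, so it suffices to bound `∑ c ⟨a, U a⟩` for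
self-adjoint contractions `U`, one for each classical value (`traceNorm_cqOp_le`). The one-time pads
make the two ciphertexts uniform, and replacing Bob's reconciled key by Alice's costs the
probability `2^(-ζ')` that a mismatch passes the verification. What remains is privacy amplification
of Alice's sifted key against Eve.

Complementarity supplies the randomness of that key. A Hadamard transform of Alice's bits and of
Bob's bit in the code rounds carries Eve's vectors of the virtual protocol to those of the actual
one (`fiberTransform_virtualVec`). Adding `t` to both `z_j` and `z_{j+1}` changes the phase error
pattern by `t` wherever the photon is; after the transform it becomes multiplication by the
character `(-1)^(t·κ)` of the sifted key `κ`. Therefore, if the error patterns are confined to a set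
`Good`, each value of `κ` carries at most the fraction `|Good| / 2^N_code` of the weight, in every
direction of Eve's space (`sum_fiberTransform_key_le`). The entropy bound `card_filter_card_le`
counts `Good`.

A leftover hash lemma (`leftover_hash`) turns this domination into near uniformity of the hashed
key. It rests on a Cauchy–Schwarz inequality weighted by quarter powers of `σ = ∑ |x⟩⟨x|`
(`exists_collision_kernel`) and on universality of the hash.

Runs with too many phase errors are not discarded. Eve's vectors are sums `x + y` of a good and a
bad part, orthogonal in total. In `decoupling` the good part is handled by hashing, the bad part by
its weight, and the cross term by a second use of the leftover hash lemma, which gains a factor of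
about two over plain Cauchy–Schwarz. `decoupling_bound_le` optimizes the result to `√2 √(ε +
2^(-ζ))`. The bound is homogeneous and jointly concave in the two weights, so
`sum_advantageBound_le` sums it over the public data. -/

noncomputable section

namespace DPSQKD

/-! ### Duality for the trace norm and traces of sums of rank-one operators. -/

section TraceNorm

variable {K : Type*} [NormedAddCommGroup K] [InnerProductSpace ℂ K]

lemma isSelfAdjoint_of_hasSum_rankOne [CompleteSpace K] {J : Type*} {x : J → K} {c : J → ℝ} {A : K →L[ℂ] K}
    (hA : ∀ v, HasSum (fun j => ((c j : ℂ) * inner ℂ (x j) v) • x j) (A v)) :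
    IsSelfAdjoint A := by
  rw [ContinuousLinearMap.isSelfAdjoint_iff_isSymmetric]
  intro v w
  have h1 := (hA w).mapL (innerSL ℂ v)
  have h2 := ((hA v).mapL (innerSL ℂ w)).star
  have h3 : HasSum (fun j => star (innerSL ℂ w (((c j : ℂ) * inner ℂ (x j) v) • x j)))
      (innerSL ℂ v (A w)) := by
    refine h1.congr_fun ?_
    intro j
    simp [mul_comm, mul_left_comm]
  have h4 := h2.unique h3
  simpa using h4

lemma HilbertBasis.hasSum_norm_inner_sq {ι : Type*} (b : HilbertBasis ι ℂ K) (x : K) :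
    HasSum (fun e => ‖inner ℂ (b e) x‖ ^ 2) (‖x‖ ^ 2) := by
  have h := Complex.hasSum_re (b.hasSum_inner_mul_inner x x)
  convert h using 1
  · ext e
    rw [← inner_conj_symm x (b e), ← Complex.normSq_eq_conj_mul_self, Complex.ofReal_re,
      Complex.normSq_eq_norm_sq]
  · simpa using (norm_sq_eq_re_inner (𝕜 := ℂ) x)

/-- Fubini: the trace of `U A` is computed by summing over the basis first, where Parseval gives `⟨x
j, U (x j)⟩`. Bounded coefficients suffice because the squared norms are summable. -/
lemma HilbertBasis.hasSum_trace_rankOne {ι J : Type*} (b : HilbertBasis ι ℂ K) {x : J → K} (hx : Summable fun j => ‖x j‖ ^ 2)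
    {c : J → ℝ} {B : ℝ} (hc : ∀ j, |c j| ≤ B) {A : K →L[ℂ] K}
    (hA : ∀ v, HasSum (fun j => ((c j : ℂ) * inner ℂ (x j) v) • x j) (A v)) (U : K →L[ℂ] K) :
    HasSum (fun e => (inner ℂ (b e) (U (A (b e)))).re)
      (∑' j, c j * (inner ℂ (x j) (U (x j))).re) := by
  obtain ⟨F, hF⟩ : ∃ F : J × ι → ℝ, ∀ p, F p =
    c p.1 * (inner ℂ (x p.1) (b p.2) * inner ℂ (b p.2) (U (x p.1))).re := ⟨_, fun _ => rfl⟩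
  have hrow : ∀ j, HasSum (fun e => F (j, e)) (c j * (inner ℂ (x j) (U (x j))).re) := by
    intro j
    simp only [hF]
    exact (Complex.hasSum_re (b.hasSum_inner_mul_inner (x j) (U (x j)))).mul_left (c j)
  have hcol : ∀ e, HasSum (fun j => F (j, e)) (inner ℂ (b e) (U (A (b e)))).re := by
    intro e
    have h := Complex.hasSum_re (((hA (b e)).mapL U).mapL (innerSL ℂ (b e)))
    refine h.congr_fun fun j => ?_
    simp only [hF, map_smul, innerSL_apply_apply, smul_eq_mul, mul_assoc]
    rw [Complex.re_ofReal_mul]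
  -- An absolutely summable majorant: a product of two inner products is at most the sum of their
  -- squares, and these sum over the basis to `‖x j‖² + ‖U (x j)‖²`.
  obtain ⟨Gb, hG⟩ : ∃ Gb : J × ι → ℝ, ∀ p, Gb p =
    B * ((‖inner ℂ (b p.2) (x p.1)‖ ^ 2 + ‖inner ℂ (b p.2) (U (x p.1))‖ ^ 2)) :=
    ⟨_, fun _ => rfl⟩
  have hB : ∀ j, 0 ≤ B := fun j => (abs_nonneg _).trans (hc j)
  have hFG : ∀ p, ‖F p‖ ≤ Gb p := by
    intro p
    simp only [hF, hG, norm_mul, Real.norm_eq_abs]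
    refine mul_le_mul (hc _) ?_ (abs_nonneg _) (hB p.1)
    refine (Complex.abs_re_le_norm _).trans ?_
    rw [norm_mul, norm_inner_symm]
    nlinarith [sq_nonneg (‖inner ℂ (b p.2) (x p.1)‖ - ‖inner ℂ (b p.2) (U (x p.1))‖),
      sq_nonneg (‖inner ℂ (b p.2) (x p.1)‖), sq_nonneg (‖inner ℂ (b p.2) (U (x p.1))‖)]
  have hGrow : ∀ j, HasSum (fun e => Gb (j, e)) (B * (‖x j‖ ^ 2 + ‖U (x j)‖ ^ 2)) := by
    intro j
    simp only [hG]
    exact ((HilbertBasis.hasSum_norm_inner_sq b _).add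
      (HilbertBasis.hasSum_norm_inner_sq b _)).mul_left B
  have hGsum : Summable Gb := by
    rw [summable_prod_of_nonneg (fun p => (norm_nonneg _).trans (hFG p))]
    refine ⟨fun j => (hGrow j).summable, ?_⟩
    simp_rw [fun j => (hGrow j).tsum_eq]
    refine (hx.add ?_).mul_left B
    refine Summable.of_nonneg_of_le (fun _ => sq_nonneg _) (fun j => ?_) (hx.mul_left (‖U‖ ^ 2))
    rw [← mul_pow]
    exact pow_le_pow_left₀ (norm_nonneg _) (U.le_opNorm _) 2
  have hFsum : Summable F := Summable.of_norm_bounded hGsum hFG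
  have h1 : HasSum F (∑' j, c j * (inner ℂ (x j) (U (x j))).re) := by
    have := hFsum.hasSum
    have h2 := hFsum.tsum_prod' (fun j => (hrow j).summable)
    have h3 : ∑' j, ∑' e, F (j, e) = ∑' j, c j * (inner ℂ (x j) (U (x j))).re :=
      tsum_congr fun j => (hrow j).tsum_eq
    rwa [h2, h3] at this
  have h4 : HasSum (F ∘ (Equiv.prodComm ι J)) (∑' j, c j * (inner ℂ (x j) (U (x j))).re) :=
    (Equiv.prodComm ι J).hasSum_iff.mpr h1
  exact h4.prod_fiberwise fun e => hcol e

variable [CompleteSpace K]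

/-- A bound on the trace norm from bounds on `tr (U A)` for self-adjoint contractions `U`. -/
theorem traceNorm_le_of_forall_selfAdjoint_contraction {A : K →L[ℂ] K} (hA : IsSelfAdjoint A) {C : ℝ}
    (h : ∀ U : K →L[ℂ] K, IsSelfAdjoint U → ‖U‖ ≤ 1 → ∃ t ≤ C,
      HasSum (fun e : (exists_hilbertBasis ℂ K).choose => (inner ℂ (e : K) (U (A e))).re) t) :
    traceNorm A ≤ ENNReal.ofReal C := by
  obtain ⟨b, hb⟩ := (exists_hilbertBasis ℂ K).choose_spec
  have hnorm : ∀ e : (exists_hilbertBasis ℂ K).choose, ‖(e : K)‖ = 1 := fun e => by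
    rw [← congrFun hb e]; exact b.orthonormal.1 e
  have habs : ∀ v : K, 0 ≤ (inner ℂ v (CFC.abs A v)).re := fun v =>
    ((ContinuousLinearMap.nonneg_iff_isPositive _).1 (CFC.abs_nonneg A)).re_inner_nonneg_right v
  have key : ∀ (s : Finset (exists_hilbertBasis ℂ K).choose) (δ : ℝ), 0 < δ →
      ∑ e ∈ s, (inner ℂ (e : K) (CFC.abs A e)).re ≤ C + s.card * δ := by
    intro s δ hδ
    -- A continuous substitute for the sign function, to which the continuous functional calculus
    -- applies: `0 ≤ f(t) t ≤ |t| ≤ f(t) t + δ`, so `U A` is positive and within `δ` of `|A|`.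
    set f : ℝ → ℝ := fun t => t / (|t| + δ) with hf
    have hpos : ∀ t : ℝ, 0 < |t| + δ := fun t => by positivity
    have hfc : Continuous f := by
      refine continuous_id.div (by fun_prop) fun t => (hpos t).ne'
    set U := cfc f A with hU
    have hU1 : ‖U‖ ≤ 1 := by
      refine norm_cfc_le zero_le_one fun t _ => ?_
      simp only [hf, Real.norm_eq_abs, abs_div, abs_of_pos (hpos t)]
      rw [div_le_one (hpos t)]
      linarith
    have hUA : U * A = cfc (fun t => f t * t) A := by
      conv_lhs => rw [hU, ← cfc_id' ℝ A]
      rw [cfc_id' ℝ A, cfc_mul f (fun t => t) A (by fun_prop) (by fun_prop), cfc_id' ℝ A]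
    have hUApos : (U * A).IsPositive := by
      rw [← ContinuousLinearMap.nonneg_iff_isPositive, hUA]
      refine cfc_nonneg fun t _ => ?_
      simp only [hf, div_mul_eq_mul_div]
      exact div_nonneg (mul_self_nonneg t) (hpos t).le
    have hdiff : ‖CFC.abs A - U * A‖ ≤ δ := by
      rw [hUA, CFC.abs_eq_cfc_norm A hA, ← cfc_sub _ _ A (by fun_prop) (by fun_prop)]
      refine norm_cfc_le hδ.le fun t _ => ?_
      have : ‖t‖ - f t * t = δ * |t| / (|t| + δ) := by
        simp only [hf, Real.norm_eq_abs]
        rw [eq_div_iff (hpos t).ne', sub_mul, div_mul_eq_mul_div, div_mul_cancel₀ _ (hpos t).ne']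
        nlinarith [abs_mul_abs_self t]
      rw [this, Real.norm_eq_abs, abs_of_nonneg (by positivity), div_le_iff₀ (hpos t)]
      nlinarith [abs_nonneg t]
    obtain ⟨t, htC, ht⟩ := h U (cfc_predicate f A) hU1
    have h1 : ∑ e ∈ s, (inner ℂ (e : K) (U (A e))).re ≤ t :=
      sum_le_hasSum s (fun e _ => hUApos.re_inner_nonneg_right _) ht
    have h2 : ∀ e ∈ s, (inner ℂ (e : K) (CFC.abs A e)).re ≤
        (inner ℂ (e : K) (U (A e))).re + δ := by
      intro e _
      have h3 : ‖inner ℂ (e : K) ((CFC.abs A - U * A) e)‖ ≤ δ := by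
        refine (norm_inner_le_norm _ _).trans ?_
        rw [hnorm e, one_mul]
        refine ((CFC.abs A - U * A).le_opNorm _).trans ?_
        rw [hnorm e, mul_one]; exact hdiff
      have h4 := (Complex.re_le_norm _).trans h3
      simp only [_root_.sub_apply, inner_sub_right, Complex.sub_re] at h4
      have h5 : (U * A) (e : K) = U (A e) := rfl
      rw [h5] at h4
      linarith
    calc _ ≤ ∑ e ∈ s, ((inner ℂ (e : K) (U (A e))).re + δ) := Finset.sum_le_sum h2
      _ ≤ C + s.card * δ := by rw [Finset.sum_add_distrib]; simp; linarith
  unfold traceNorm opTrace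
  rw [ENNReal.tsum_eq_iSup_sum]
  refine iSup_le fun s => ?_
  rw [← ENNReal.ofReal_sum_of_nonneg (f := fun e : (exists_hilbertBasis ℂ K).choose =>
    (inner ℂ (e : K) (CFC.abs A e)).re) fun e _ => habs e]
  refine ENNReal.ofReal_le_ofReal ?_
  refine le_of_forall_pos_le_add fun δ hδ => ?_
  -- Each of the `s.card` basis vectors contributes an error of at most the chosen parameter; the `+
  -- 1` covers the empty set.
  refine (key s (δ / (s.card + 1)) (by positivity)).trans ?_
  have : (s.card : ℝ) * (δ / (s.card + 1)) ≤ δ := by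
    rw [mul_div_assoc', div_le_iff₀ (by positivity)]
    nlinarith
  linarith

end TraceNorm

/-- The compression of an operator on `ℂ^ι ⊗ H` to the `i`-th diagonal block. -/
def diagBlock {ι H : Type*} [Fintype ι] [NormedAddCommGroup H] [InnerProductSpace ℂ H]
    [DecidableEq ι] (U : PiLp 2 (fun _ : ι => H) →L[ℂ] PiLp 2 (fun _ : ι => H)) (i : ι) :
    H →L[ℂ] H :=
  LinearMap.mkContinuous
    { toFun := fun x => U (PiLp.single 2 i x) i
      map_add' := fun x y => by simp [PiLp.single_add]
      map_smul' := fun r x => by 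
        have h : PiLp.single 2 i (r • x) = r • PiLp.single 2 i x (β := fun _ : ι => H) := by
          ext j; by_cases h : j = i <;> simp [h]
        simp [h] } ‖U‖ fun x => by
    refine (PiLp.norm_apply_le (U (PiLp.single 2 i x)) i).trans ((U.le_opNorm _).trans ?_)
    simp

/-! ### Classical-quantum operators tested block by block. -/

section CQ

variable {ι H : Type*} [Fintype ι] [NormedAddCommGroup H] [InnerProductSpace ℂ H]

lemma inner_piLp_single_left [DecidableEq ι] (i : ι) (x : H) (v : PiLp 2 (fun _ : ι => H)) :
    inner ℂ (PiLp.single 2 i x) v = inner ℂ x (v i) := by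
  rw [PiLp.inner_apply, Finset.sum_eq_single i]
  · simp
  · intro j _ hj; simp [hj]
  · simp

lemma norm_diagBlock_le [DecidableEq ι] (U : PiLp 2 (fun _ : ι => H) →L[ℂ] PiLp 2 (fun _ : ι => H))
    (i : ι) : ‖diagBlock U i‖ ≤ ‖U‖ :=
  LinearMap.mkContinuous_norm_le _ (norm_nonneg U) _

lemma inner_diagBlock [DecidableEq ι] (U : PiLp 2 (fun _ : ι => H) →L[ℂ] PiLp 2 (fun _ : ι => H))
    (i : ι) (x y : H) :
    inner ℂ x (diagBlock U i y) = inner ℂ (PiLp.single 2 i x) (U (PiLp.single 2 i y)) := by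
  rw [inner_piLp_single_left]; rfl

variable [CompleteSpace H]

lemma isSelfAdjoint_diagBlock [DecidableEq ι]
    {U : PiLp 2 (fun _ : ι => H) →L[ℂ] PiLp 2 (fun _ : ι => H)}
    (hU : IsSelfAdjoint U) (i : ι) : IsSelfAdjoint (diagBlock U i) := by
  rw [ContinuousLinearMap.isSelfAdjoint_iff_isSymmetric] at hU ⊢
  intro x y
  have h1 := hU (PiLp.single 2 i x) (PiLp.single 2 i y)
  simp only [ContinuousLinearMap.coe_coe] at h1 ⊢
  rw [inner_diagBlock, ← h1, ← inner_conj_symm, inner_diagBlock, inner_conj_symm]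

/-- A dual bound on the trace norm of a classical-quantum operator. -/
theorem traceNorm_cqOp_le {W : Type*} {a : W → H} (ha : Summable fun w => ‖a w‖ ^ 2)
    {c : W → ι → ℝ} {B : ℝ} (hc : ∀ w i, |c w i| ≤ B) {X : ι → H →L[ℂ] H}
    (hX : ∀ i, X i = ∑' w, (c w i : ℂ) • InnerProductSpace.rankOne ℂ (a w) (a w)) {C : ℝ}
    (h : ∀ U : ι → H →L[ℂ] H, (∀ i, IsSelfAdjoint (U i)) → (∀ i, ‖U i‖ ≤ 1) →
      ∑' w, ∑ i, c w i * (inner ℂ (a w) (U i (a w))).re ≤ C) :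
    traceNorm (cqOp X) ≤ ENNReal.ofReal C := by
  classical
  -- The vector `a w` placed in block `i`. In terms of these vectors `cqOp X` is itself a weighted
  -- sum of rank-one operators, so the trace formula applies to it.
  set x : W × ι → PiLp 2 (fun _ : ι => H) := fun p => PiLp.single 2 p.2 (a p.1) with hx
  have hxn : Summable fun p => ‖x p‖ ^ 2 := by
    simp only [hx, PiLp.norm_single]
    rw [summable_prod_of_nonneg (fun p => sq_nonneg _)]
    refine ⟨fun w => (hasSum_fintype _).summable, ?_⟩
    simp only [tsum_fintype, Finset.sum_const]
    simpa using ha.mul_left _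
  have hXs : ∀ i, Summable fun w => (c w i : ℂ) • InnerProductSpace.rankOne ℂ (a w) (a w) := by
    intro i
    refine Summable.of_norm_bounded (ha.mul_left B) fun w => ?_
    rw [norm_smul, InnerProductSpace.norm_rankOne, ← sq, Complex.norm_real]
    exact mul_le_mul_of_nonneg_right (hc w i) (sq_nonneg _)
  have hXv : ∀ i v, HasSum (fun w => ((c w i : ℂ) * inner ℂ (a w) v) • a w) (X i v) := by
    intro i v
    have := (hXs i).hasSum.mapL (ContinuousLinearMap.apply ℂ H v)
    rw [← hX i] at this
    refine this.congr_fun fun w => ?_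
    simp [InnerProductSpace.rankOne_apply, mul_smul]
  have hA : ∀ v, HasSum (fun p : W × ι => ((c p.1 p.2 : ℂ) * inner ℂ (x p) v) • x p)
      (cqOp X v) := by
    intro v
    have hsm : Summable (fun p : W × ι => ((c p.1 p.2 : ℂ) * inner ℂ (x p) v) • x p) := by
      refine Summable.of_norm_bounded (hxn.mul_left (B * ‖v‖)) fun p => ?_
      rw [norm_smul, norm_mul, Complex.norm_real]
      calc _ ≤ B * (‖x p‖ * ‖v‖) * ‖x p‖ := by
            gcongr
            · exact (abs_nonneg _).trans (hc p.1 p.2)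
            · exact hc _ _
            · exact norm_inner_le_norm _ _
        _ = _ := by ring
    convert hsm.hasSum
    ext i
    have h1 : (cqOp X v) i = X i (v i) := rfl
    have h2 := hsm.hasSum.mapL (PiLp.proj 2 (fun _ : ι => H) i : _ →L[ℂ] H)
    rw [h1]
    have h3 := h2.prod_fiberwise fun w => hasSum_fintype _
    refine (hXv i (v i)).unique (h3.congr_fun fun w => ?_)
    rw [Finset.sum_eq_single i]
    · simp [hx, inner_piLp_single_left]
    · intro j _ hj
      simp [hx, Ne.symm hj]
    · simp
  refine traceNorm_le_of_forall_selfAdjoint_contraction (isSelfAdjoint_of_hasSum_rankOne hA)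
    fun U hU hU1 => ?_
  obtain ⟨b, hb⟩ := (exists_hilbertBasis ℂ (PiLp 2 (fun _ : ι => H))).choose_spec
  have hs := HilbertBasis.hasSum_trace_rankOne b hxn (fun p => hc p.1 p.2) hA U
  rw [hb] at hs
  refine ⟨_, ?_, hs⟩
  -- Every vector of the family lives in a single block, so the trace only sees the diagonal blocks
  -- of `U`, and these are again self-adjoint contractions.
  refine le_of_eq_of_le ?_ (h (diagBlock U) (fun i => isSelfAdjoint_diagBlock hU i)
    fun i => (norm_diagBlock_le U i).trans hU1)
  have hsum : Summable fun p : W × ι => c p.1 p.2 * (inner ℂ (x p) (U (x p))).re := by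
    refine Summable.of_norm_bounded (hxn.mul_left B) fun p => ?_
    rw [norm_mul, Real.norm_eq_abs, Real.norm_eq_abs]
    refine mul_le_mul (hc _ _) ?_ (abs_nonneg _) ((abs_nonneg _).trans (hc p.1 p.2))
    refine (Complex.abs_re_le_norm _).trans ((norm_inner_le_norm _ _).trans ?_)
    rw [sq]
    refine mul_le_mul_of_nonneg_left ((U.le_of_opNorm_le hU1 _).trans (one_mul _).le)
      (norm_nonneg _)
  rw [hsum.tsum_prod' fun w => (hasSum_fintype _).summable]
  refine tsum_congr fun w => ?_
  rw [tsum_fintype]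
  refine Finset.sum_congr rfl fun i _ => ?_
  rw [inner_diagBlock]

end CQ

/-! ### A Cauchy–Schwarz inequality weighted by powers of `∑ |x_w⟩⟨x_w|`. -/

section Decoupling

variable {H : Type*} [NormedAddCommGroup H] [InnerProductSpace ℂ H]

lemma ofReal_norm_sq (z : ℂ) : (‖z‖ : ℂ) ^ 2 = starRingEnd ℂ z * z := (RCLike.conj_mul z).symm

lemma ofReal_norm_sq_eq_inner (v : H) : (‖v‖ : ℂ) ^ 2 = inner ℂ v v :=
  (inner_self_eq_norm_sq_to_K v).symm

/-- Principal axes of a finite family of vectors. -/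
lemma exists_principal_axes {W : Type*} [Fintype W] (x : W → H) :
    ∃ (n : ℕ) (e : Fin n → H) (r : Fin n → ℝ) (X : W → Fin n → ℂ),
      Orthonormal ℂ e ∧ (∀ i, 0 ≤ r i) ∧ (∀ w, x w = ∑ i, X w i • e i) ∧
      ∀ i j, ∑ w, star (X w i) * X w j = if i = j then ((r i ^ 4 : ℝ) : ℂ) else 0 := by
  classical
  set E : Submodule ℂ H := Submodule.span ℂ (Set.range x) with hE
  have : FiniteDimensional ℂ E := FiniteDimensional.span_of_finite ℂ (Set.finite_range x)
  set x' : W → E := fun w => ⟨x w, Submodule.subset_span ⟨w, rfl⟩⟩ with hx'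
  set T : E →ₗ[ℂ] E := ∑ w, (InnerProductSpace.rankOne ℂ (x' w) (x' w) : E →L[ℂ] E).toLinearMap with hT
  have hTv : ∀ u v, inner ℂ u (T v) = ∑ w, inner ℂ u (x' w) * inner ℂ (x' w) v := by
    intro u v
    simp [hT, LinearMap.sum_apply, InnerProductSpace.rankOne_apply, mul_comm]
  have hsym : T.IsSymmetric := by
    intro u v
    rw [← inner_conj_symm, hTv, hTv, map_sum]
    refine Finset.sum_congr rfl fun w _ => ?_
    rw [map_mul, inner_conj_symm, inner_conj_symm, mul_comm]
  set b := hsym.eigenvectorBasis rfl with hb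
  set t := hsym.eigenvalues rfl with ht
  have hsum : ∀ i j, ∑ w, star (inner ℂ (b i) (x' w)) * inner ℂ (b j) (x' w) =
      if i = j then (t i : ℂ) else 0 := by
    intro i j
    have h1 := hTv (b j) (b i)
    rw [hb, hsym.apply_eigenvectorBasis rfl i, inner_smul_right, ← hb,
      orthonormal_iff_ite.mp b.orthonormal j i] at h1
    rw [show (if i = j then (t i : ℂ) else 0) = t i * (if j = i then 1 else 0) by
      by_cases h : i = j <;> simp [h, eq_comm]]
    refine Eq.trans ?_ h1.symm
    refine Finset.sum_congr rfl fun w _ => ?_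
    rw [mul_comm, RCLike.star_def, inner_conj_symm]
  have ht0 : ∀ i, 0 ≤ t i := by
    intro i
    have h1 := hsum i i
    rw [if_pos rfl] at h1
    have h2 : (t i : ℂ) = ((∑ w, ‖inner ℂ (b i) (x' w)‖ ^ 2 : ℝ) : ℂ) := by
      rw [← h1]; push_cast
      refine Finset.sum_congr rfl fun w _ => ?_
      rw [RCLike.star_def, RCLike.conj_mul]; rfl
    rw [Complex.ofReal_inj.mp h2]
    positivity
  -- `r i` is the fourth root of the eigenvalue `t i`, because the application conjugates by the
  -- quarter power of `σ`.
  refine ⟨_, fun i => (b i : H), fun i => √√(t i), fun w i => inner ℂ (b i) (x' w), ?_,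
    fun i => Real.sqrt_nonneg _, fun w => ?_, fun i j => ?_⟩
  · exact b.orthonormal.comp_linearIsometry E.subtypeₗᵢ
  · have h1 := congrArg (Subtype.val) (b.sum_repr' (x' w))
    simpa using h1.symm
  · rw [hsum i j, show √√(t i) ^ 4 = t i by
      rw [show (4 : ℕ) = 2 * 2 by norm_num, pow_mul, Real.sq_sqrt (Real.sqrt_nonneg _),
        Real.sq_sqrt (ht0 i)]]

/-- The kernel `|⟨x_w, σ^{-1/2} x_v⟩|²`, where `σ = ∑_w |x_w⟩⟨x_w|`. -/
lemma exists_collision_kernel {W : Type*} [Fintype W] (x : W → H) :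
    ∃ K : W → W → ℝ,
      (∀ w, ∃ u : H, (∀ v, K w v = ‖inner ℂ u (x v)‖ ^ 2) ∧ ∑ v, K w v = ‖x w‖ ^ 2) ∧
      ∀ (V : H →ₗ[ℂ] H), V.IsSymmetric → ∀ c : W → ℝ,
        0 ≤ ∑ w, ∑ v, c w * c v * K w v ∧
        (∑ w, c w * (inner ℂ (x w) (V (x w))).re) ^ 2 ≤
          (∑ w, ∑ v, c w * c v * K w v) * ∑ w, ‖V (x w)‖ ^ 2 := by
  classical
  obtain ⟨n, e, r, X, he, hr, hx, hX⟩ := exists_principal_axes x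
  -- Along an axis with eigenvalue zero all vectors vanish, so the value `0` that division by `r i =
  -- 0` produces below is the right one.
  have hX0 : ∀ i, r i = 0 → ∀ w, X w i = 0 := by
    intro i hi w
    have h1 := hX i i
    rw [if_pos rfl, hi] at h1
    have h2 : ∑ w, ‖X w i‖ ^ 2 = 0 := by
      have h3 : ((∑ w, ‖X w i‖ ^ 2 : ℝ) : ℂ) = 0 := by
        push_cast
        rw [← show ((((0:ℝ) ^ 4 : ℝ)) : ℂ) = 0 by simp, ← h1]
        refine Finset.sum_congr rfl fun w _ => ?_
        rw [RCLike.star_def, RCLike.conj_mul]; rfl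
      exact_mod_cast h3
    have h3 := (Finset.sum_eq_zero_iff_of_nonneg fun w _ => sq_nonneg _).mp h2 w (Finset.mem_univ _)
    simpa using h3
  have hein : ∀ i (f : Fin n → ℂ), inner ℂ (e i) (∑ j, f j • e j) = f i := fun i f =>
    he.inner_right_fintype f i
  -- Coordinates of `σ^(-1/4) x_w`; their Gram sums over `w` are those of `σ^(1/2)`.
  set P : W → Fin n → ℂ := fun w i => X w i / r i with hP
  have hXP : ∀ w i, X w i = r i * P w i := by
    intro w i
    by_cases h : r i = 0
    · simp [h, hX0 i h w]
    · have h' : (r i : ℂ) ≠ 0 := by exact_mod_cast h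
      rw [hP]; field_simp
  have hP2 : ∀ i j, ∑ w, star (P w i) * P w j = if i = j then ((r i ^ 2 : ℝ) : ℂ) else 0 := by
    intro i j
    have h1 : ∑ w, star (P w i) * P w j = (∑ w, star (X w i) * X w j) / (r i * r j) := by
      rw [Finset.sum_div]
      refine Finset.sum_congr rfl fun w _ => ?_
      simp [hP, div_mul_div_comm]
    rw [h1, hX]
    by_cases h : i = j
    · subst h
      by_cases h0 : r i = 0
      · simp [h0]
      · have h' : (r i : ℂ) ≠ 0 := by exact_mod_cast h0
        simp only [if_true]; push_cast; field_simp
    · simp [h]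
  set K : W → W → ℝ := fun w v => ‖∑ i, star (P w i) * P v i‖ ^ 2 with hK
  -- The witness is `u = σ^(-1/2) x_w`, for which `∑_v |⟨u, x_v⟩|² = ⟨u, σ u⟩ = ‖x_w‖²`.
  refine ⟨K, fun w => ⟨∑ i, (X w i / (r i) ^ 2) • e i, fun v => ?_, ?_⟩, fun V hV c => ?_⟩
  · simp only [hK]
    congr 2
    rw [hx v, sum_inner]
    refine Finset.sum_congr rfl fun i _ => ?_
    rw [inner_smul_left, hein, hP]
    simp
    ring
  · rw [← Complex.ofReal_inj]
    calc ((∑ v, K w v : ℝ) : ℂ)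
        = ∑ v, ∑ i, ∑ j, (star (P w j) * P w i) * (star (P v i) * P v j) := by
          push_cast
          refine Finset.sum_congr rfl fun v _ => ?_
          simp only [hK, Complex.ofReal_pow]
          rw [ofReal_norm_sq, map_sum, Finset.sum_mul_sum]
          refine Finset.sum_congr rfl fun i _ => Finset.sum_congr rfl fun j _ => ?_
          simp; ring
      _ = ∑ i, ∑ j, (star (P w j) * P w i) * ∑ v, (star (P v i) * P v j) := by
          rw [Finset.sum_comm]
          refine Finset.sum_congr rfl fun i _ => ?_
          rw [Finset.sum_comm]
          simp_rw [Finset.mul_sum]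
      _ = ∑ i, star (X w i) * X w i := by
          refine Finset.sum_congr rfl fun i _ => ?_
          simp only [hP2, mul_ite, mul_zero, Finset.sum_ite_eq, Finset.mem_univ, if_true, hXP]
          simp; ring
      _ = ((‖x w‖ ^ 2 : ℝ) : ℂ) := by
          push_cast
          rw [ofReal_norm_sq_eq_inner, hx w]
          rw [sum_inner]
          refine Finset.sum_congr rfl fun i _ => ?_
          rw [inner_smul_left, hein]; rfl
  · have hVx : ∀ w, V (x w) = ∑ j, X w j • V (e j) := fun w => by rw [hx w]; simp
    have hS : ∑ w, ‖V (x w)‖ ^ 2 = ∑ i, r i ^ 4 * ‖V (e i)‖ ^ 2 := by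
      rw [← Complex.ofReal_inj]
      calc ((∑ w, ‖V (x w)‖ ^ 2 : ℝ) : ℂ)
          = ∑ w, ∑ i, ∑ j, (star (X w i) * X w j) * inner ℂ (V (e i)) (V (e j)) := by
            push_cast
            refine Finset.sum_congr rfl fun w _ => ?_
            rw [ofReal_norm_sq_eq_inner, hVx, sum_inner]
            refine Finset.sum_congr rfl fun i _ => ?_
            rw [inner_sum]
            refine Finset.sum_congr rfl fun j _ => ?_
            rw [inner_smul_left, inner_smul_right]
            simp; ring
        _ = ∑ i, ∑ j, (∑ w, star (X w i) * X w j) * inner ℂ (V (e i)) (V (e j)) := by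
            rw [Finset.sum_comm]
            refine Finset.sum_congr rfl fun i _ => ?_
            rw [Finset.sum_comm]
            simp_rw [Finset.sum_mul]
        _ = _ := by
            push_cast
            refine Finset.sum_congr rfl fun i _ => ?_
            simp only [hX, ite_mul, zero_mul, Finset.sum_ite_eq, Finset.mem_univ, if_true]
            rw [inner_self_eq_norm_sq_to_K]
            simp
    -- `N` is the matrix of `σ^(1/4) V σ^(1/4)` and `M` collects the coefficients on the vectors
    -- `σ^(-1/4) x_w`. The tested sum is their Hilbert–Schmidt pairing: `‖M‖²` is the quadratic form
    -- of `K`, and `‖N‖²` is compared with `tr (σ V²)`.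
    set N : Fin n → Fin n → ℂ := fun i j => r i * r j * inner ℂ (e i) (V (e j)) with hN
    set M : Fin n → Fin n → ℂ := fun i j => ∑ w, c w * (star (P w i) * P w j) with hM
    have hNM : ((∑ w, c w * (inner ℂ (x w) (V (x w))).re : ℝ)) = (∑ i, ∑ j, M i j * N i j).re := by
      have h1 : (∑ w, (c w : ℂ) * inner ℂ (x w) (V (x w))) = ∑ i, ∑ j, M i j * N i j := by
        simp only [hM, Finset.sum_mul]
        rw [show (∑ i, ∑ j, ∑ w, (c w : ℂ) * (star (P w i) * P w j) * N i j) =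
          ∑ w, ∑ i, ∑ j, (c w : ℂ) * (star (P w i) * P w j) * N i j by
            rw [Finset.sum_comm (s := (Finset.univ : Finset W))]
            refine Finset.sum_congr rfl fun i _ => ?_
            rw [Finset.sum_comm]]
        refine Finset.sum_congr rfl fun w _ => ?_
        rw [hVx, hx w, sum_inner, Finset.mul_sum]
        refine Finset.sum_congr rfl fun i _ => ?_
        rw [inner_sum, Finset.mul_sum]
        refine Finset.sum_congr rfl fun j _ => ?_
        rw [inner_smul_left, inner_smul_right, hXP w i, hXP w j, hN]
        simp; ring
      rw [← h1, Complex.re_sum]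
      simp
    have hMsum : ∑ i, ∑ j, ‖M i j‖ ^ 2 = ∑ w, ∑ v, c w * c v * K w v := by
      rw [← Complex.ofReal_inj]
      push_cast
      have h1 : ∀ i j, ((‖M i j‖ : ℂ)) ^ 2 = ∑ w, ∑ v, (c w * c v : ℂ) *
          ((P w i * star (P w j)) * (star (P v i) * P v j)) := by
        intro i j
        rw [ofReal_norm_sq, hM, map_sum, Finset.sum_mul_sum]
        refine Finset.sum_congr rfl fun w _ => Finset.sum_congr rfl fun v _ => ?_
        simp; ring
      have h2 : ∀ w v, ((c w : ℂ) * c v * (K w v : ℝ)) = ∑ i, ∑ j, (c w * c v : ℂ) *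
          ((P w i * star (P w j)) * (star (P v i) * P v j)) := by
        intro w v
        simp only [hK, Complex.ofReal_pow]
        rw [ofReal_norm_sq, map_sum, Finset.sum_mul_sum, Finset.mul_sum]
        refine Finset.sum_congr rfl fun i _ => ?_
        rw [Finset.mul_sum]
        refine Finset.sum_congr rfl fun j _ => ?_
        simp only [map_mul, RCLike.star_def, Complex.conj_conj]; ring
      simp_rw [h1, h2]
      calc _ = ∑ i, ∑ w, ∑ j, ∑ v, (c w * c v : ℂ) *
          ((P w i * star (P w j)) * (star (P v i) * P v j)) :=
            Finset.sum_congr rfl fun i _ => Finset.sum_comm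
        _ = ∑ w, ∑ i, ∑ v, ∑ j, (c w * c v : ℂ) *
          ((P w i * star (P w j)) * (star (P v i) * P v j)) := by
            rw [Finset.sum_comm]
            exact Finset.sum_congr rfl fun w _ => Finset.sum_congr rfl fun i _ => Finset.sum_comm
        _ = _ := Finset.sum_congr rfl fun w _ => Finset.sum_comm
    have hNsum : ∑ i, ∑ j, ‖N i j‖ ^ 2 ≤ ∑ w, ‖V (x w)‖ ^ 2 := by
      have hsymm : ∀ i j, ‖inner ℂ (e i) (V (e j))‖ = ‖inner ℂ (e j) (V (e i))‖ := by
        intro i j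
        rw [← hV, norm_inner_symm]
      have hb : ∀ j, ∑ i, ‖inner ℂ (e i) (V (e j))‖ ^ 2 ≤ ‖V (e j)‖ ^ 2 := fun j =>
        he.sum_inner_products_le _
      -- The inequality `r_i² r_j² ≤ (r_i⁴ + r_j⁴) / 2` replaces `tr (σ^(1/2) V σ^(1/2) V)` by `tr
      -- (σ V²)`. Symmetry of `V` makes the two halves equal, and Bessel's inequality sums each row.
      have h1 : ∀ i j, ‖N i j‖ ^ 2 ≤ (r i ^ 4 * ‖inner ℂ (e j) (V (e i))‖ ^ 2 +
          r j ^ 4 * ‖inner ℂ (e i) (V (e j))‖ ^ 2) / 2 := by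
        intro i j
        simp only [hN, norm_mul, Complex.norm_real, Real.norm_eq_abs, abs_of_nonneg (hr _)]
        rw [← hsymm i j]
        nlinarith [mul_nonneg (sq_nonneg (r i ^ 2 - r j ^ 2))
          (sq_nonneg ‖inner ℂ (e i) (V (e j))‖)]
      calc ∑ i, ∑ j, ‖N i j‖ ^ 2
          ≤ ∑ i, ∑ j, (r i ^ 4 * ‖inner ℂ (e j) (V (e i))‖ ^ 2 +
            r j ^ 4 * ‖inner ℂ (e i) (V (e j))‖ ^ 2) / 2 :=
            Finset.sum_le_sum fun i _ => Finset.sum_le_sum fun j _ => h1 i j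
        _ = ∑ i, r i ^ 4 * ∑ j, ‖inner ℂ (e j) (V (e i))‖ ^ 2 := by
            simp_rw [add_div, Finset.sum_add_distrib]
            rw [Finset.sum_comm (f := fun i j => r j ^ 4 * ‖inner ℂ (e i) (V (e j))‖ ^ 2 / 2)]
            rw [← Finset.sum_add_distrib]
            refine Finset.sum_congr rfl fun i _ => ?_
            rw [← Finset.sum_div, ← Finset.mul_sum]
            ring
        _ ≤ ∑ i, r i ^ 4 * ‖V (e i)‖ ^ 2 :=
            Finset.sum_le_sum fun i _ => mul_le_mul_of_nonneg_left (hb i) (by have := hr i; positivity)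
        _ = _ := hS.symm
    refine ⟨by rw [← hMsum]; positivity, ?_⟩
    rw [hNM]
    have h3 : |(∑ i, ∑ j, M i j * N i j).re| ≤ ∑ p : Fin n × Fin n, ‖M p.1 p.2‖ * ‖N p.1 p.2‖ := by
      refine (Complex.abs_re_le_norm _).trans ?_
      rw [← Fintype.sum_prod_type' (f := fun i j => M i j * N i j)]
      refine (norm_sum_le _ _).trans (Finset.sum_le_sum fun p _ => (norm_mul_le _ _))
    calc _ ≤ (∑ p : Fin n × Fin n, ‖M p.1 p.2‖ * ‖N p.1 p.2‖) ^ 2 := by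
          rw [← sq_abs]; exact pow_le_pow_left₀ (abs_nonneg _) h3 2
      _ ≤ (∑ p : Fin n × Fin n, ‖M p.1 p.2‖ ^ 2) * ∑ p : Fin n × Fin n, ‖N p.1 p.2‖ ^ 2 :=
          Finset.sum_mul_sq_le_sq_mul_sq _ _ _
      _ ≤ _ := by
          rw [Fintype.sum_prod_type' (f := fun i j => ‖M i j‖ ^ 2),
            Fintype.sum_prod_type' (f := fun i j => ‖N i j‖ ^ 2), hMsum]
          refine mul_le_mul_of_nonneg_left hNsum ?_
          rw [← hMsum]; positivity

end Decoupling

/-! ### Leftover hashing and the decoupling bound. -/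

section Hashing

variable {H : Type*} [NormedAddCommGroup H] [InnerProductSpace ℂ H]
  {Ω Z 𝒦 W : Type*} [Fintype Ω] [Fintype Z] [Nonempty Z] [DecidableEq Z] [DecidableEq 𝒦] [Fintype W]

/-- A leftover hash lemma for a family of vectors, in dual form. -/
theorem leftover_hash {p : Ω → ℝ} (hp0 : ∀ G, 0 ≤ p G) (hp1 : ∑ G, p G = 1)
    {hash : Ω → 𝒦 → Z}
    (huniv : ∀ k k', k ≠ k' → ∑ G, (if hash G k = hash G k' then p G else 0) ≤ (Fintype.card Z : ℝ)⁻¹)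
    {x : W → H} {κ : W → 𝒦} {a : W → ℝ} (ha0 : ∀ w, 0 ≤ a w) (ha1 : ∀ w, a w ≤ 1) {lam : ℝ}
    (hdom : ∀ k u, ∑ w, (if κ w = k then ‖inner ℂ u (x w)‖ ^ 2 else 0) ≤
      lam * ∑ w, ‖inner ℂ u (x w)‖ ^ 2)
    {V : Ω → Z → H →ₗ[ℂ] H} (hV : ∀ G k, (V G k).IsSymmetric) {s : ℝ} (hs : 0 < s) :
    ∑ G, p G * ∑ w, a w * ((inner ℂ (x w) (V G (hash G (κ w)) (x w))).re -
        (Fintype.card Z : ℝ)⁻¹ * ∑ k, (inner ℂ (x w) (V G k (x w))).re) ≤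
      (s * (lam * ∑ w, ‖x w‖ ^ 2) + s⁻¹ * ∑ G, p G * ∑ k, ∑ w, ‖V G k (x w)‖ ^ 2) / 2 := by
  obtain ⟨K, hK1, hK2⟩ := exists_collision_kernel x
  have hK0 : ∀ w v, 0 ≤ K w v := fun w v => by
    obtain ⟨u, hu, -⟩ := hK1 w; rw [hu]; positivity
  set M : ℝ := (Fintype.card Z : ℝ) with hM
  have hMpos : 0 < M := by rw [hM]; exact_mod_cast Fintype.card_pos
  -- The centred indicator of the event that the hash value is `k`, weighted by `a`.
  set c : Ω → Z → W → ℝ := fun G k w => a w * ((if hash G (κ w) = k then 1 else 0) - M⁻¹) with hc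
  have hterm : ∀ G, ∑ w, a w * ((inner ℂ (x w) (V G (hash G (κ w)) (x w))).re -
        M⁻¹ * ∑ k, (inner ℂ (x w) (V G k (x w))).re) =
      ∑ k, ∑ w, c G k w * (inner ℂ (x w) (V G k (x w))).re := by
    intro G
    rw [Finset.sum_comm]
    refine Finset.sum_congr rfl fun w _ => ?_
    simp only [hc, mul_assoc, ← Finset.mul_sum, sub_mul, ite_mul, one_mul, zero_mul,
      Finset.sum_sub_distrib, Finset.sum_ite_eq, Finset.mem_univ, if_true]
  -- The geometric mean is relaxed to an arithmetic mean with a free parameter `s`. The bound is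
  -- then linear and can be averaged over `G` and summed over `k`.
  have hbound : ∀ G k, ∑ w, c G k w * (inner ℂ (x w) (V G k (x w))).re ≤
      (s * (∑ w, ∑ v, c G k w * c G k v * K w v) + s⁻¹ * ∑ w, ‖V G k (x w)‖ ^ 2) / 2 := by
    intro G k
    obtain ⟨hA, hAB⟩ := hK2 (V G k) (hV G k) (c G k)
    set A := ∑ w, ∑ v, c G k w * c G k v * K w v
    set B := ∑ w, ‖V G k (x w)‖ ^ 2
    have hB : 0 ≤ B := by positivity
    have hsB : s * A * (s⁻¹ * B) = A * B := by field_simp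
    refine (le_abs_self _).trans (abs_le_of_sq_le_sq ?_ (by positivity))
    nlinarith [sq_nonneg (s * A - s⁻¹ * B)]
  -- Summing out `k` leaves the collision indicator minus the collision probability of a uniform
  -- value.
  have hcc : ∀ G w v, ∑ k, c G k w * c G k v =
      a w * a v * ((if hash G (κ w) = hash G (κ v) then 1 else 0) - M⁻¹) := by
    intro G w v
    have h1 : ∀ k, c G k w * c G k v = a w * a v *
        ((if hash G (κ w) = k then (if hash G (κ v) = k then 1 else 0) else 0)
        - M⁻¹ * (if hash G (κ w) = k then 1 else 0) - M⁻¹ * (if hash G (κ v) = k then 1 else 0)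
        + M⁻¹ * M⁻¹) := by
      intro k
      simp only [hc]
      split_ifs <;> ring
    simp_rw [h1]
    rw [← Finset.mul_sum]
    congr 1
    simp only [Finset.sum_add_distrib, Finset.sum_sub_distrib, ← Finset.mul_sum,
      Finset.sum_ite_eq, Finset.mem_univ, if_true, Finset.sum_const, Finset.card_univ,
      nsmul_eq_mul, ← hM]
    rw [if_congr (eq_comm (a := hash G (κ v))) rfl rfl]
    field_simp
    ring
  have hA : ∑ G, p G * ∑ k, ∑ w, ∑ v, c G k w * c G k v * K w v ≤ lam * ∑ w, ‖x w‖ ^ 2 := by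
    have h1 : ∑ G, p G * ∑ k, ∑ w, ∑ v, c G k w * c G k v * K w v =
        ∑ w, ∑ v, a w * a v * K w v *
          (∑ G, (if hash G (κ w) = hash G (κ v) then p G else 0) - M⁻¹) := by
      have h2 : ∀ G, ∑ k, ∑ w, ∑ v, c G k w * c G k v * K w v =
          ∑ w, ∑ v, (a w * a v * ((if hash G (κ w) = hash G (κ v) then 1 else 0) - M⁻¹)) * K w v := by
        intro G
        rw [Finset.sum_comm]
        refine Finset.sum_congr rfl fun w _ => ?_
        rw [Finset.sum_comm]
        refine Finset.sum_congr rfl fun v _ => ?_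
        rw [← hcc, Finset.sum_mul]
      simp_rw [h2, Finset.mul_sum]
      rw [Finset.sum_comm]
      refine Finset.sum_congr rfl fun w _ => ?_
      rw [Finset.sum_comm]
      refine Finset.sum_congr rfl fun v _ => ?_
      rw [show M⁻¹ = ∑ G, p G * M⁻¹ by rw [← Finset.sum_mul, hp1, one_mul],
        ← Finset.sum_sub_distrib, Finset.mul_sum]
      rw [← show M⁻¹ = ∑ G, p G * M⁻¹ by rw [← Finset.sum_mul, hp1, one_mul]]
      refine Finset.sum_congr rfl fun G _ => ?_
      split_ifs <;> ring
    rw [h1]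
    -- On average over the hash function, pairs with different keys contribute nonpositively by
    -- universality. Only pairs with equal keys survive, and these are bounded by `hdom` at `u =
    -- σ^(-1/2) x_w`.
    have h3 : ∀ w v, a w * a v * K w v *
          (∑ G, (if hash G (κ w) = hash G (κ v) then p G else 0) - M⁻¹) ≤
        if κ v = κ w then K w v else 0 := by
      intro w v
      have haa : 0 ≤ a w * a v * K w v := mul_nonneg (mul_nonneg (ha0 w) (ha0 v)) (hK0 w v)
      by_cases h : κ v = κ w
      · rw [if_pos h]
        simp only [h, if_true, hp1]
        have h4 : a w * a v ≤ 1 := mul_le_one₀ (ha1 w) (ha0 v) (ha1 v)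
        have h5 : 0 < M⁻¹ := inv_pos.mpr hMpos
        nlinarith [mul_le_mul_of_nonneg_right h4 (hK0 w v)]
      · rw [if_neg h]
        exact mul_nonpos_of_nonneg_of_nonpos haa (sub_nonpos.mpr (huniv _ _ (Ne.symm h)))
    refine (Finset.sum_le_sum fun w _ => Finset.sum_le_sum fun v _ => h3 w v).trans ?_
    rw [Finset.mul_sum]
    refine Finset.sum_le_sum fun w _ => ?_
    obtain ⟨u, hu, hsum⟩ := hK1 w
    have := hdom (κ w) u
    simp_rw [← hu] at this
    rwa [hsum] at this
  calc _ = ∑ G, p G * ∑ k, ∑ w, c G k w * (inner ℂ (x w) (V G k (x w))).re := by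
        simp_rw [hterm]
    _ ≤ ∑ G, p G * ∑ k, (s * (∑ w, ∑ v, c G k w * c G k v * K w v) +
          s⁻¹ * ∑ w, ‖V G k (x w)‖ ^ 2) / 2 :=
        Finset.sum_le_sum fun G _ => mul_le_mul_of_nonneg_left
          (Finset.sum_le_sum fun k _ => hbound G k) (hp0 G)
    _ = (s * (∑ G, p G * ∑ k, ∑ w, ∑ v, c G k w * c G k v * K w v) +
          s⁻¹ * ∑ G, p G * ∑ k, ∑ w, ‖V G k (x w)‖ ^ 2) / 2 := by
        rw [Finset.mul_sum, Finset.mul_sum, ← Finset.sum_add_distrib, Finset.sum_div]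
        refine Finset.sum_congr rfl fun G _ => ?_
        rw [← Finset.sum_div, Finset.sum_add_distrib, ← Finset.mul_sum, ← Finset.mul_sum]
        ring
    _ ≤ _ := by gcongr

set_option maxHeartbeats 1000000 in
/-- The decoupling bound: `x` and `y` are the parts of a family of vectors without and with too many
phase errors, and `U` is a test of an eavesdropper who knows the hash function. -/
theorem decoupling [CompleteSpace H] {p : Ω → ℝ} (hp0 : ∀ G, 0 ≤ p G) (hp1 : ∑ G, p G = 1)
    {hash : Ω → 𝒦 → Z}
    (huniv : ∀ k k', k ≠ k' → ∑ G, (if hash G k = hash G k' then p G else 0) ≤ (Fintype.card Z : ℝ)⁻¹)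
    {x y : W → H} (hxy : ∑ w, (inner ℂ (x w) (y w)).re = 0)
    {κ : W → 𝒦} {a : W → ℝ} (ha0 : ∀ w, 0 ≤ a w) (ha1 : ∀ w, a w ≤ 1) {lam h : ℝ}
    (hdom : ∀ k u, ∑ w, (if κ w = k then ‖inner ℂ u (x w)‖ ^ 2 else 0) ≤
      lam * ∑ w, ‖inner ℂ u (x w)‖ ^ 2)
    (hh0 : 0 < h) (hh1 : h ≤ 1) (hlam : Fintype.card Z * lam ≤ h ^ 2)
    {U : Ω → Z → H →L[ℂ] H} (hU : ∀ G k, IsSelfAdjoint (U G k)) (hU1 : ∀ G k, ‖U G k‖ ≤ 1)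
    {θ : ℝ} (hθ0 : 0 ≤ θ) (hθ1 : θ ≤ 1) :
    ∑ G, p G * ∑ w, a w * ((inner ℂ (x w + y w) (U G (hash G (κ w)) (x w + y w))).re -
        (Fintype.card Z : ℝ)⁻¹ * ∑ k, (inner ℂ (x w + y w) (U G k (x w + y w))).re) / 2 ≤
      ∑ w, ‖y w‖ ^ 2 + θ ^ 2 * ∑ w, ‖x w‖ ^ 2 + (1 - θ ^ 2) * (h / 2 * ∑ w, ‖x w‖ ^ 2) +
        (1 - θ) * (√(1 + √2 * h) * √((∑ w, ‖y w‖ ^ 2) * ∑ w, ‖x w‖ ^ 2)) := by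
  set M : ℝ := (Fintype.card Z : ℝ) with hM
  have hMpos : 0 < M := by rw [hM]; exact_mod_cast Fintype.card_pos
  set q := ∑ w, ‖x w‖ ^ 2 with hq
  set ε := ∑ w, ‖y w‖ ^ 2 with hε
  have hq0 : 0 ≤ q := by positivity
  have hε0 : 0 ≤ ε := by positivity
  have hsymU : ∀ G k u v, inner ℂ (U G k u) v = inner ℂ u (U G k v) := fun G k =>
    (ContinuousLinearMap.isSelfAdjoint_iff_isSymmetric.mp (hU G k))
  have hUle : ∀ G k u, ‖U G k u‖ ≤ ‖u‖ := fun G k u =>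
    ((U G k).le_of_opNorm_le (hU1 G k) u).trans (one_mul _).le
  -- The test seen by a uniform key: the average of `U G k` over `k`.
  set Ub : Ω → H →L[ℂ] H := fun G => (M⁻¹ : ℂ) • ∑ k, U G k with hUb
  have hUbi : ∀ G u v, inner ℂ u (Ub G v) = (M⁻¹ : ℂ) * ∑ k, inner ℂ u (U G k v) := by
    intro G u v
    simp [hUb]
  have hUbre : ∀ G u v, (inner ℂ u (Ub G v)).re = M⁻¹ * ∑ k, (inner ℂ u (U G k v)).re := by
    intro G u v
    rw [hUbi, ← Complex.ofReal_inv, Complex.re_ofReal_mul, Complex.re_sum]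
  have hsymUb : ∀ G u v, inner ℂ (Ub G u) v = inner ℂ u (Ub G v) := by
    intro G u v
    rw [← inner_conj_symm, hUbi, hUbi, map_mul, map_sum]
    congr 1
    · simp
    · exact Finset.sum_congr rfl fun k _ => by rw [inner_conj_symm, hsymU]
  have hUble : ∀ G u, ‖Ub G u‖ ≤ ‖u‖ := by
    intro G u
    have h1 : Ub G u = (M⁻¹ : ℂ) • ∑ k, U G k u := by simp [hUb]
    rw [h1, norm_smul]
    have h2 : ‖∑ k, U G k u‖ ≤ M * ‖u‖ := by
      refine (norm_sum_le _ _).trans ((Finset.sum_le_sum fun k _ => hUle G k u).trans ?_)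
      simp [hM]
    have h3 : ‖(M⁻¹ : ℂ)‖ = M⁻¹ := by rw [norm_inv, Complex.norm_real, Real.norm_of_nonneg hMpos.le]
    rw [h3]
    calc _ ≤ M⁻¹ * (M * ‖u‖) := by gcongr
      _ = ‖u‖ := by field_simp
  -- Half the difference between the tests for the real and for a uniform key; it is again a
  -- self-adjoint contraction.
  set T : Ω → W → H → H := fun G w v => (1 / 2 : ℂ) • (U G (hash G (κ w)) v - Ub G v) with hT
  have hTre : ∀ G w u v, (inner ℂ u (T G w v)).re = ((inner ℂ u (U G (hash G (κ w)) v)).re -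
      (inner ℂ u (Ub G v)).re) / 2 := by
    intro G w u v
    simp only [hT, inner_smul_right, inner_sub_right]
    rw [show (1 / 2 : ℂ) = ((1 / 2 : ℝ) : ℂ) by norm_num, Complex.re_ofReal_mul, Complex.sub_re]
    ring
  have hTsym : ∀ G w u v, (inner ℂ u (T G w v)).re = (inner ℂ v (T G w u)).re := by
    intro G w u v
    rw [hTre, hTre, ← hsymU, ← hsymUb, ← inner_conj_symm, Complex.conj_re,
      ← inner_conj_symm (Ub G u), Complex.conj_re]
  have hTle : ∀ G w u, (inner ℂ u (T G w u)).re ≤ ‖u‖ ^ 2 := by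
    intro G w u
    rw [hTre]
    have h1 := (Complex.re_le_norm _).trans
      ((norm_inner_le_norm (𝕜 := ℂ) u (U G (hash G (κ w)) u)).trans
        (mul_le_mul_of_nonneg_left (hUle _ _ _) (norm_nonneg _)))
    have h2 := (neg_abs_le _).trans' (neg_le_neg ((Complex.abs_re_le_norm _).trans
      ((norm_inner_le_norm (𝕜 := ℂ) u (Ub G u)).trans
        (mul_le_mul_of_nonneg_left (hUble _ _) (norm_nonneg _)))))
    nlinarith
  have hTadd : ∀ G w u v, T G w (u + v) = T G w u + T G w v := by
    intro G w u v
    simp only [hT, map_add, ← smul_add]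
    congr 1; abel
  have hTnorm : ∀ G w v, ‖T G w v‖ ^ 2 = (‖U G (hash G (κ w)) v‖ ^ 2 + ‖Ub G v‖ ^ 2
      - 2 * (inner ℂ (U G (hash G (κ w)) v) (Ub G v)).re) / 4 := by
    intro G w v
    simp only [hT]
    rw [norm_smul, mul_pow, norm_sub_sq (𝕜 := ℂ)]
    norm_num
    ring
  have hTsmul : ∀ G w (c : ℂ) v, T G w (c • v) = c • T G w v := by
    intro G w c v
    simp only [hT, map_smul, ← smul_sub]
    rw [smul_comm]
  clear hT
  clear_value T
  -- The quadratic form of `T` on `x + y` splits into the good block `g`, the cross term `χ`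
  -- (counted twice) and the bad block `β`.
  set g := ∑ G, p G * ∑ w, a w * (inner ℂ (x w) (T G w (x w))).re with hg
  set χ := ∑ G, p G * ∑ w, a w * (inner ℂ (y w) (T G w (x w))).re with hχ
  set β := ∑ G, p G * ∑ w, a w * (inner ℂ (y w) (T G w (y w))).re with hβ
  have hD : ∑ G, p G * ∑ w, a w * ((inner ℂ (x w + y w) (U G (hash G (κ w)) (x w + y w))).re -
        M⁻¹ * ∑ k, (inner ℂ (x w + y w) (U G k (x w + y w))).re) / 2 = g + 2 * χ + β := by
    rw [hg, hχ, hβ, Finset.mul_sum, ← Finset.sum_add_distrib, ← Finset.sum_add_distrib]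
    refine Finset.sum_congr rfl fun G _ => ?_
    rw [mul_left_comm, ← mul_add, ← mul_add]
    congr 1
    rw [Finset.mul_sum, ← Finset.sum_add_distrib, ← Finset.sum_add_distrib]
    refine Finset.sum_congr rfl fun w _ => ?_
    rw [← hUbre, mul_div_assoc, ← hTre, hTadd, inner_add_left, inner_add_right, inner_add_right]
    simp only [Complex.add_re]
    rw [hTsym G w (x w) (y w)]
    ring
  -- The inequality `T ≤ 1` on `y + θ x`: the mixed term of the norm disappears in total by `hxy`.
  -- Part of the cross term is thereby absorbed without Cauchy–Schwarz.
  have hquad : β + 2 * θ * χ + θ ^ 2 * g ≤ ε + θ ^ 2 * q := by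
    have h1 : ∀ G w, a w * (inner ℂ (y w) (T G w (y w))).re +
        2 * θ * (a w * (inner ℂ (y w) (T G w (x w))).re) +
        θ ^ 2 * (a w * (inner ℂ (x w) (T G w (x w))).re) ≤
        ‖y w‖ ^ 2 + 2 * θ * (inner ℂ (x w) (y w)).re + θ ^ 2 * ‖x w‖ ^ 2 := by
      intro G w
      have h2 := hTle G w (y w + (θ : ℂ) • x w)
      have h4 : (inner ℂ (y w + (θ : ℂ) • x w) (T G w (y w + (θ : ℂ) • x w))).re =
          (inner ℂ (y w) (T G w (y w))).re + 2 * θ * (inner ℂ (y w) (T G w (x w))).re +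
          θ ^ 2 * (inner ℂ (x w) (T G w (x w))).re := by
        rw [hTadd, hTsmul, inner_add_left, inner_add_right, inner_add_right, inner_smul_left,
          inner_smul_left, inner_smul_right, inner_smul_right, Complex.conj_ofReal]
        simp only [Complex.add_re, Complex.re_ofReal_mul]
        rw [hTsym G w (x w) (y w)]
        ring
      have h5 : ‖y w + (θ : ℂ) • x w‖ ^ 2 =
          ‖y w‖ ^ 2 + 2 * θ * (inner ℂ (x w) (y w)).re + θ ^ 2 * ‖x w‖ ^ 2 := by
        rw [norm_add_sq (𝕜 := ℂ), inner_smul_right, norm_smul, Complex.norm_real, mul_pow,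
          Real.norm_eq_abs, sq_abs, ← inner_conj_symm (y w) (x w)]
        simp only [RCLike.re_eq_complex_re, Complex.re_ofReal_mul, Complex.conj_re]
        ring
      rw [h4] at h2
      rw [← h5]
      have h6 : 0 ≤ ‖y w + (θ : ℂ) • x w‖ ^ 2 := sq_nonneg _
      rw [show a w * (inner ℂ (y w) (T G w (y w))).re +
        2 * θ * (a w * (inner ℂ (y w) (T G w (x w))).re) +
        θ ^ 2 * (a w * (inner ℂ (x w) (T G w (x w))).re) =
        a w * ((inner ℂ (y w) (T G w (y w))).re + 2 * θ * (inner ℂ (y w) (T G w (x w))).re +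
          θ ^ 2 * (inner ℂ (x w) (T G w (x w))).re) by ring]
      calc _ ≤ a w * ‖y w + (θ : ℂ) • x w‖ ^ 2 := mul_le_mul_of_nonneg_left h2 (ha0 w)
        _ ≤ 1 * _ := mul_le_mul_of_nonneg_right (ha1 w) h6
        _ = _ := one_mul _
    have h2 : ∀ G, p G * ∑ w, (a w * (inner ℂ (y w) (T G w (y w))).re +
        2 * θ * (a w * (inner ℂ (y w) (T G w (x w))).re) +
        θ ^ 2 * (a w * (inner ℂ (x w) (T G w (x w))).re)) ≤ p G * (ε + θ ^ 2 * q) := by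
      intro G
      refine mul_le_mul_of_nonneg_left ?_ (hp0 G)
      refine (Finset.sum_le_sum fun w _ => h1 G w).trans (le_of_eq ?_)
      rw [Finset.sum_add_distrib, Finset.sum_add_distrib, ← Finset.mul_sum, ← Finset.mul_sum, hxy]
      ring
    have h3 := Finset.sum_le_sum fun G (_ : G ∈ Finset.univ) => h2 G
    rw [← Finset.sum_mul, hp1, one_mul] at h3
    refine le_trans (le_of_eq ?_) h3
    rw [hβ, hχ, hg, Finset.mul_sum, Finset.mul_sum, ← Finset.sum_add_distrib,
      ← Finset.sum_add_distrib]
    refine Finset.sum_congr rfl fun G _ => ?_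
    rw [Finset.sum_add_distrib, Finset.sum_add_distrib, ← Finset.mul_sum, ← Finset.mul_sum]
    ring
  -- With `s = |Z| / h` both terms of the leftover hash bound are at most `h q`; the factor `1/2` in
  -- `T` halves the result.
  have hgle : g ≤ h / 2 * q := by
    have h1 := leftover_hash hp0 hp1 huniv ha0 ha1 hdom (V := fun G k => (U G k : H →ₗ[ℂ] H))
      (fun G k => hsymU G k) (show 0 < M / h by positivity)
    simp only [ContinuousLinearMap.coe_coe] at h1
    have h2 : ∑ G, p G * ∑ k, ∑ w, ‖U G k (x w)‖ ^ 2 ≤ M * q := by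
      have : ∀ G, p G * ∑ k, ∑ w, ‖U G k (x w)‖ ^ 2 ≤ p G * (M * q) := by
        intro G
        refine mul_le_mul_of_nonneg_left ?_ (hp0 G)
        refine (Finset.sum_le_sum fun k _ => Finset.sum_le_sum fun w _ =>
          pow_le_pow_left₀ (norm_nonneg _) (hUle G k (x w)) 2).trans ?_
        simp [hM, hq]
      refine (Finset.sum_le_sum fun G _ => this G).trans ?_
      rw [← Finset.sum_mul, hp1, one_mul]
    have h3 : g = (∑ G, p G * ∑ w, a w * ((inner ℂ (x w) (U G (hash G (κ w)) (x w))).re -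
        M⁻¹ * ∑ k, (inner ℂ (x w) (U G k (x w))).re)) / 2 := by
      rw [hg, Finset.sum_div]
      refine Finset.sum_congr rfl fun G _ => ?_
      rw [mul_div_assoc, Finset.sum_div]
      congr 1
      refine Finset.sum_congr rfl fun w _ => ?_
      rw [hTre, hUbre]
      ring
    rw [h3]
    have h4 : M / h * (lam * q) ≤ h * q := by
      rw [← mul_assoc]
      refine mul_le_mul_of_nonneg_right ?_ hq0
      rw [div_mul_eq_mul_div, div_le_iff₀ hh0]
      linarith
    have h5 : (M / h)⁻¹ * ∑ G, p G * ∑ k, ∑ w, ‖U G k (x w)‖ ^ 2 ≤ h * q := by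
      calc _ ≤ (M / h)⁻¹ * (M * q) := by gcongr
        _ = h * q := by field_simp
    linarith
  -- The variance of the test. For a uniform key the mean of `‖U x - Ub x‖²` is that of `‖U x‖² -
  -- ‖Ub x‖²`, which is at most `‖x‖²`; hence the `1/4`, up to a hashing error of relative size `√2
  -- h`.
  have hTx : ∑ G, p G * ∑ w, ‖T G w (x w)‖ ^ 2 ≤ (1 + √2 * h) * q / 4 := by
    have h20 : 0 < √(2 : ℝ) := by positivity
    have h22 : √(2 : ℝ) * √2 = 2 := Real.mul_self_sqrt (by norm_num)
    -- The symmetrized product makes the covariance term of `‖T x‖²` the expectation of a symmetric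
    -- operator, so that the leftover hash lemma controls its deviation from the mean over `k`.
    set V : Ω → Z → H →L[ℂ] H := fun G k => -(U G k ∘L Ub G + Ub G ∘L U G k) with hVdef
    have hVa : ∀ G k u, V G k u = -(U G k (Ub G u) + Ub G (U G k u)) := fun G k u => rfl
    have hVre : ∀ G k u, (inner ℂ u (V G k u)).re = -2 * (inner ℂ (U G k u) (Ub G u)).re := by
      intro G k u
      rw [hVa, inner_neg_right, inner_add_right, ← hsymU, ← hsymUb G u (U G k u),
        ← inner_conj_symm (Ub G u) (U G k u)]
      simp only [Complex.neg_re, Complex.add_re, Complex.conj_re]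
      ring
    have hVsym : ∀ G k, ((V G k : H →L[ℂ] H) : H →ₗ[ℂ] H).IsSymmetric := by
      intro G k u v
      simp only [ContinuousLinearMap.coe_coe, hVa, inner_neg_right, inner_neg_left, inner_add_left,
        inner_add_right, hsymU, hsymUb]
      ring
    have hVn : ∀ G k u, ‖V G k u‖ ^ 2 ≤ 2 * ‖u‖ ^ 2 + 2 * ‖Ub G u‖ ^ 2 := by
      intro G k u
      rw [hVa, norm_neg]
      have h1 := norm_add_le (U G k (Ub G u)) (Ub G (U G k u))
      have h2 := hUle G k (Ub G u)
      have h3 := (hUble G (U G k u)).trans (hUle G k u)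
      have h4 : ‖U G k (Ub G u) + Ub G (U G k u)‖ ≤ ‖Ub G u‖ + ‖u‖ := by linarith
      nlinarith [norm_nonneg (U G k (Ub G u) + Ub G (U G k u)), sq_nonneg (‖Ub G u‖ - ‖u‖)]
    have hVbar : ∀ G u, M⁻¹ * ∑ k, (inner ℂ u (V G k u)).re = -2 * ‖Ub G u‖ ^ 2 := by
      intro G u
      simp_rw [hVre]
      rw [← Finset.mul_sum, mul_left_comm]
      congr 1
      rw [norm_sq_eq_re_inner (𝕜 := ℂ), RCLike.re_eq_complex_re, ← inner_conj_symm, Complex.conj_re,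
        hUbre]
      congr 1
      refine Finset.sum_congr rfl fun k _ => ?_
      rw [← inner_conj_symm, Complex.conj_re]
    set Y := ∑ G, p G * ∑ w, ‖Ub G (x w)‖ ^ 2 with hY
    have hY0 : 0 ≤ Y := Finset.sum_nonneg fun G _ => mul_nonneg (hp0 G) (by positivity)
    have h1 := leftover_hash hp0 hp1 huniv (a := fun _ => 1) (fun _ => zero_le_one)
      (fun _ => le_rfl) hdom (V := fun G k => (V G k : H →ₗ[ℂ] H))
      hVsym (show 0 < √2 * M / h by positivity)
    simp only [ContinuousLinearMap.coe_coe, one_mul] at h1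
    rw [← hM] at h1
    simp_rw [hVbar, hVre] at h1
    have h2 : ∑ G, p G * ∑ k, ∑ w, ‖V G k (x w)‖ ^ 2 ≤ M * (2 * q + 2 * Y) := by
      have h3 : ∀ G, p G * ∑ k, ∑ w, ‖V G k (x w)‖ ^ 2 ≤
          M * (2 * q * p G + 2 * (p G * ∑ w, ‖Ub G (x w)‖ ^ 2)) := by
        intro G
        calc _ ≤ p G * ∑ k : Z, ∑ w, (2 * ‖x w‖ ^ 2 + 2 * ‖Ub G (x w)‖ ^ 2) :=
              mul_le_mul_of_nonneg_left (Finset.sum_le_sum fun k _ => Finset.sum_le_sum fun w _ =>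
                hVn G k (x w)) (hp0 G)
          _ = _ := by
              rw [Finset.sum_const, Finset.card_univ, nsmul_eq_mul, ← hM, Finset.sum_add_distrib,
                ← Finset.mul_sum, ← Finset.mul_sum]
              ring
      refine (Finset.sum_le_sum fun G _ => h3 G).trans (le_of_eq ?_)
      rw [← Finset.mul_sum, Finset.sum_add_distrib, ← Finset.mul_sum, ← Finset.mul_sum, hp1]
      ring
    have h4 : √2 * M / h * (lam * q) ≤ √2 * h * q := by
      rw [← mul_assoc]
      refine mul_le_mul_of_nonneg_right ?_ hq0
      rw [div_mul_eq_mul_div, div_le_iff₀ hh0]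
      nlinarith
    have h5 : (√2 * M / h)⁻¹ * ∑ G, p G * ∑ k, ∑ w, ‖V G k (x w)‖ ^ 2 ≤ √2 * h * (q + Y) := by
      calc _ ≤ (√2 * M / h)⁻¹ * (M * (2 * q + 2 * Y)) := by gcongr
        _ = 2 * h / √2 * (q + Y) := by field_simp
        _ = √2 * h * (q + Y) := by
            rw [mul_div_right_comm, Real.div_sqrt]
    have h6 : ∑ G, p G * ∑ w, ‖T G w (x w)‖ ^ 2 ≤ (q - Y + ∑ G, p G * ∑ w,
        (-2 * (inner ℂ (U G (hash G (κ w)) (x w)) (Ub G (x w))).re - -2 * ‖Ub G (x w)‖ ^ 2)) / 4 := by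
      have h7 : ∀ G, p G * ∑ w, ‖T G w (x w)‖ ^ 2 ≤ (p G * q - p G * ∑ w, ‖Ub G (x w)‖ ^ 2 +
          p G * ∑ w, (-2 * (inner ℂ (U G (hash G (κ w)) (x w)) (Ub G (x w))).re -
            -2 * ‖Ub G (x w)‖ ^ 2)) / 4 := by
        intro G
        rw [← mul_sub, ← mul_add, mul_div_assoc]
        refine mul_le_mul_of_nonneg_left ?_ (hp0 G)
        rw [hq, ← Finset.sum_sub_distrib, ← Finset.sum_add_distrib, Finset.sum_div]
        refine Finset.sum_le_sum fun w _ => ?_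
        rw [hTnorm]
        have := pow_le_pow_left₀ (norm_nonneg _) (hUle G (hash G (κ w)) (x w)) 2
        linarith
      refine (Finset.sum_le_sum fun G _ => h7 G).trans (le_of_eq ?_)
      rw [← Finset.sum_div, Finset.sum_add_distrib, Finset.sum_sub_distrib, ← Finset.sum_mul, hp1,
        one_mul]
    -- The part of the hashing error proportional to `Y` is absorbed by the `-Y` in the variance.
    have h8 : √2 * h * Y ≤ 2 * Y := by
      refine mul_le_mul_of_nonneg_right ?_ hY0
      nlinarith
    linarith
  -- Cauchy–Schwarz against `y`. By the variance bound the cross term is about half of what `‖T‖ ≤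
  -- 1` alone would give.
  have hχle : χ ≤ √(1 + √2 * h) * √(ε * q) / 2 := by
    have h1 : χ ≤ ∑ r : Ω × W, (√(p r.1) * ‖y r.2‖) * (√(p r.1) * ‖T r.1 r.2 (x r.2)‖) := by
      rw [Fintype.sum_prod_type, hχ]
      refine Finset.sum_le_sum fun G _ => ?_
      rw [Finset.mul_sum]
      refine Finset.sum_le_sum fun w _ => ?_
      rw [mul_mul_mul_comm, Real.mul_self_sqrt (hp0 G)]
      refine mul_le_mul_of_nonneg_left ?_ (hp0 G)
      have h2 : (inner ℂ (y w) (T G w (x w))).re ≤ ‖y w‖ * ‖T G w (x w)‖ :=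
        (Complex.re_le_norm _).trans (norm_inner_le_norm _ _)
      calc _ ≤ a w * (‖y w‖ * ‖T G w (x w)‖) := mul_le_mul_of_nonneg_left h2 (ha0 w)
        _ ≤ 1 * (‖y w‖ * ‖T G w (x w)‖) := mul_le_mul_of_nonneg_right (ha1 w) (by positivity)
        _ = _ := one_mul _
    have h2 := Finset.sum_mul_sq_le_sq_mul_sq Finset.univ
      (fun r : Ω × W => √(p r.1) * ‖y r.2‖) (fun r => √(p r.1) * ‖T r.1 r.2 (x r.2)‖)
    have h3 : ∑ r : Ω × W, (√(p r.1) * ‖y r.2‖) ^ 2 = ε := by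
      rw [Fintype.sum_prod_type]
      simp only [mul_pow, Real.sq_sqrt (hp0 _), ← Finset.mul_sum]
      rw [← Finset.sum_mul, hp1, one_mul]
    have h4 : ∑ r : Ω × W, (√(p r.1) * ‖T r.1 r.2 (x r.2)‖) ^ 2 =
        ∑ G, p G * ∑ w, ‖T G w (x w)‖ ^ 2 := by
      rw [Fintype.sum_prod_type]
      simp only [mul_pow, Real.sq_sqrt (hp0 _), ← Finset.mul_sum]
    rw [h3, h4] at h2
    refine h1.trans ((le_abs_self _).trans (abs_le_of_sq_le_sq (h2.trans ?_) (by positivity)))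
    rw [div_pow, mul_pow, Real.sq_sqrt (by positivity), Real.sq_sqrt (by positivity)]
    calc _ ≤ ε * ((1 + √2 * h) * q / 4) := mul_le_mul_of_nonneg_left hTx hε0
      _ = _ := by ring
  rw [hD]
  -- `g + 2χ + β = (β + 2θχ + θ²g) + (1 - θ²) g + 2 (1 - θ) χ`.
  nlinarith [mul_le_mul_of_nonneg_left hgle (show 0 ≤ 1 - θ ^ 2 by nlinarith),
    mul_le_mul_of_nonneg_left hχle (show 0 ≤ 1 - θ by linarith)]

end Hashing

/-- The numerical inequality that turns the decoupling bound into `√2 √(ε + η)`. -/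
lemma decoupling_bound_le {e h Q : ℝ} (he0 : 0 ≤ e) (he1 : e ≤ 1) (hh : 0 ≤ h) (hQ0 : 0 ≤ Q)
    (hQ : Q ≤ 1 - e ^ 2) :
    e ^ 2 + (e / 2) ^ 2 * Q + (1 - (e / 2) ^ 2) * (h / 2 * Q) +
      (1 - e / 2) * (√(1 + √2 * h) * √(e ^ 2 * Q)) ≤ √2 * √(e ^ 2 + h ^ 2) := by
  have h2 : √(2 : ℝ) ≤ 1.4144 := by
    rw [Real.sqrt_le_left (by norm_num)]; norm_num
  have h20 : 0 ≤ √(2 : ℝ) := Real.sqrt_nonneg _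
  have hs1 : √(1 + √2 * h) ≤ 1 + 0.7072 * h := by
    rw [Real.sqrt_le_left (by positivity)]
    nlinarith [mul_nonneg h20 hh, sq_nonneg h]
  have hs2 : √(e ^ 2 * Q) ≤ e * (1 - e ^ 2 / 2) := by
    have : 0 ≤ e * (1 - e ^ 2 / 2) := mul_nonneg he0 (by nlinarith)
    rw [Real.sqrt_le_left this]
    nlinarith [mul_le_mul_of_nonneg_left hQ (sq_nonneg e), sq_nonneg (e ^ 2), sq_nonneg (e ^ 3)]
  -- With `θ = e / 2` the left side is at most `A e + B h`, where `A = 1 + 3e/4 - e²/2`, so it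
  -- suffices that `A² + B² ≤ 2`. The value `θ = 0` would not do: at `Q = 1 - e²`, `e = 1/√2` the
  -- terms without `h` already exhaust `√2 e`.
  set B := (1 - e ^ 2 / 4) * (1 - e ^ 2) / 2 + 0.7072 * e * (1 - e / 2) * (1 - e ^ 2 / 2) with hB
  have hB0 : 0 ≤ B := by
    have h1 : 0 ≤ 1 - e ^ 2 := by nlinarith
    have h3 : 0 ≤ 1 - e / 2 := by linarith
    have h4 : 0 ≤ 1 - e ^ 2 / 2 := by linarith
    have h5 : 0 ≤ 1 - e ^ 2 / 4 := by linarith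
    positivity
  -- A linear majorant of `B` on `[0, 1]`, sharp enough for `A² + B² ≤ 2`.
  have hB1 : B ≤ 0.675 - 0.125 * e := by
    rw [hB]
    have h1 : 0 ≤ e * (e - 0.42) ^ 2 := by positivity
    have h2 : 0 ≤ e ^ 3 * (1 - e) := mul_nonneg (by positivity) (by linarith)
    nlinarith [sq_nonneg (e - 0.412)]
  have hA : (1 + 3 / 4 * e - e ^ 2 / 2) ^ 2 + B ^ 2 ≤ 2 := by
    have h1 : B ^ 2 ≤ (0.675 - 0.125 * e) ^ 2 := pow_le_pow_left₀ hB0 hB1 2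
    nlinarith [sq_nonneg (e - 2 / 3), sq_nonneg (e ^ 2 - 4 / 9), mul_nonneg he0 (sub_nonneg.mpr he1),
      mul_nonneg he0 (sq_nonneg (e - 2 / 3)), mul_nonneg (mul_nonneg he0 he0) (sub_nonneg.mpr he1)]
  have hle : e ^ 2 + (e / 2) ^ 2 * Q + (1 - (e / 2) ^ 2) * (h / 2 * Q) +
      (1 - e / 2) * (√(1 + √2 * h) * √(e ^ 2 * Q)) ≤ (1 + 3 / 4 * e - e ^ 2 / 2) * e + B * h := by
    have h1 : √(1 + √2 * h) * √(e ^ 2 * Q) ≤ (1 + 0.7072 * h) * (e * (1 - e ^ 2 / 2)) :=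
      mul_le_mul hs1 hs2 (Real.sqrt_nonneg _) (by positivity)
    have h3 := mul_le_mul_of_nonneg_left h1 (show 0 ≤ 1 - e / 2 by linarith)
    have h4 := mul_le_mul_of_nonneg_left hQ (show 0 ≤ (e / 2) ^ 2 by positivity)
    have h5 := mul_le_mul_of_nonneg_left (mul_le_mul_of_nonneg_left hQ (show 0 ≤ h / 2 by linarith))
      (show 0 ≤ 1 - (e / 2) ^ 2 by nlinarith)
    rw [hB]
    linarith
  refine hle.trans ((le_abs_self _).trans (abs_le_of_sq_le_sq ?_ (by positivity)))
  rw [mul_pow, Real.sq_sqrt (by norm_num), Real.sq_sqrt (by positivity)]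
  -- Lagrange's identity for `(A e + B h)²`, that is, Cauchy–Schwarz in the plane.
  nlinarith [sq_nonneg ((1 + 3 / 4 * e - e ^ 2 / 2) * h - B * e),
    mul_le_mul_of_nonneg_right hA (show 0 ≤ e ^ 2 + h ^ 2 by positivity)]

/-! ### Counting error patterns by the binary entropy. -/

lemma entropyFn_nonneg {x : ℝ} (hx : 0 ≤ x) : 0 ≤ entropyFn x := by
  unfold entropyFn
  split_ifs with h
  · have h1 : Real.logb 2 x ≤ 0 := Real.logb_nonpos (by norm_num) hx (by linarith)
    have h2 : Real.logb 2 (1 - x) ≤ 0 := Real.logb_nonpos (by norm_num) (by linarith) (by linarith)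
    nlinarith
  · norm_num

/-- The number of sets with at most `x m` of `m` elements is at most `2 ^ (m h(x))`. -/
lemma card_filter_card_le {α : Type*} [Fintype α] [DecidableEq α] {x : ℝ} (hx : 0 ≤ x) :
    ((Finset.univ.filter fun s : Finset α => (s.card : ℝ) ≤ x * Fintype.card α).card : ℝ) ≤
      2 ^ (Fintype.card α * entropyFn x) := by
  set m := Fintype.card α with hm
  have hall : ((Finset.univ.filter fun s : Finset α => (s.card : ℝ) ≤ x * m).card : ℝ) ≤ 2 ^ m := by
    have := Finset.card_filter_le (Finset.univ : Finset (Finset α)) fun s => (s.card : ℝ) ≤ x * m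
    rw [Finset.card_univ, Fintype.card_finset, ← hm] at this
    exact_mod_cast this
  unfold entropyFn
  split_ifs with h
  -- At `x = 0` the term `x log x` is `0` because of the zero factor, and only the empty set is
  -- counted.
  · rcases hx.eq_or_lt with rfl | hx0
    · simp only [zero_mul, Real.logb_zero, Real.logb_one, neg_zero, mul_zero, sub_zero,
        Real.rpow_zero]
      have : (Finset.univ.filter fun s : Finset α => (s.card : ℝ) ≤ 0) ⊆ {∅} := by
        intro s hs
        simp only [Finset.mem_filter, Finset.mem_univ, true_and] at hs
        have : s.card = 0 := by exact_mod_cast le_antisymm hs (Nat.cast_nonneg _)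
        simpa using this
      exact_mod_cast (Finset.card_le_card this).trans (by simp)
    · have hx1 : 0 < 1 - x := by linarith
      have hsum : ∑ s : Finset α, x ^ s.card * (1 - x) ^ (m - s.card) = 1 := by
        have := Fintype.sum_pow_mul_eq_add_pow α x (1 - x)
        rw [this]; simp
      -- Under independent bits with bias `x ≤ 1 - x`, a set with fewer elements is more likely. So
      -- each counted set has probability at least `2^(-m h(x))`, and the probabilities of all sets
      -- add up to `1`.
      have hterm : ∀ s : Finset α, (s.card : ℝ) ≤ x * m →
          x ^ (x * m) * (1 - x) ^ ((1 - x) * m) ≤ x ^ s.card * (1 - x) ^ (m - s.card) := by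
        intro s hs
        have hsm : s.card ≤ m := Finset.card_le_univ s
        rw [← Real.rpow_natCast, ← Real.rpow_natCast, Nat.cast_sub hsm]
        rw [show x ^ (x * m) = x ^ (s.card : ℝ) * x ^ (x * m - s.card) by
          rw [← Real.rpow_add hx0]; congr 1; ring]
        rw [show (1 - x) ^ ((m : ℝ) - s.card) = (1 - x) ^ ((1 - x) * m) * (1 - x) ^ (x * m - s.card) by
          rw [← Real.rpow_add hx1]; congr 1; ring]
        have h1 : x ^ (x * m - s.card) ≤ (1 - x) ^ (x * m - s.card) :=
          Real.rpow_le_rpow hx0.le (by linarith) (by linarith)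
        have h2 : 0 ≤ x ^ (s.card : ℝ) := Real.rpow_nonneg hx0.le _
        have h3 : 0 ≤ (1 - x) ^ ((1 - x) * (m : ℝ)) := Real.rpow_nonneg hx1.le _
        calc _ = x ^ (s.card : ℝ) * (1 - x) ^ ((1 - x) * (m : ℝ)) * x ^ (x * m - s.card) := by ring
          _ ≤ x ^ (s.card : ℝ) * (1 - x) ^ ((1 - x) * (m : ℝ)) * (1 - x) ^ (x * m - s.card) := by
            gcongr
          _ = _ := by ring
      have hle : ((Finset.univ.filter fun s : Finset α => (s.card : ℝ) ≤ x * m).card : ℝ) *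
          (x ^ (x * m) * (1 - x) ^ ((1 - x) * m)) ≤ 1 := by
        rw [← nsmul_eq_mul, ← Finset.sum_const]
        refine le_trans ?_ hsum.le
        refine (Finset.sum_le_sum fun s hs => hterm s (Finset.mem_filter.mp hs).2).trans ?_
        refine Finset.sum_le_sum_of_subset_of_nonneg (Finset.filter_subset _ _) fun s _ _ => ?_
        positivity
      have hpow : x ^ (x * m) * (1 - x) ^ ((1 - x) * m) *
          2 ^ ((m : ℝ) * (-x * Real.logb 2 x - (1 - x) * Real.logb 2 (1 - x))) = 1 := by
        have e1 : x ^ (x * m) = (2 : ℝ) ^ (Real.logb 2 x * (x * m)) := by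
          rw [Real.rpow_mul (x := 2) (by norm_num), Real.rpow_logb (by norm_num) (by norm_num) hx0]
        have e2 : (1 - x) ^ ((1 - x) * m) = (2 : ℝ) ^ (Real.logb 2 (1 - x) * ((1 - x) * m)) := by
          rw [Real.rpow_mul (x := 2) (by norm_num), Real.rpow_logb (by norm_num) (by norm_num) hx1]
        rw [e1, e2, ← Real.rpow_add (by norm_num), ← Real.rpow_add (by norm_num)]
        rw [show Real.logb 2 x * (x * m) + Real.logb 2 (1 - x) * ((1 - x) * m) +
          m * (-x * Real.logb 2 x - (1 - x) * Real.logb 2 (1 - x)) = 0 by ring, Real.rpow_zero]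
      have hp : 0 < x ^ (x * m) * (1 - x) ^ ((1 - x) * m) :=
        mul_pos (Real.rpow_pos_of_pos hx0 _) (Real.rpow_pos_of_pos hx1 _)
      refine le_of_mul_le_mul_right ?_ hp
      rw [mul_comm (_ ^ _) (_ * _), hpow]
      exact hle
  · rw [mul_one, Real.rpow_natCast]; exact hall

/-! ### Hadamard transforms of the bits of the code rounds -/

/-- The character `(-1)^{ab}` of `ZMod 2`. -/
def chi (a b : ZMod 2) : ℝ := (-1) ^ (a.val * b.val)

lemma chi_comm (a b : ZMod 2) : chi a b = chi b a := by simp [chi, mul_comm]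

@[simp] lemma chi_zero_right (a : ZMod 2) : chi a 0 = 1 := by simp [chi]
@[simp] lemma chi_zero_left (a : ZMod 2) : chi 0 a = 1 := by simp [chi]
@[simp] lemma chi_one_one : chi 1 1 = -1 := by simp [chi, ZMod.val_one]

lemma zmod2_eq_zero_or_one (a : ZMod 2) : a = 0 ∨ a = 1 := by
  revert a; decide

lemma zmod2_add_self (a : ZMod 2) : a + a = 0 := CharTwo.add_self_eq_zero a

lemma chi_add_right (a b c : ZMod 2) : chi a (b + c) = chi a b * chi a c := by
  rcases zmod2_eq_zero_or_one a with rfl | rfl <;> rcases zmod2_eq_zero_or_one b with rfl | rfl <;>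
    rcases zmod2_eq_zero_or_one c with rfl | rfl <;> simp [zmod2_add_self]

lemma abs_chi (a b : ZMod 2) : |chi a b| = 1 := by simp [chi]

lemma sum_chi_mul_chi (b c : ZMod 2) : ∑ a, chi a b * chi a c = if b = c then 2 else 0 := by
  have h : (Finset.univ : Finset (ZMod 2)) = {0, 1} := rfl
  rw [h, Finset.sum_pair (by decide)]
  rcases zmod2_eq_zero_or_one b with rfl | rfl <;>
    rcases zmod2_eq_zero_or_one c with rfl | rfl <;> norm_num

lemma sum_chi (b : ZMod 2) : ∑ a, chi a b = if b = 0 then 2 else 0 := by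
  simpa using sum_chi_mul_chi b 0

/-- The bits of a block: the three bits of Alice and the bit of Bob. -/
abbrev BlockBits := (Fin 3 → ZMod 2) × ZMod 2

/-- The bits of all blocks. -/
abbrev Fiber (N : ℕ) := Fin N → BlockBits

/-- The kernel of the Hadamard transform of a block if `c`, and of the identity otherwise. -/
def blockKernel (c : Bool) (g g' : BlockBits) : ℝ :=
  if c then 1 / 4 * ((∏ u, chi (g.1 u) (g'.1 u)) * chi g.2 g'.2) else if g = g' then 1 else 0

lemma sum_blockBits {M : Type*} [CommSemiring M] (F : Fin 3 → ZMod 2 → M) (G : ZMod 2 → M) :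
    ∑ g : BlockBits, (∏ u, F u (g.1 u)) * G g.2 = (∏ u, ∑ a, F u a) * ∑ m, G m := by
  rw [Fintype.sum_prod_type, Finset.prod_univ_sum, Fintype.piFinset_univ, Finset.sum_mul_sum]

/-- The factor `1/4 = 2^(-4/2)` normalizes the Hadamard transform of four bits, three of Alice and
one of Bob. -/
lemma blockKernel_orthogonal (c : Bool) (g₁ g₂ : BlockBits) :
    ∑ g, blockKernel c g g₁ * blockKernel c g g₂ = if g₁ = g₂ then 1 else 0 := by
  cases c
  · simp [blockKernel, eq_comm]
  · have h : ∀ g : BlockBits, blockKernel true g g₁ * blockKernel true g g₂ =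
        (∏ u, chi (g.1 u) (g₁.1 u) * chi (g.1 u) (g₂.1 u)) *
          (1 / 16 * (chi g.2 g₁.2 * chi g.2 g₂.2)) := by
      intro g
      simp only [blockKernel, if_true, Finset.prod_mul_distrib]
      ring
    simp_rw [h]
    rw [sum_blockBits (fun u a => chi a (g₁.1 u) * chi a (g₂.1 u))
      (fun m => 1 / 16 * (chi m g₁.2 * chi m g₂.2)), ← Finset.mul_sum, sum_chi_mul_chi]
    simp_rw [sum_chi_mul_chi]
    by_cases h1 : g₁ = g₂
    · subst h1; norm_num
    · rw [if_neg h1]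
      by_cases h2 : g₁.2 = g₂.2
      · have h3 : ∃ u, g₁.1 u ≠ g₂.1 u := by
          by_contra h4; push Not at h4
          exact h1 (Prod.ext (funext h4) h2)
        obtain ⟨u, hu⟩ := h3
        rw [Finset.prod_eq_zero (Finset.mem_univ u) (by rw [if_neg hu]), zero_mul]
      · rw [if_neg h2]; ring

variable {N : ℕ}

/-- The kernel of the Hadamard transform of all bits of the code rounds. -/
def fiberKernel (C : Fin N → Bool) (γ γ' : Fiber N) : ℝ := ∏ i, blockKernel (C i) (γ i) (γ' i)

lemma sum_fiber {M : Type*} [CommSemiring M] (F : Fin N → BlockBits → M) :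
    ∑ γ : Fiber N, ∏ i, F i (γ i) = ∏ i, ∑ g, F i g := by
  rw [Finset.prod_univ_sum, Fintype.piFinset_univ]

lemma fiberKernel_orthogonal (C : Fin N → Bool) (γ₁ γ₂ : Fiber N) :
    ∑ γ, fiberKernel C γ γ₁ * fiberKernel C γ γ₂ = if γ₁ = γ₂ then 1 else 0 := by
  simp only [fiberKernel, ← Finset.prod_mul_distrib]
  rw [sum_fiber fun i g => blockKernel (C i) g (γ₁ i) * blockKernel (C i) g (γ₂ i)]
  simp_rw [blockKernel_orthogonal]
  by_cases h : γ₁ = γ₂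
  · subst h; simp
  · obtain ⟨i, hi⟩ : ∃ i, γ₁ i ≠ γ₂ i := by
      by_contra h4; push Not at h4; exact h (funext h4)
    rw [if_neg h, Finset.prod_eq_zero (Finset.mem_univ i) (by rw [if_neg hi])]

section Transform

variable {E : Type*} [NormedAddCommGroup E] [InnerProductSpace ℂ E]

/-- The Hadamard transform of the bits of the code rounds. -/
def fiberTransform (C : Fin N → Bool) (ξ : Fiber N → E) (γ : Fiber N) : E :=
  ∑ γ', (fiberKernel C γ γ' : ℂ) • ξ γ'

lemma fiberTransform_add (C : Fin N → Bool) (ξ ξ' : Fiber N → E) (γ : Fiber N) :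
    fiberTransform C (ξ + ξ') γ = fiberTransform C ξ γ + fiberTransform C ξ' γ := by
  simp [fiberTransform, Finset.sum_add_distrib]

lemma fiberTransform_zero (C : Fin N → Bool) (γ : Fiber N) :
    fiberTransform C (0 : Fiber N → E) γ = 0 := by
  simp [fiberTransform]

lemma inner_fiberTransform_right (C : Fin N → Bool) (u : E) (ξ : Fiber N → E) (γ : Fiber N) :
    inner ℂ u (fiberTransform C ξ γ) = fiberTransform C (fun γ' => inner ℂ u (ξ γ')) γ := by
  simp only [fiberTransform, inner_sum, inner_smul_right, smul_eq_mul]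

/-- Parseval's identity for a real orthogonal matrix acting on the index of a family of vectors. -/
lemma sum_inner_kernel {I : Type*} [Fintype I] [DecidableEq I] {k : I → I → ℝ}
    (hk : ∀ c c', ∑ d, k d c * k d c' = if c = c' then 1 else 0) (ξ ξ' : I → E) :
    ∑ d, inner ℂ (∑ c, (k d c : ℂ) • ξ c) (∑ c, (k d c : ℂ) • ξ' c) =
      ∑ c, inner ℂ (ξ c) (ξ' c) := by
  have h : ∀ d, inner ℂ (∑ c, (k d c : ℂ) • ξ c) (∑ c, (k d c : ℂ) • ξ' c) =
      ∑ c, ∑ c', ((k d c * k d c' : ℝ) : ℂ) * inner ℂ (ξ c) (ξ' c') := by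
    intro d
    rw [sum_inner]
    refine Finset.sum_congr rfl fun c _ => ?_
    rw [inner_sum]
    refine Finset.sum_congr rfl fun c' _ => ?_
    rw [inner_smul_left, inner_smul_right, Complex.conj_ofReal]
    push_cast; ring
  simp_rw [h]
  rw [Finset.sum_comm]
  refine Finset.sum_congr rfl fun c _ => ?_
  rw [Finset.sum_comm]
  have h2 : ∀ c', ∑ d, ((k d c * k d c' : ℝ) : ℂ) * inner ℂ (ξ c) (ξ' c') =
      if c = c' then inner ℂ (ξ c) (ξ' c') else 0 := by
    intro c'
    rw [← Finset.sum_mul, ← Complex.ofReal_sum, hk]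
    split_ifs <;> simp
  simp_rw [h2]
  simp

lemma sum_norm_sq_kernel {I : Type*} [Fintype I] [DecidableEq I] {k : I → I → ℝ}
    (hk : ∀ c c', ∑ d, k d c * k d c' = if c = c' then 1 else 0) (ξ : I → E) :
    ∑ d, ‖∑ c, (k d c : ℂ) • ξ c‖ ^ 2 = ∑ c, ‖ξ c‖ ^ 2 := by
  have h := congrArg Complex.re (sum_inner_kernel hk ξ ξ)
  rw [Complex.re_sum, Complex.re_sum] at h
  simpa only [norm_sq_eq_re_inner (𝕜 := ℂ), RCLike.re_eq_complex_re] using h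

lemma sum_inner_fiberTransform (C : Fin N → Bool) (ξ ξ' : Fiber N → E) :
    ∑ γ, inner ℂ (fiberTransform C ξ γ) (fiberTransform C ξ' γ) = ∑ γ, inner ℂ (ξ γ) (ξ' γ) :=
  sum_inner_kernel (fiberKernel_orthogonal C) ξ ξ'

lemma sum_norm_sq_fiberTransform (C : Fin N → Bool) (ξ : Fiber N → E) :
    ∑ γ, ‖fiberTransform C ξ γ‖ ^ 2 = ∑ γ, ‖ξ γ‖ ^ 2 :=
  sum_norm_sq_kernel (fiberKernel_orthogonal C) ξ

end Transform

/-! ### The distribution of the sifted key when the phase errors are restricted -/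

section Domination

variable (s : Finset (Fin N)) (j : Fin N → Fin 2)

/-- The sifted key bits of the rounds in `s`, with time slots `j`. -/
def fiberKey (γ : Fiber N) : s → ZMod 2 := fun i =>
  (γ i).1 (j i).castSucc + (γ i).1 (j i).succ

/-- The phase errors of the rounds in `s`, with time slots `j`. -/
def fiberError (γ : Fiber N) : s → ZMod 2 := fun i =>
  if (γ i).2 = 0 then (γ i).1 (j i).succ else (γ i).1 (j i).castSucc

/-- Extension by zero of a bit string on `s`. -/
def extendZero (t : s → ZMod 2) (i : Fin N) : ZMod 2 := if h : i ∈ s then t ⟨i, h⟩ else 0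

/-- Addition of `t` to the bits of both interfering pulses. -/
def fiberShift (t : s → ZMod 2) (γ : Fiber N) : Fiber N := fun i =>
  (fun u => (γ i).1 u + if u = (j i).castSucc ∨ u = (j i).succ then extendZero s t i else 0, (γ i).2)

lemma fiberShift_fiberShift (t : s → ZMod 2) (γ : Fiber N) :
    fiberShift s j t (fiberShift s j t γ) = γ := by
  funext i
  refine Prod.ext (funext fun u => ?_) rfl
  simp only [fiberShift]
  split_ifs
  · rw [add_assoc, zmod2_add_self, add_zero]
  · simp

/-- The shift as a permutation. -/
def fiberShiftEquiv (t : s → ZMod 2) : Equiv.Perm (Fiber N) where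
  toFun := fiberShift s j t
  invFun := fiberShift s j t
  left_inv := fiberShift_fiberShift s j t
  right_inv := fiberShift_fiberShift s j t

/-- Both interfering pulses are shifted, so the pattern changes by `t` whichever of them contains
the photon. -/
lemma fiberError_fiberShift (t : s → ZMod 2) (γ : Fiber N) :
    fiberError s j (fiberShift s j t γ) = fiberError s j γ + t := by
  funext i
  simp only [fiberError, fiberShift, Pi.add_apply, true_or, or_true, if_true, extendZero, i.2,
    dif_pos]
  split_ifs <;> rfl

lemma prod_chi_shift (j : Fin 2) (g g' : Fin 3 → ZMod 2) (t : ZMod 2) :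
    ∏ u, chi (g u) (g' u + if u = j.castSucc ∨ u = j.succ then t else 0) =
      chi t (g j.castSucc + g j.succ) * ∏ u, chi (g u) (g' u) := by
  simp_rw [chi_add_right]
  rw [Finset.prod_mul_distrib, mul_comm]
  congr 1
  have h : ∀ u, chi (g u) (if u = j.castSucc ∨ u = j.succ then t else 0) =
      (if u = j.castSucc then chi t (g u) else 1) * (if u = j.succ then chi t (g u) else 1) := by
    intro u
    have hne : j.castSucc ≠ j.succ := (Fin.castSucc_lt_succ (i := j)).ne
    by_cases h1 : u = j.castSucc
    · have h2 : u ≠ j.succ := h1 ▸ hne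
      simp [h1, hne, chi_comm]
    · by_cases h2 : u = j.succ <;> simp [h1, h2, chi_comm]
      simp [hne.symm]
  simp_rw [h]
  rw [Finset.prod_mul_distrib]
  simp

/-- The character of `ZMod 2 ^ s`. -/
def chiPi (t v : s → ZMod 2) : ℝ := ∏ i, chi (t i) (v i)

lemma abs_chiPi (t v : s → ZMod 2) : |chiPi s t v| = 1 := by
  simp [chiPi, Finset.abs_prod, abs_chi]

lemma chiPi_add_right (t v v' : s → ZMod 2) : chiPi s t (v + v') = chiPi s t v * chiPi s t v' := by
  simp [chiPi, chi_add_right, Finset.prod_mul_distrib]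

lemma sum_chiPi (v : s → ZMod 2) : ∑ t, chiPi s t v = if v = 0 then 2 ^ s.card else 0 := by
  have h : ∑ t, chiPi s t v = ∏ i, ∑ a, chi a (v i) := by
    rw [Finset.prod_univ_sum, Fintype.piFinset_univ]; rfl
  rw [h]
  simp_rw [sum_chi]
  by_cases hv : v = 0
  · subst hv; simp
  · obtain ⟨i, hi⟩ : ∃ i, v i ≠ 0 := by
      by_contra h4; push Not at h4; exact hv (funext h4)
    rw [if_neg hv, Finset.prod_eq_zero (Finset.mem_univ i) (by rw [if_neg hi])]

/-- Complementarity of phase errors and key: a shift of the `Z` bits that moves the error pattern by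
`t` is, after the Hadamard transform, multiplication by the character of the sifted key at `t`. -/
lemma fiberKernel_fiberShift (t : s → ZMod 2) (γ γ' : Fiber N) :
    fiberKernel (fun i => decide (i ∈ s)) γ (fiberShift s j t γ') =
      chiPi s t (fiberKey s j γ) * fiberKernel (fun i => decide (i ∈ s)) γ γ' := by
  have h1 : chiPi s t (fiberKey s j γ) =
      ∏ i, if i ∈ s then chi (extendZero s t i) ((γ i).1 (j i).castSucc + (γ i).1 (j i).succ) else 1 := by
    rw [Finset.prod_ite_mem, Finset.univ_inter, ← Finset.prod_coe_sort]
    refine Finset.prod_congr rfl fun i _ => ?_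
    simp [fiberKey, extendZero]
  rw [h1, fiberKernel, fiberKernel, ← Finset.prod_mul_distrib]
  refine Finset.prod_congr rfl fun i _ => ?_
  by_cases hi : i ∈ s
  · simp only [hi, decide_true, blockKernel, if_true, fiberShift]
    rw [prod_chi_shift]
    ring
  · have h2 : fiberShift s j t γ' i = γ' i := by
      refine Prod.ext (funext fun u => ?_) rfl
      simp [fiberShift, extendZero, hi]
    simp [hi, h2]

lemma fiberTransform_comp_fiberShift (t : s → ZMod 2) (ξ : Fiber N → ℂ) (γ : Fiber N) :
    fiberTransform (fun i => decide (i ∈ s)) (fun γ' => ξ (fiberShift s j t γ')) γ =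
      chiPi s t (fiberKey s j γ) • fiberTransform (fun i => decide (i ∈ s)) ξ γ := by
  simp only [fiberTransform]
  rw [← Equiv.sum_comp (fiberShiftEquiv s j t), Finset.smul_sum]
  refine Finset.sum_congr rfl fun γ' _ => ?_
  simp only [fiberShiftEquiv, Equiv.coe_fn_mk, fiberShift_fiberShift]
  rw [fiberKernel_fiberShift]
  simp only [Complex.real_smul, smul_eq_mul, Complex.ofReal_mul]
  ring

/-- If the phase error patterns are restricted to the set `Good`, then the probability of each value
of the sifted key is at most `|Good| / 2 ^ |s|`. -/
theorem sum_fiberTransform_key_le (Good : Finset (s → ZMod 2)) (ξ : Fiber N → ℂ)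
    (hξ : ∀ γ, ξ γ ≠ 0 → fiberError s j γ ∈ Good) (k : s → ZMod 2) :
    ∑ γ, (if fiberKey s j γ = k then ‖fiberTransform (fun i => decide (i ∈ s)) ξ γ‖ ^ 2 else 0) ≤
      Good.card / 2 ^ s.card * ∑ γ, ‖ξ γ‖ ^ 2 := by
  set C : Fin N → Bool := fun i => decide (i ∈ s) with hC
  -- Fourier expansion of the indicator of the key value `k`.
  have hind : ∀ γ, (if fiberKey s j γ = k then ‖fiberTransform C ξ γ‖ ^ 2 else 0) =
      ((2 : ℝ) ^ s.card)⁻¹ * ∑ t, chiPi s t k * (chiPi s t (fiberKey s j γ) *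
        ‖fiberTransform C ξ γ‖ ^ 2) := by
    intro γ
    simp_rw [← mul_assoc, ← chiPi_add_right]
    rw [← Finset.sum_mul, sum_chiPi]
    have h0 : k + fiberKey s j γ = 0 ↔ fiberKey s j γ = k := by
      constructor
      · intro h
        have hk : k + k = 0 := funext fun i => zmod2_add_self (k i)
        rw [← zero_add (fiberKey s j γ), ← hk, add_assoc, h, add_zero]
      · rintro rfl
        exact funext fun i => zmod2_add_self _
    by_cases h : fiberKey s j γ = k
    · rw [if_pos h, if_pos (h0.mpr h)]; field_simp
    · rw [if_neg h, if_neg (h0.not.mpr h)]; ring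
  -- The Fourier coefficients of the key distribution are the correlations of `ξ` with its shifts.
  have hcorr : ∀ t, ∑ γ, chiPi s t (fiberKey s j γ) * ‖fiberTransform C ξ γ‖ ^ 2 =
      (∑ γ, inner ℂ (ξ γ) (ξ (fiberShift s j t γ))).re := by
    intro t
    rw [← sum_inner_fiberTransform C ξ (fun γ => ξ (fiberShift s j t γ)), Complex.re_sum]
    refine Finset.sum_congr rfl fun γ _ => ?_
    rw [hC, fiberTransform_comp_fiberShift, inner_smul_right_eq_smul, Complex.smul_re,
      smul_eq_mul, norm_sq_eq_re_inner (𝕜 := ℂ), RCLike.re_eq_complex_re]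
  simp_rw [hind]
  rw [← Finset.mul_sum, Finset.sum_comm]
  simp_rw [← Finset.mul_sum, hcorr]
  have hle : ∑ t, chiPi s t k * (∑ γ, inner ℂ (ξ γ) (ξ (fiberShift s j t γ))).re ≤
      Good.card * ∑ γ, ‖ξ γ‖ ^ 2 := by
    -- A term of the correlation vanishes unless the error patterns of `γ` and of its shift both lie
    -- in `Good`. The arithmetic mean bound then splits it into two sums that the shift permutes
    -- into each other.
    have h1 : ∀ t, chiPi s t k * (∑ γ, inner ℂ (ξ γ) (ξ (fiberShift s j t γ))).re ≤
        ∑ γ, (if fiberError s j γ + t ∈ Good then ‖ξ γ‖ ^ 2 else 0) := by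
      intro t
      have h2 : ∀ γ, ‖inner ℂ (ξ γ) (ξ (fiberShift s j t γ))‖ ≤
          ((if fiberError s j γ + t ∈ Good then ‖ξ γ‖ ^ 2 else 0) +
          (if fiberError s j (fiberShift s j t γ) + t ∈ Good then
            ‖ξ (fiberShift s j t γ)‖ ^ 2 else 0)) / 2 := by
        intro γ
        rw [fiberError_fiberShift, add_assoc,
          show t + t = 0 from funext fun i => zmod2_add_self _, add_zero]
        by_cases hz : ξ γ = 0 ∨ ξ (fiberShift s j t γ) = 0
        · have : inner ℂ (ξ γ) (ξ (fiberShift s j t γ)) = 0 := by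
            rcases hz with h | h <;> simp [h]
          rw [this, norm_zero]
          positivity
        · push Not at hz
          have e1 := hξ _ hz.1
          have e2 := hξ _ hz.2
          rw [fiberError_fiberShift] at e2
          rw [if_pos e1, if_pos e2]
          refine (norm_inner_le_norm _ _).trans ?_
          nlinarith [sq_nonneg (‖ξ γ‖ - ‖ξ (fiberShift s j t γ)‖)]
      calc _ ≤ |chiPi s t k * (∑ γ, inner ℂ (ξ γ) (ξ (fiberShift s j t γ))).re| := le_abs_self _
        _ ≤ ∑ γ, ‖inner ℂ (ξ γ) (ξ (fiberShift s j t γ))‖ := by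
            rw [abs_mul, abs_chiPi, one_mul]
            exact (Complex.abs_re_le_norm _).trans (norm_sum_le _ _)
        _ ≤ _ := Finset.sum_le_sum fun γ _ => h2 γ
        _ = _ := by
            rw [← Finset.sum_div, Finset.sum_add_distrib,
              show (∑ γ, if fiberError s j (fiberShift s j t γ) + t ∈ Good then
                ‖ξ (fiberShift s j t γ)‖ ^ 2 else 0) =
                ∑ γ, (if fiberError s j γ + t ∈ Good then ‖ξ γ‖ ^ 2 else 0) from
                Equiv.sum_comp (fiberShiftEquiv s j t)
                  (fun γ => if fiberError s j γ + t ∈ Good then ‖ξ γ‖ ^ 2 else 0)]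
            ring
    refine (Finset.sum_le_sum fun t _ => h1 t).trans ?_
    rw [Finset.sum_comm, Finset.mul_sum]
    refine Finset.sum_le_sum fun γ _ => ?_
    rw [← Finset.sum_filter, Finset.sum_const, nsmul_eq_mul]
    refine mul_le_mul_of_nonneg_right ?_ (sq_nonneg _)
    norm_cast
    -- For fixed `γ`, at most `|Good|` shifts lead into `Good`.
    refine Finset.card_le_card_of_injOn (fun t => fiberError s j γ + t) (fun t ht => ?_)
      fun t _ t' _ h => add_left_cancel h
    simpa using ht
  calc _ ≤ ((2 : ℝ) ^ s.card)⁻¹ * (Good.card * ∑ γ, ‖ξ γ‖ ^ 2) := by gcongr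
    _ = _ := by ring

end Domination

/-! ### Relating the actual and the virtual protocol -/

/-- Whether a round is detected. -/
def Outcome.isClick : Outcome → Bool
  | .click _ _ _ => true
  | .noClick _ _ => false

/-- The bit of a detected round. -/
def Outcome.bit : Outcome → ZMod 2
  | .click _ m _ => m
  | .noClick _ _ => 0

/-- Replacement of the bit of a detected round. -/
def Outcome.set : Outcome → ZMod 2 → Outcome
  | .click j _ k, m => .click j m k
  | .noClick a ha, _ => .noClick a ha

@[simp] lemma Outcome.config_set (o : Outcome) (m c : ZMod 2) : (o.set m).config c = o.config c := by
  cases o <;> rfl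

/-- Addition of `d` to the bit of a detected round. -/
def Outcome.shift (d : ZMod 2) (o : Outcome) : Outcome := o.set (o.bit + d)

lemma Outcome.shift_shift (d : ZMod 2) (o : Outcome) : (o.shift d).shift d = o := by
  cases o
  · simp only [Outcome.shift, Outcome.set, Outcome.bit, add_assoc, zmod2_add_self, add_zero]
  · rfl

section Frames

variable {R : Type*} {N : ℕ}

/-- Addition of `d` to the bits of the detected rounds, as a permutation. -/
def outcomeShift (d : Fin N → ZMod 2) : Equiv.Perm (Fin N → Outcome) where
  toFun o i := (o i).shift (d i)
  invFun o i := (o i).shift (d i)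
  left_inv o := funext fun i => (o i).shift_shift (d i)
  right_inv o := funext fun i => (o i).shift_shift (d i)

/-- The bits of Alice and Bob as one family. -/
def fiberEquiv (N : ℕ) : Bits N × (Fin N → ZMod 2) ≃ Fiber N where
  toFun p i := (p.1 i, p.2 i)
  invFun γ := (fun i => (γ i).1, fun i => (γ i).2)
  left_inv _ := rfl
  right_inv _ := rfl

/-- The bits of Alice and the outcomes of Bob, from the bits `γ` and outcomes `o` whose bits are
disregarded. -/
def fiberPoint (φ : (Fin N → Fin 3 → R) × (Fin N → Outcome)) (γ : Fiber N) :
    Bits N × (Fin N → Fin 3 → R) × (Fin N → Outcome) :=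
  (fun i => (γ i).1, φ.1, fun i => (φ.2 i).set (γ i).2)

lemma sum_outcomeShift {M : Type*} [AddCommMonoid M] (g : (Fin N → Outcome) → M)
    (o : Fin N → Outcome) :
    ∑ d, g (outcomeShift d o) = ∑ d : Fin N → ZMod 2, g (fun i => (o i).set (d i)) := by
  refine Fintype.sum_equiv (Equiv.addLeft fun i => (o i).bit) _ _ fun d => ?_
  rfl

/-- Summation by fibers of constant outcomes up to the bits. -/
lemma hasSum_fiberPoint {M : Type*} [AddCommMonoid M] [TopologicalSpace M] [ContinuousAdd M]
    [RegularSpace M] {g : Bits N × (Fin N → Fin 3 → R) × (Fin N → Outcome) → M} {S : M}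
    (h : HasSum g S) :
    HasSum (fun φ => ∑ γ : Fiber N, g (fiberPoint φ γ)) (2 ^ N • S) := by
  -- Each run is met `2^N` times: in a detected round the bit stored in `φ` is disregarded, and in
  -- an undetected round the bit of Bob in `γ` has no effect.
  have h1 : ∀ d : Fin N → ZMod 2, HasSum (fun w : Bits N × (Fin N → Fin 3 → R) × (Fin N → Outcome) =>
      g (w.1, w.2.1, outcomeShift d w.2.2)) S :=
    fun d => ((Equiv.prodCongrRight fun _ : Bits N => Equiv.prodCongrRight
      fun _ : Fin N → Fin 3 → R => outcomeShift d).hasSum_iff (f := g)).mpr h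
  have h2 := hasSum_sum (s := Finset.univ) fun d (_ : d ∈ Finset.univ) => h1 d
  rw [Finset.sum_const, Finset.card_univ] at h2
  have h3 := ((Equiv.prodComm _ _).hasSum_iff.mpr h2).prod_fiberwise
    fun φ : (Fin N → Fin 3 → R) × (Fin N → Outcome) => hasSum_fintype _
  have hc : Fintype.card (Fin N → ZMod 2) = 2 ^ N := by simp [ZMod.card]
  rw [hc] at h3
  refine h3.congr_fun ?_
  intro φ
  rw [← (fiberEquiv N).sum_comp, Fintype.sum_prod_type]
  refine Finset.sum_congr rfl fun b _ => ?_
  exact (sum_outcomeShift (fun o => g (b, φ.1, o)) φ.2).symm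

end Frames

section Fiber

variable {S R H : Type*} [NormedAddCommGroup H] [InnerProductSpace ℂ H] {N : ℕ}

lemma neg_one_pow_eq_chi (a b : ZMod 2) : ((-1 : ℂ)) ^ (a.val * b.val) = (chi a b : ℂ) := by
  simp [chi]

lemma aliceAmp_false (x b : Fin 3 → ZMod 2) :
    aliceAmp false x b = (1 / (√2 : ℝ) : ℂ) ^ 3 * if x = b then 1 else 0 := by
  rw [aliceAmp, Finset.prod_mul_distrib, Finset.prod_const]
  congr 1
  by_cases h : x = b
  · subst h; simp
  · obtain ⟨i, hi⟩ : ∃ i, x i ≠ b i := by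
      by_contra h4; push Not at h4; exact h (funext h4)
    rw [if_neg h, Finset.prod_eq_zero (Finset.mem_univ i)]
    simp [hi]

lemma sqrt_two_mul_self : ((√2 : ℝ) : ℂ) * ((√2 : ℝ) : ℂ) = 2 := by
  norm_cast
  exact Real.mul_self_sqrt (by norm_num)

lemma aliceAmp_true (x b : Fin 3 → ZMod 2) :
    aliceAmp true x b = ((1 / 8 : ℝ) : ℂ) * ∏ u, (chi (x u) (b u) : ℂ) := by
  have h : ∀ u, (1 / (√2 : ℝ) : ℂ) * (((-1) ^ ((x u).val * (b u).val) / √2 : ℝ) : ℂ) =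
      (1 / 2) * (chi (x u) (b u) : ℂ) := by
    intro u
    rw [Complex.ofReal_div, div_mul_div_comm, one_mul, sqrt_two_mul_self, chi]
    ring
  simp only [aliceAmp, if_true]
  simp_rw [h, Finset.prod_mul_distrib, Finset.prod_const]
  norm_num

/-- The transform of the amplitudes of the virtual measurements of a block gives the amplitudes of
the actual measurements. -/
lemma sum_blockKernel_amplitude (f : Bool) (o : Outcome) (g : BlockBits) (b : Fin 3 → ZMod 2)
    (c : ZMod 2) :
    ∑ g' : BlockBits, (blockKernel (f && o.isClick) g g' : ℂ) *
      (aliceAmp (f && o.isClick) g'.1 b *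
        (if f && o.isClick then (o.set g'.2).whichArm c else (o.set g'.2).interfere c)) =
    (1 / (√2 : ℝ) : ℂ) ^ 3 * ((if g.1 = b then 1 else 0) * (o.set g.2).interfere c) := by
  by_cases hf : f && o.isClick
  · rw [hf]
    cases o with
    | noClick a ha => simp [Outcome.isClick] at hf
    | click j m k =>
      simp only [blockKernel, if_true, aliceAmp_true, Outcome.set, Outcome.whichArm,
        Outcome.interfere, neg_one_pow_eq_chi]
      have h : ∀ g' : BlockBits,
          ((1 / 4 * ((∏ u, chi (g.1 u) (g'.1 u)) * chi g.2 g'.2) : ℝ) : ℂ) *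
          (((1 / 8 : ℝ) : ℂ) * (∏ u, (chi (g'.1 u) (b u) : ℂ)) * (if c = g'.2 then 1 else 0)) =
          ((∏ u, chi (g'.1 u) (g.1 u) * chi (g'.1 u) (b u)) *
            (1 / 32 * (chi g.2 g'.2 * if c = g'.2 then 1 else 0)) : ℝ) := by
        intro g'
        simp only [Finset.prod_mul_distrib, chi_comm (g.1 _)]
        push_cast
        rw [apply_ite ((↑) : ℝ → ℂ)]
        push_cast
        ring
      simp_rw [h]
      rw [← Complex.ofReal_sum,
        sum_blockBits (fun u a => chi a (g.1 u) * chi a (b u))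
          (fun m => 1 / 32 * (chi g.2 m * if c = m then 1 else 0)), ← Finset.mul_sum]
      simp_rw [sum_chi_mul_chi]
      have h2 : ∏ u : Fin 3, (if g.1 u = b u then (2 : ℝ) else 0) = if g.1 = b then 8 else 0 := by
        by_cases hb : g.1 = b
        · subst hb; norm_num
        · obtain ⟨i, hi⟩ : ∃ i, g.1 i ≠ b i := by
            by_contra h4; push Not at h4; exact hb (funext h4)
          rw [if_neg hb, Finset.prod_eq_zero (Finset.mem_univ i) (by rw [if_neg hi])]
      rw [h2]
      simp only [mul_ite, mul_one, mul_zero, Finset.sum_ite_eq, Finset.mem_univ, if_true]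
      -- The constants `1/4` of the kernel, `1/8` of Alice's amplitude and `8` of the three
      -- character sums give `1/4 = (1/√2)^4`: three factors from Alice's uniform bits and one from
      -- the second beam splitter.
      have h3 : (1 / (√2 : ℝ) : ℂ) ^ 3 * (1 / (√2 : ℝ) : ℂ) = 1 / 4 := by
        rw [← pow_succ, div_pow, one_pow,
          show ((√2 : ℝ) : ℂ) ^ 4 = (((√2 : ℝ) : ℂ) * ((√2 : ℝ) : ℂ)) ^ 2 by ring,
          sqrt_two_mul_self]
        norm_num
      have h4 : ((1 / 4 : ℝ) : ℂ) = (1 / (√2 : ℝ) : ℂ) ^ (3 + 1) := by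
        rw [pow_succ, h3]; norm_num
      split_ifs
      · rw [show (1 / (√2 : ℝ) : ℂ) ^ 3 * (1 * ((chi g.2 c : ℂ) / (√2 : ℝ))) =
          (1 / (√2 : ℝ) : ℂ) ^ (3 + 1) * (chi g.2 c : ℂ) by ring, ← h4]
        push_cast
        ring
      · simp
  · rw [Bool.not_eq_true] at hf
    rw [hf]
    simp only [blockKernel, Bool.false_eq_true, if_false, aliceAmp_false]
    rw [Finset.sum_eq_single g]
    · simp
    · intro g' _ hne
      simp [hne.symm]
    · simp

variable (src : Source S R) (V : Attack S N H)

/-- The code rounds. -/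
def codeFlags (f : Fin N → Bool) (o : Fin N → Outcome) (i : Fin N) : Bool := f i && (o i).isClick

/-- The actual protocol is the Hadamard transform of the virtual protocol. -/
lemma fiberTransform_virtualVec (f : Fin N → Bool)
    (φ : (Fin N → Fin 3 → R) × (Fin N → Outcome)) (γ : Fiber N) :
    fiberTransform (codeFlags f φ.2) (fun γ' => virtualVec src V (codeFlags f φ.2)
      (fiberPoint φ γ').1 φ.1 (fiberPoint φ γ').2.2) γ =
    ((1 / (√2 : ℝ) : ℂ) ^ (3 * N)) • actualVec src V (fiberPoint φ γ).1 φ.1 (fiberPoint φ γ).2.2 := by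
  simp only [fiberTransform, virtualVec, actualVec, fiberPoint, Outcome.config_set, Finset.smul_sum,
    smul_smul]
  rw [Finset.sum_comm]
  have h : ∀ b : Bits N, ∑ γ' : Fiber N, ∑ c : Fin N → ZMod 2,
      ((fiberKernel (codeFlags f φ.2) γ γ' : ℂ) *
        ((∏ i, aliceAmp (codeFlags f φ.2 i) (γ' i).1 (b i)) *
          ∏ i, if codeFlags f φ.2 i = true then ((φ.2 i).set (γ' i).2).whichArm (c i)
            else ((φ.2 i).set (γ' i).2).interfere (c i))) •
        armVec src V b φ.1 (fun i => (φ.2 i).config (c i)) =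
      if (fun i => (γ i).1) = b then ∑ c : Fin N → ZMod 2, ((1 / (√2 : ℝ) : ℂ) ^ (3 * N) *
        ∏ i, ((φ.2 i).set (γ i).2).interfere (c i)) •
        armVec src V b φ.1 (fun i => (φ.2 i).config (c i)) else 0 := by
    intro b
    rw [Finset.sum_comm]
    have h1 : ∀ c : Fin N → ZMod 2, ∑ γ' : Fiber N,
        ((fiberKernel (codeFlags f φ.2) γ γ' : ℂ) *
        ((∏ i, aliceAmp (codeFlags f φ.2 i) (γ' i).1 (b i)) *
          ∏ i, if codeFlags f φ.2 i = true then ((φ.2 i).set (γ' i).2).whichArm (c i)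
            else ((φ.2 i).set (γ' i).2).interfere (c i))) =
        if (fun i => (γ i).1) = b then ((1 / (√2 : ℝ) : ℂ) ^ (3 * N) *
          ∏ i, ((φ.2 i).set (γ i).2).interfere (c i)) else 0 := by
      intro c
      simp only [fiberKernel, Complex.ofReal_prod, ← Finset.prod_mul_distrib]
      rw [sum_fiber fun i g' => (blockKernel (codeFlags f φ.2 i) (γ i) g' : ℂ) *
        (aliceAmp (codeFlags f φ.2 i) g'.1 (b i) *
          if codeFlags f φ.2 i = true then ((φ.2 i).set g'.2).whichArm (c i)
            else ((φ.2 i).set g'.2).interfere (c i))]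
      have h2 : ∀ i, ∑ g', (blockKernel (codeFlags f φ.2 i) (γ i) g' : ℂ) *
        (aliceAmp (codeFlags f φ.2 i) g'.1 (b i) *
          if codeFlags f φ.2 i = true then ((φ.2 i).set g'.2).whichArm (c i)
            else ((φ.2 i).set g'.2).interfere (c i)) = _ :=
        fun i => sum_blockKernel_amplitude (f i) (φ.2 i) (γ i) (b i) (c i)
      simp_rw [h2, Finset.prod_mul_distrib]
      rw [Finset.prod_const, Finset.card_univ, Fintype.card_fin, ← pow_mul]
      by_cases hb : (fun i => (γ i).1) = b
      · subst hb; simp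
      · obtain ⟨i, hi⟩ : ∃ i, (γ i).1 ≠ b i := by
          by_contra h4; push Not at h4; exact hb (funext h4)
        rw [if_neg hb, Finset.prod_eq_zero (Finset.mem_univ i) (by rw [if_neg hi])]
        simp
    simp_rw [← Finset.sum_smul, h1]
    split_ifs
    · rfl
    · simp
  simp_rw [h]
  simp

/-- The kernel preserves the public data. -/
lemma transcript_eq_of_fiberKernel_ne_zero (f : Fin N → Bool)
    (φ : (Fin N → Fin 3 → R) × (Fin N → Outcome)) {γ γ' : Fiber N}
    (h : fiberKernel (codeFlags f φ.2) γ γ' ≠ 0) :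
    transcript (fiberPoint φ γ).1 (fiberPoint φ γ).2.2 f =
      transcript (fiberPoint φ γ').1 (fiberPoint φ γ').2.2 f := by
  funext i
  have hi : blockKernel (codeFlags f φ.2 i) (γ i) (γ' i) ≠ 0 :=
    Finset.prod_ne_zero_iff.mp h i (Finset.mem_univ i)
  simp only [transcript, fiberPoint]
  cases hc : codeFlags f φ.2 i
  · rw [hc] at hi
    have : γ i = γ' i := by
      by_contra h4
      simp [blockKernel, h4] at hi
    rw [this]
  -- The record of a code round shows only its slot, so the bits that the kernel mixes there are not
  -- announced.
  · simp only [codeFlags, Bool.and_eq_true] at hc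
    cases ho : φ.2 i with
    | noClick a ha => simp [Outcome.set, roundRecord]
    | click j m k => simp [Outcome.set, roundRecord, hc.1]

/-- The set of code rounds is constant on a fiber, so a single transform serves all of its runs. -/
lemma isCode_transcript (f : Fin N → Bool)
    (φ : (Fin N → Fin 3 → R) × (Fin N → Outcome)) (γ : Fiber N) (i : Fin N) :
    (transcript (fiberPoint φ γ).1 (fiberPoint φ γ).2.2 f i).isCode = codeFlags f φ.2 i := by
  simp only [transcript, fiberPoint, codeFlags]
  cases φ.2 i with
  | noClick a ha => simp [Outcome.set, roundRecord, RoundRecord.isCode, Outcome.isClick]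
  | click j m k =>
    cases f i <;> simp [Outcome.set, roundRecord, RoundRecord.isCode, Outcome.isClick]

/-- The time slot of a code round. -/
def RoundRecord.slot : RoundRecord → Fin 2
  | .code j => j
  | _ => 0

lemma fiberKey_eq_siftedA (τ : Transcript N) (γ : Fiber N) :
    fiberKey (codeSet τ) (fun i => (τ i).slot) γ = siftedA τ (fun i => (γ i).1) := by
  funext i
  have hi : (τ i).isCode = true := by simpa [codeSet] using i.2
  simp only [fiberKey, siftedA]
  cases h : τ i <;> simp_all [RoundRecord.isCode, RoundRecord.slot]

lemma card_fiberError (f : Fin N → Bool) (φ : (Fin N → Fin 3 → R) × (Fin N → Outcome))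
    (γ : Fiber N) (τ : Transcript N)
    (hτ : transcript (fiberPoint φ γ).1 (fiberPoint φ γ).2.2 f = τ) :
    (Finset.univ.filter fun i => fiberError (codeSet τ) (fun i => (τ i).slot) γ i = 1).card =
      nPh τ (fiberPoint φ γ).1 (fiberPoint φ γ).2.2 := by
  classical
  rw [nPh]
  have key : ∀ i : codeSet τ, fiberError (codeSet τ) (fun i => (τ i).slot) γ i = 1 ↔
      IsPhaseError ((fiberPoint φ γ).1 i) ((fiberPoint φ γ).2.2 i) := by
    intro i
    have hi : (τ i).isCode = true := by simpa [codeSet] using i.2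
    have h2 := congrFun hτ i
    simp only [transcript, fiberPoint] at h2
    simp only [fiberError, fiberPoint]
    cases ho : φ.2 i with
    | noClick a ha =>
      rw [ho] at h2
      rw [← h2] at hi
      simp [Outcome.set, roundRecord, RoundRecord.isCode] at hi
    | click j m k =>
      rw [ho] at h2
      have h3 : (τ i).slot = j := by
        cases hf : f i
        · rw [← h2] at hi
          simp [Outcome.set, roundRecord, RoundRecord.isCode, hf] at hi
        · rw [← h2]
          simp [Outcome.set, roundRecord, RoundRecord.slot, hf]
      rw [h3]
      simp only [Outcome.set, IsPhaseError]
      split_ifs <;> rfl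
  simp_rw [key]
  refine Finset.card_bij (fun i _ => (i : Fin N)) ?_ ?_ ?_
  · intro i hi
    simp only [Finset.mem_filter, Finset.mem_univ, true_and] at hi
    exact Finset.mem_filter.mpr ⟨i.2, hi⟩
  · intro i _ i' _ h
    exact Subtype.ext h
  · intro i hi
    rw [Finset.mem_filter] at hi
    exact ⟨⟨i, hi.1⟩, by simpa using hi.2, rfl⟩

end Fiber

/-! ### The total probability is at most one -/

lemma tsum_pi_prod_le {ι κ : Type*} [Fintype ι] (f : ι → κ → ℝ≥0∞) :
    ∑' s : ι → κ, ∏ i, f i (s i) ≤ ∏ i, ∑' k, f i k := by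
  classical
  rw [ENNReal.tsum_eq_iSup_sum]
  refine iSup_le fun F => ?_
  calc ∑ s ∈ F, ∏ i, f i (s i)
      ≤ ∑ s ∈ Fintype.piFinset (fun i => F.image (fun s => s i)), ∏ i, f i (s i) := by
        refine Finset.sum_le_sum_of_subset fun s hs => ?_
        rw [Fintype.mem_piFinset]
        exact fun i => Finset.mem_image_of_mem (fun s => s i) hs
    _ = ∏ i, ∑ k ∈ F.image (fun s => s i), f i k := by rw [Finset.prod_univ_sum]
    _ ≤ ∏ i, ∑' k, f i k := Finset.prod_le_prod' fun i _ => ENNReal.sum_le_tsum _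

lemma tsum_ofReal_norm_sq {ι E : Type*} [NormedAddCommGroup E] (x : L2 ι E) :
    ∑' i, ENNReal.ofReal (‖x i‖ ^ 2) = ENNReal.ofReal (‖x‖ ^ 2) := by
  have h := lp.hasSum_norm (p := 2) (by norm_num) x
  simp only [ENNReal.toReal_ofNat, Real.rpow_ofNat] at h
  rw [← ENNReal.ofReal_tsum_of_nonneg (fun i => by positivity) h.summable, h.tsum_eq]

section Mass

variable {S R H : Type*} [NormedAddCommGroup H] [InnerProductSpace ℂ H] {N : ℕ}

/-- The components of a tensor product of unit vectors have total weight at most one. -/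
lemma tsum_norm_sq_jointInput_le (src : Source S R) (b : Bits N) :
    ∑' r, ENNReal.ofReal (‖jointInput src b r‖ ^ 2) ≤ 1 := by
  have h1 : ∀ r, ENNReal.ofReal (‖jointInput src b r‖ ^ 2) = ∑' s : Fin N → Fin 3 → S,
      ∏ i, ∏ u, ENNReal.ofReal (‖src.state u (b i u) (s i u, r i u)‖ ^ 2) := by
    intro r
    rw [← tsum_ofReal_norm_sq]
    refine tsum_congr fun s => ?_
    simp only [jointInput, norm_prod, ← Finset.prod_pow]
    rw [ENNReal.ofReal_prod_of_nonneg fun i _ => Finset.prod_nonneg fun u _ => by positivity]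
    exact Finset.prod_congr rfl fun i _ => ENNReal.ofReal_prod_of_nonneg fun u _ => by positivity
  simp_rw [h1]
  let e : (Fin N → Fin 3 → S × R) ≃ (Fin N → Fin 3 → R) × (Fin N → Fin 3 → S) :=
    { toFun := fun p => (fun i u => (p i u).2, fun i u => (p i u).1)
      invFun := fun q i u => (q.2 i u, q.1 i u)
      left_inv := fun _ => rfl
      right_inv := fun _ => rfl }
  have h2 : ∑' (r : Fin N → Fin 3 → R) (s : Fin N → Fin 3 → S),
      ∏ i, ∏ u, ENNReal.ofReal (‖src.state u (b i u) (s i u, r i u)‖ ^ 2) =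
      ∑' p : Fin N → Fin 3 → S × R, ∏ i, ∏ u, ENNReal.ofReal (‖src.state u (b i u) (p i u)‖ ^ 2) :=
    ENNReal.tsum_prod.symm.trans (e.tsum_eq fun q => ∏ i, ∏ u : Fin 3,
      ENNReal.ofReal (‖src.state u (b i u) (q.2 i u, q.1 i u)‖ ^ 2)).symm
  refine h2.trans_le ?_
  calc _ ≤ ∏ i, ∑' p : Fin 3 → S × R, ∏ u, ENNReal.ofReal (‖src.state u (b i u) (p u)‖ ^ 2) :=
        tsum_pi_prod_le fun i (p : Fin 3 → S × R) =>
          ∏ u, ENNReal.ofReal (‖src.state u (b i u) (p u)‖ ^ 2)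
    _ ≤ ∏ i : Fin N, 1 := by
        refine Finset.prod_le_prod' fun i _ => ?_
        refine (tsum_pi_prod_le fun u (p : S × R) =>
          ENNReal.ofReal (‖src.state u (b i u) p‖ ^ 2)).trans ?_
        refine Finset.prod_le_one' fun u _ => ?_
        rw [tsum_ofReal_norm_sq, src.norm_state]
        simp
    _ = 1 := by simp

lemma sum_antidiagonal_bsAmp_sq (n : ℕ) :
    ∑ p ∈ Finset.HasAntidiagonal.antidiagonal n, ENNReal.ofReal (bsAmp p ^ 2) = 1 := by
  rw [← ENNReal.ofReal_sum_of_nonneg fun p _ => sq_nonneg _, ENNReal.ofReal_eq_one]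
  have h : ∀ p ∈ Finset.HasAntidiagonal.antidiagonal n, bsAmp p ^ 2 = (n.choose p.1 : ℝ) / 2 ^ n := by
    intro p hp
    rw [Finset.HasAntidiagonal.mem_antidiagonal] at hp
    rw [bsAmp, Real.sq_sqrt (by positivity), hp]
  rw [Finset.sum_congr rfl h, ← Finset.sum_div, ← Nat.cast_sum,
    Finset.Nat.sum_antidiagonal_eq_sum_range_succ_mk, Nat.sum_range_choose]
  push_cast
  exact div_self (by positivity)

/-- Beam splitters preserve the norm. -/
lemma tsum_norm_sq_armVec_le (src : Source S R) (V : Attack S N H) (b : Bits N)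
    (r : Fin N → Fin 3 → R) :
    ∑' a, ENNReal.ofReal (‖armVec src V b r a‖ ^ 2) ≤ ENNReal.ofReal (‖jointInput src b r‖ ^ 2) := by
  classical
  set x := V (jointInput src b r) with hx
  have h1 : ∀ a : Fin N → Arms, ENNReal.ofReal (‖armVec src V b r a‖ ^ 2) =
      ∑' n : Fin N → Fin 3 → ℕ, ENNReal.ofReal (‖x n‖ ^ 2) *
        (if n = (fun i u => (a i u).1 + (a i u).2) then
          ∏ i, ∏ u, ENNReal.ofReal (bsAmp (a i u) ^ 2) else 0) := by
    intro a
    rw [tsum_eq_single (fun i u => (a i u).1 + (a i u).2) (fun n hn => by rw [if_neg hn, mul_zero]),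
      if_pos rfl, armVec, norm_smul, mul_pow, mul_comm, ENNReal.ofReal_mul (by positivity)]
    congr 1
    rw [Complex.norm_real, Real.norm_eq_abs, sq_abs, ← Finset.prod_pow,
      ENNReal.ofReal_prod_of_nonneg fun i _ => sq_nonneg _]
    refine Finset.prod_congr rfl fun i _ => ?_
    rw [← Finset.prod_pow, ENNReal.ofReal_prod_of_nonneg fun i _ => sq_nonneg _]
  simp_rw [h1]
  rw [ENNReal.tsum_comm]
  have h2 : ∀ n : Fin N → Fin 3 → ℕ, ∑' a : Fin N → Arms,
      (if n = (fun i u => (a i u).1 + (a i u).2) then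
        ∏ i, ∏ u, ENNReal.ofReal (bsAmp (a i u) ^ 2) else 0) = 1 := by
    intro n
    rw [tsum_eq_sum (s := Fintype.piFinset fun i => Fintype.piFinset fun u =>
      Finset.HasAntidiagonal.antidiagonal (n i u))]
    · rw [Finset.sum_congr rfl (g := fun a : Fin N → Arms =>
        ∏ i, ∏ u, ENNReal.ofReal (bsAmp (a i u) ^ 2))]
      · have h3 := Finset.prod_univ_sum
          (fun i => Fintype.piFinset fun u => Finset.HasAntidiagonal.antidiagonal (n i u))
          (fun (i : Fin N) (p : Arms) => ∏ u, ENNReal.ofReal (bsAmp (p u) ^ 2))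
        rw [← h3]
        refine Finset.prod_eq_one fun i _ => ?_
        have h4 := Finset.prod_univ_sum (fun u => Finset.HasAntidiagonal.antidiagonal (n i u))
          (fun (u : Fin 3) (p : ℕ × ℕ) => ENNReal.ofReal (bsAmp p ^ 2))
        rw [← h4]
        exact Finset.prod_eq_one fun u _ => sum_antidiagonal_bsAmp_sq _
      · intro a ha
        simp only [Fintype.mem_piFinset, Finset.HasAntidiagonal.mem_antidiagonal] at ha
        rw [if_pos (funext fun i => funext fun u => (ha i u).symm)]
    · intro a ha
      rw [if_neg]
      rintro rfl
      simp at ha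
  simp_rw [ENNReal.tsum_mul_left, h2, mul_one]
  rw [tsum_ofReal_norm_sq, hx, V.norm_map]

lemma monitored_onePhoton (j : Fin 2) (c : ZMod 2) (k : ℕ × ℕ) : monitored (onePhoton j c k) = 1 := by
  rcases zmod2_eq_zero_or_one c with rfl | rfl <;> fin_cases j <;>
    simp [monitored, onePhoton, Fin.sum_univ_two]

lemma onePhoton_injective {j j' : Fin 2} {c c' : ZMod 2} {k k' : ℕ × ℕ}
    (h : onePhoton j c k = onePhoton j' c' k') : j = j' ∧ c = c' ∧ k = k' := by
  have h0 := congrFun h 0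
  have h1 := congrFun h 1
  have h2 := congrFun h 2
  rcases zmod2_eq_zero_or_one c with rfl | rfl <;> rcases zmod2_eq_zero_or_one c' with rfl | rfl <;>
    fin_cases j <;> fin_cases j' <;> simp [onePhoton, Fin.ext_iff] at h0 h1 h2 ⊢ <;>
    exact Prod.ext h0 h2

/-- The bit of a detected round, or `c` in an undetected round. -/
def Outcome.label : Outcome → ZMod 2 → ZMod 2
  | .click _ m _, _ => m
  | .noClick _ _, c => c

/-- Detected configurations have exactly one monitored photon and undetected ones do not, so the two
kinds never coincide. The label retains the one bit that the configuration forgets. -/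
lemma config_label_injective :
    Function.Injective fun p : Outcome × ZMod 2 => (p.1.config p.2, p.1.label p.2) := by
  rintro ⟨o, c⟩ ⟨o', c'⟩ h
  simp only [Prod.mk.injEq] at h
  obtain ⟨h1, h2⟩ := h
  cases o with
  | click j m k =>
    cases o' with
    | click j' m' k' =>
      obtain ⟨rfl, rfl, rfl⟩ := onePhoton_injective h1
      simp only [Outcome.label] at h2
      rw [h2]
    | noClick a ha =>
      simp only [Outcome.config] at h1
      exact absurd (h1 ▸ monitored_onePhoton j c k) ha
  | noClick a ha =>
    cases o' with
    | click j' m' k' =>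
      simp only [Outcome.config] at h1
      exact absurd (h1 ▸ monitored_onePhoton j' c' k') ha
    | noClick a' ha' =>
      simp only [Outcome.config, Outcome.label] at h1 h2
      subst h1 h2
      rfl

/-- An orthogonal matrix that maps the arm amplitudes to the detector amplitudes. -/
def Outcome.kernel : Outcome → ZMod 2 → ZMod 2 → ℝ
  | .click _ _ _, d, c => chi d c / √2
  | .noClick _ _, d, c => if c = d then 1 else 0

lemma Outcome.kernel_orthogonal (o : Outcome) (c c' : ZMod 2) :
    ∑ d, o.kernel d c * o.kernel d c' = if c = c' then 1 else 0 := by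
  cases o with
  | click j m k =>
    have h : ∀ d, chi d c / √2 * (chi d c' / √2) = 1 / 2 * (chi d c * chi d c') := by
      intro d
      rw [div_mul_div_comm, Real.mul_self_sqrt (by norm_num)]
      ring
    simp only [Outcome.kernel, h, ← Finset.mul_sum, sum_chi_mul_chi]
    split_ifs <;> norm_num
  | noClick a ha => simp [Outcome.kernel]

/-- A change of the arm label that is immaterial in undetected rounds. -/
def Outcome.relabel : Outcome → ZMod 2 → ZMod 2
  | .click _ _ _, _ => 0
  | .noClick _ _, d => d

lemma Outcome.config_add_relabel (o : Outcome) (d c : ZMod 2) :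
    o.config (c + o.relabel d) = o.config c := by
  cases o <;> simp [Outcome.config, Outcome.relabel]

/-- In an undetected round `interfere` is concentrated at `c = 0` whatever the bit `d`, so it is not
a row of an orthogonal matrix. Translating `c` by `d`, which the configuration does not see, turns
it into the identity matrix. -/
lemma Outcome.kernel_add_relabel (o : Outcome) (d c : ZMod 2) :
    (o.kernel d (c + o.relabel d) : ℂ) = (o.set d).interfere c := by
  cases o with
  | click j m k => simp [Outcome.kernel, Outcome.relabel, Outcome.set, Outcome.interfere, chi]
  | noClick a ha =>
    simp only [Outcome.kernel, Outcome.relabel, Outcome.set, Outcome.interfere, add_eq_right]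
    split_ifs <;> simp

lemma actualVec_set (src : Source S R) (V : Attack S N H) (b : Bits N) (r : Fin N → Fin 3 → R)
    (o : Fin N → Outcome) (d : Fin N → ZMod 2) :
    actualVec src V b r (fun i => (o i).set (d i)) = ∑ c : Fin N → ZMod 2,
      ((∏ i, (o i).kernel (d i) (c i) : ℝ) : ℂ) • armVec src V b r (fun i => (o i).config (c i)) := by
  rw [← Equiv.sum_comp (Equiv.addRight fun i => (o i).relabel (d i)), actualVec]
  refine Finset.sum_congr rfl fun c _ => ?_
  simp only [Equiv.coe_addRight, Pi.add_apply, Outcome.config_add_relabel, Complex.ofReal_prod,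
    Outcome.kernel_add_relabel, Outcome.config_set]

lemma sum_norm_sq_actualVec_set (src : Source S R) (V : Attack S N H) (b : Bits N)
    (r : Fin N → Fin 3 → R) (o : Fin N → Outcome) :
    ∑ d : Fin N → ZMod 2, ‖actualVec src V b r (fun i => (o i).set (d i))‖ ^ 2 =
      ∑ c : Fin N → ZMod 2, ‖armVec src V b r (fun i => (o i).config (c i))‖ ^ 2 := by
  simp_rw [actualVec_set]
  refine sum_norm_sq_kernel (k := fun d c : Fin N → ZMod 2 => ∏ i, (o i).kernel (d i) (c i))
    (fun c c' => ?_) fun c => armVec src V b r (fun i => (o i).config (c i))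
  simp_rw [← Finset.prod_mul_distrib]
  have h : ∑ d : Fin N → ZMod 2, ∏ i, (o i).kernel (d i) (c i) * (o i).kernel (d i) (c' i) =
      ∏ i, ∑ d, (o i).kernel d (c i) * (o i).kernel d (c' i) := by
    rw [Finset.prod_univ_sum, Fintype.piFinset_univ]
  rw [h]
  simp_rw [Outcome.kernel_orthogonal]
  by_cases h : c = c'
  · subst h; simp
  · obtain ⟨i, hi⟩ : ∃ i, c i ≠ c' i := by
      by_contra h4; push Not at h4; exact h (funext h4)
    rw [if_neg h, Finset.prod_eq_zero (Finset.mem_univ i) (by rw [if_neg hi])]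

/-- The measurement preserves the norm. -/
lemma tsum_norm_sq_actualVec_le (src : Source S R) (V : Attack S N H) (b : Bits N)
    (r : Fin N → Fin 3 → R) :
    ∑' o, ENNReal.ofReal (‖actualVec src V b r o‖ ^ 2) ≤
      ∑' a, ENNReal.ofReal (‖armVec src V b r a‖ ^ 2) := by
  -- Both sides are multiplied by `2^N` so that bits can be averaged over on the left, where
  -- Parseval applies, and labels can be added on the right, where the configurations become
  -- injective.
  have h2 : ((2 : ℝ≥0∞) ^ N) ≠ 0 := by simp
  have h2' : ((2 : ℝ≥0∞) ^ N) ≠ ⊤ := by simp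
  refine (ENNReal.mul_le_mul_iff_right h2 h2').mp ?_
  have hcard : (Fintype.card (Fin N → ZMod 2) : ℝ≥0∞) = 2 ^ N := by simp [ZMod.card]
  have h3 : (2 : ℝ≥0∞) ^ N * ∑' o, ENNReal.ofReal (‖actualVec src V b r o‖ ^ 2) =
      ∑' o : Fin N → Outcome, ∑ d : Fin N → ZMod 2,
        ENNReal.ofReal (‖actualVec src V b r (fun i => (o i).set (d i))‖ ^ 2) := by
    simp_rw [← sum_outcomeShift (fun o => ENNReal.ofReal (‖actualVec src V b r o‖ ^ 2))]
    rw [Summable.tsum_finsetSum fun d _ => ENNReal.summable]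
    simp_rw [(outcomeShift _).tsum_eq (fun o => ENNReal.ofReal (‖actualVec src V b r o‖ ^ 2))]
    rw [Finset.sum_const, Finset.card_univ, nsmul_eq_mul, hcard]
  rw [h3]
  have h4 : ∀ o : Fin N → Outcome, ∑ d : Fin N → ZMod 2,
      ENNReal.ofReal (‖actualVec src V b r (fun i => (o i).set (d i))‖ ^ 2) =
      ∑' c : Fin N → ZMod 2, ENNReal.ofReal (‖armVec src V b r (fun i => (o i).config (c i))‖ ^ 2) := by
    intro o
    rw [tsum_fintype, ← ENNReal.ofReal_sum_of_nonneg fun _ _ => by positivity,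
      ← ENNReal.ofReal_sum_of_nonneg fun _ _ => by positivity, sum_norm_sq_actualVec_set]
  simp_rw [h4]
  rw [← ENNReal.tsum_prod (f := fun (o : Fin N → Outcome) (c : Fin N → ZMod 2) =>
    ENNReal.ofReal (‖armVec src V b r (fun i => (o i).config (c i))‖ ^ 2))]
  have hinj : Function.Injective fun p : (Fin N → Outcome) × (Fin N → ZMod 2) =>
      ((fun i => (p.1 i).config (p.2 i), fun i => (p.1 i).label (p.2 i)) :
        (Fin N → Arms) × (Fin N → ZMod 2)) := by
    intro p q h
    have h5 : ∀ i, (p.1 i, p.2 i) = (q.1 i, q.2 i) := fun i => config_label_injective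
      (Prod.ext (congrFun (congrArg Prod.fst h) i) (congrFun (congrArg Prod.snd h) i))
    exact Prod.ext (funext fun i => congrArg Prod.fst (h5 i))
      (funext fun i => congrArg Prod.snd (h5 i))
  refine (ENNReal.tsum_comp_le_tsum_of_injective hinj
    fun q => ENNReal.ofReal (‖armVec src V b r q.1‖ ^ 2)).trans ?_
  rw [ENNReal.tsum_prod (f := fun (a : Fin N → Arms) (_ : Fin N → ZMod 2) =>
    ENNReal.ofReal (‖armVec src V b r a‖ ^ 2))]
  simp_rw [tsum_fintype, Finset.sum_const, Finset.card_univ, nsmul_eq_mul, hcard]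
  rw [ENNReal.tsum_mul_left]

/-- The total weight of the vectors of the actual protocol. -/
theorem tsum_norm_sq_actualVec_total_le (src : Source S R) (V : Attack S N H) :
    ∑' w : Bits N × (Fin N → Fin 3 → R) × (Fin N → Outcome),
      ENNReal.ofReal (‖actualVec src V w.1 w.2.1 w.2.2‖ ^ 2) ≤ 2 ^ (3 * N) := by
  rw [ENNReal.tsum_prod (f := fun (b : Bits N) (q : (Fin N → Fin 3 → R) × (Fin N → Outcome)) =>
    ENNReal.ofReal (‖actualVec src V b q.1 q.2‖ ^ 2)), tsum_fintype]
  calc _ ≤ ∑ b : Bits N, (1 : ℝ≥0∞) := by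
        refine Finset.sum_le_sum fun b _ => ?_
        rw [ENNReal.tsum_prod (f := fun (r : Fin N → Fin 3 → R) (o : Fin N → Outcome) =>
          ENNReal.ofReal (‖actualVec src V b r o‖ ^ 2))]
        exact (ENNReal.tsum_le_tsum fun r => (tsum_norm_sq_actualVec_le src V b r).trans
          (tsum_norm_sq_armVec_le src V b r)).trans (tsum_norm_sq_jointInput_le src b)
    _ = 2 ^ (3 * N) := by
        simp only [Finset.sum_const, Finset.card_univ, Fintype.card_pi, ZMod.card,
          Finset.prod_const, Fintype.card_fin, ← pow_mul, nsmul_eq_mul, mul_one]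
        norm_cast

lemma summable_norm_sq_actualVec (src : Source S R) (V : Attack S N H) :
    Summable fun w : Bits N × (Fin N → Fin 3 → R) × (Fin N → Outcome) =>
      ‖actualVec src V w.1 w.2.1 w.2.2‖ ^ 2 := by
  have h : ∑' w : Bits N × (Fin N → Fin 3 → R) × (Fin N → Outcome),
      ENNReal.ofReal (‖actualVec src V w.1 w.2.1 w.2.2‖ ^ 2) ≠ ⊤ :=
    ne_top_of_le_ne_top (by simp) (tsum_norm_sq_actualVec_total_le src V)
  have h2 := ENNReal.summable_toReal h
  refine h2.congr fun w => ?_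
  rw [ENNReal.toReal_ofReal (by positivity)]

end Mass

/-! ### Distance from an ideal key given the public data -/

section Advantage

variable {H : Type*} [NormedAddCommGroup H] [InnerProductSpace ℂ H]
variable {Ω Z 𝒦 : Type*} [Fintype Ω] [Fintype Z]

/-- The difference between an ideal key and the key `hash G κ`, tested by `U`. -/
def advantage (p : Ω → ℝ) (hash : Ω → 𝒦 → Z) (U : Ω → Z → H →L[ℂ] H) (κ : 𝒦) (v : H) : ℝ :=
  ∑ G, p G * ((Fintype.card Z : ℝ)⁻¹ * ∑ k, (inner ℂ v (U G k v)).re -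
    (inner ℂ v (U G (hash G κ) v)).re)

lemma re_inner_smul_apply (c : ℂ) (v : H) (A : H →L[ℂ] H) :
    (inner ℂ (c • v) (A (c • v))).re = ‖c‖ ^ 2 * (inner ℂ v (A v)).re := by
  rw [map_smul, inner_smul_left, inner_smul_right, ← mul_assoc, mul_comm _ c, Complex.mul_conj,
    Complex.re_ofReal_mul, Complex.normSq_eq_norm_sq]

lemma abs_re_inner_apply_le {A : H →L[ℂ] H} (hA : ‖A‖ ≤ 1) (v : H) :
    |(inner ℂ v (A v)).re| ≤ ‖v‖ ^ 2 := by
  refine (Complex.abs_re_le_norm _).trans ((norm_inner_le_norm _ _).trans ?_)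
  rw [sq]
  exact mul_le_mul_of_nonneg_left ((A.le_of_opNorm_le hA v).trans (by rw [one_mul])) (norm_nonneg _)

lemma advantage_smul (p : Ω → ℝ) (hash : Ω → 𝒦 → Z) (U : Ω → Z → H →L[ℂ] H) (κ : 𝒦) (c : ℂ)
    (v : H) : advantage p hash U κ (c • v) = ‖c‖ ^ 2 * advantage p hash U κ v := by
  simp only [advantage, re_inner_smul_apply, ← Finset.mul_sum]
  rw [Finset.mul_sum]
  exact Finset.sum_congr rfl fun G _ => by ring

lemma abs_advantage_le [Nonempty Z] {p : Ω → ℝ} (hp0 : ∀ G, 0 ≤ p G) (hp1 : ∑ G, p G = 1)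
    (hash : Ω → 𝒦 → Z) {U : Ω → Z → H →L[ℂ] H} (hU1 : ∀ G k, ‖U G k‖ ≤ 1) (κ : 𝒦) (v : H) :
    |advantage p hash U κ v| ≤ 2 * ‖v‖ ^ 2 := by
  have hc : (0 : ℝ) < Fintype.card Z := by exact_mod_cast Fintype.card_pos
  have h1 : ∀ G, |(Fintype.card Z : ℝ)⁻¹ * ∑ k, (inner ℂ v (U G k v)).re -
      (inner ℂ v (U G (hash G κ) v)).re| ≤ 2 * ‖v‖ ^ 2 := by
    intro G
    have h2 : |(Fintype.card Z : ℝ)⁻¹ * ∑ k, (inner ℂ v (U G k v)).re| ≤ ‖v‖ ^ 2 := by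
      rw [abs_mul, abs_of_nonneg (by positivity), inv_mul_le_iff₀ hc]
      refine (Finset.abs_sum_le_sum_abs _ _).trans
        ((Finset.sum_le_sum fun k _ => abs_re_inner_apply_le (hU1 G k) v).trans ?_)
      simp
    have h3 := abs_re_inner_apply_le (hU1 G (hash G κ)) v
    exact (abs_sub _ _).trans (by linarith)
  calc _ ≤ ∑ G, p G * (2 * ‖v‖ ^ 2) := by
        refine (Finset.abs_sum_le_sum_abs _ _).trans (Finset.sum_le_sum fun G _ => ?_)
        rw [abs_mul, abs_of_nonneg (hp0 G)]
        exact mul_le_mul_of_nonneg_left (h1 G) (hp0 G)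
    _ = _ := by rw [← Finset.sum_mul, hp1, one_mul]

/-- The bound on the distance in terms of the weights with too many and with few phase errors. -/
def advantageBound (θ h e q : ℝ) : ℝ :=
  e + θ ^ 2 * q + (1 - θ ^ 2) * (h / 2 * q) + (1 - θ) * (√(1 + √2 * h) * √(e * q))

lemma advantageBound_nonneg {θ h e q : ℝ} (hθ0 : 0 ≤ θ) (hθ1 : θ ≤ 1) (hh : 0 ≤ h) (he : 0 ≤ e)
    (hq : 0 ≤ q) : 0 ≤ advantageBound θ h e q := by
  have h1 : 0 ≤ 1 - θ := by linarith
  have h2 : 0 ≤ 1 - θ ^ 2 := by nlinarith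
  rw [advantageBound]
  positivity

lemma advantageBound_mono {θ h e q e' q' : ℝ} (hθ0 : 0 ≤ θ) (hθ1 : θ ≤ 1) (hh : 0 ≤ h)
    (he : 0 ≤ e) (hq : 0 ≤ q) (hee : e ≤ e') (hqq : q ≤ q') :
    advantageBound θ h e q ≤ advantageBound θ h e' q' := by
  have h1 : 0 ≤ 1 - θ := by linarith
  have h2 : 0 ≤ 1 - θ ^ 2 := by nlinarith
  have h3 := he.trans hee
  rw [advantageBound, advantageBound]
  gcongr

/-- Homogeneity cancels the `2^N`-fold counting of runs by fibers. -/
lemma advantageBound_mul {θ h e q c : ℝ} (hc : 0 ≤ c) :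
    advantageBound θ h (c * e) (c * q) = c * advantageBound θ h e q := by
  rw [advantageBound, advantageBound, show c * e * (c * q) = c ^ 2 * (e * q) by ring,
    Real.sqrt_mul (sq_nonneg c), Real.sqrt_sq hc]
  ring

/-- `advantage` is ideal minus real and lacks the factor `1/2`, so `decoupling` is applied to `-U`
and doubled. -/
lemma sum_advantage_le [CompleteSpace H] {W : Type*} [Nonempty Z] [DecidableEq Z] [DecidableEq 𝒦]
    [Fintype W]
    {p : Ω → ℝ} (hp0 : ∀ G, 0 ≤ p G) (hp1 : ∑ G, p G = 1) {hash : Ω → 𝒦 → Z}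
    (huniv : ∀ k k', k ≠ k' →
      ∑ G, (if hash G k = hash G k' then p G else 0) ≤ (Fintype.card Z : ℝ)⁻¹)
    {x y : W → H} (hxy : ∑ w, (inner ℂ (x w) (y w)).re = 0) {κ : W → 𝒦} {a : W → ℝ}
    (ha0 : ∀ w, 0 ≤ a w) (ha1 : ∀ w, a w ≤ 1) {lam h : ℝ}
    (hdom : ∀ k u, ∑ w, (if κ w = k then ‖inner ℂ u (x w)‖ ^ 2 else 0) ≤
      lam * ∑ w, ‖inner ℂ u (x w)‖ ^ 2)
    (hh0 : 0 < h) (hh1 : h ≤ 1) (hlam : Fintype.card Z * lam ≤ h ^ 2)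
    {U : Ω → Z → H →L[ℂ] H} (hU : ∀ G k, IsSelfAdjoint (U G k)) (hU1 : ∀ G k, ‖U G k‖ ≤ 1)
    {θ : ℝ} (hθ0 : 0 ≤ θ) (hθ1 : θ ≤ 1) :
    ∑ w, a w * advantage p hash U (κ w) (x w + y w) ≤
      2 * advantageBound θ h (∑ w, ‖y w‖ ^ 2) (∑ w, ‖x w‖ ^ 2) := by
  have h1 := decoupling hp0 hp1 huniv hxy ha0 ha1 hdom hh0 hh1 hlam (U := fun G k => -U G k)
    (fun G k => (hU G k).neg) (fun G k => by rw [norm_neg]; exact hU1 G k) hθ0 hθ1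
  rw [advantageBound]
  refine le_trans (le_of_eq ?_) (mul_le_mul_of_nonneg_left h1 zero_le_two)
  simp only [advantage, Finset.mul_sum]
  rw [Finset.sum_comm]
  refine Finset.sum_congr rfl fun G _ => Finset.sum_congr rfl fun w _ => ?_
  simp only [neg_apply, inner_neg_right, Complex.neg_re, Finset.sum_neg_distrib,
    ← Finset.mul_sum]
  ring

end Advantage

/-- The patterns with few phase errors. -/
def goodErrors {N : ℕ} (NphU : Transcript N → ℝ≥0) (τ : Transcript N) : Finset (Sifted τ) :=
  Finset.univ.filter fun v => ((Finset.univ.filter fun i => v i = 1).card : ℝ) ≤ NphU τ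

lemma card_goodErrors_le {N : ℕ} (NphU : Transcript N → ℝ≥0) (τ : Transcript N)
    (hm : 0 < nCode τ) :
    ((goodErrors NphU τ).card : ℝ) ≤ 2 ^ ((nCode τ : ℝ) * entropyFn ((NphU τ : ℝ) / nCode τ)) := by
  have hm' : (0 : ℝ) < nCode τ := by exact_mod_cast hm
  have h1 := card_filter_card_le (α := codeSet τ) (x := (NphU τ : ℝ) / nCode τ) (by positivity)
  rw [Fintype.card_coe] at h1
  change _ ≤ (2 : ℝ) ^ ((nCode τ : ℝ) * _) at h1
  refine le_trans ?_ h1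
  rw [Nat.cast_le]
  -- A bit string is determined by the set of positions of its ones.
  refine Finset.card_le_card_of_injOn (fun v => Finset.univ.filter fun i => v i = 1) ?_ ?_
  · intro v hv
    simp only [goodErrors, Finset.coe_filter, Finset.mem_univ, true_and, Set.mem_ofPred_eq] at hv ⊢
    change _ ≤ (NphU τ : ℝ) / nCode τ * (nCode τ : ℝ)
    rw [div_mul_cancel₀ _ hm'.ne']
    exact hv
  · intro v _ v' _ h
    funext i
    have h2 := Finset.ext_iff.mp h i
    simp only [Finset.mem_filter, Finset.mem_univ, true_and] at h2
    rcases zmod2_eq_zero_or_one (v i) with h3 | h3 <;>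
      rcases zmod2_eq_zero_or_one (v' i) with h4 | h4 <;> simp_all

/-! ### Runs of the virtual protocol, split by the number of phase errors. -/

section Runs

variable {S R H : Type*} [NormedAddCommGroup H] [InnerProductSpace ℂ H] {N : ℕ}

/-- Alice's bits, the components of the purifying systems, and Bob's measurement results. -/
abbrev Run (N : ℕ) (R : Type*) := Bits N × (Fin N → Fin 3 → R) × (Fin N → Outcome)

variable (src : Source S R) (V : Attack S N H) (NphU : Transcript N → ℝ≥0)

/-- Eve's vector in the virtual protocol. -/
def virtualRun (f : Fin N → Bool) (w : Run N R) : H :=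
  virtualVec src V (fun i => (transcript w.1 w.2.2 f i).isCode) w.1 w.2.1 w.2.2

/-- Eve's vector in the actual protocol. -/
def actualRun (w : Run N R) : H := actualVec src V w.1 w.2.1 w.2.2

lemma virtualRun_fiberPoint (f : Fin N → Bool) (φ : (Fin N → Fin 3 → R) × (Fin N → Outcome))
    (γ : Fiber N) : virtualRun src V f (fiberPoint φ γ) =
      virtualVec src V (codeFlags f φ.2) (fiberPoint φ γ).1 φ.1 (fiberPoint φ γ).2.2 := by
  rw [virtualRun]
  congr 1
  exact funext fun i => isCode_transcript f φ γ i

lemma fiberTransform_virtualRun (f : Fin N → Bool)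
    (φ : (Fin N → Fin 3 → R) × (Fin N → Outcome)) (γ : Fiber N) :
    fiberTransform (codeFlags f φ.2) (fun γ' => virtualRun src V f (fiberPoint φ γ')) γ =
      ((1 / (√2 : ℝ) : ℂ) ^ (3 * N)) • actualRun src V (fiberPoint φ γ) := by
  simp_rw [virtualRun_fiberPoint]
  exact fiberTransform_virtualVec src V f φ γ

lemma norm_sq_inv_sqrt_two_pow (n : ℕ) : ‖(1 / (√2 : ℝ) : ℂ) ^ n‖ ^ 2 = (1 / 2) ^ n := by
  rw [norm_pow, norm_div, norm_one, Complex.norm_real, Real.norm_of_nonneg (Real.sqrt_nonneg _),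
    ← pow_mul, mul_comm, pow_mul, div_pow, Real.sq_sqrt (by norm_num), one_pow]

lemma sum_norm_sq_virtualRun (f : Fin N → Bool)
    (φ : (Fin N → Fin 3 → R) × (Fin N → Outcome)) :
    ∑ γ, ‖virtualRun src V f (fiberPoint φ γ)‖ ^ 2 =
      ∑ γ, (1 / 2) ^ (3 * N) * ‖actualRun src V (fiberPoint φ γ)‖ ^ 2 := by
  rw [← sum_norm_sq_fiberTransform (codeFlags f φ.2)]
  refine Finset.sum_congr rfl fun γ _ => ?_
  rw [fiberTransform_virtualRun, norm_smul, mul_pow, norm_sq_inv_sqrt_two_pow]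

/-- Parseval on each fiber transports the normalization of the actual protocol to the virtual one.
-/
lemma tsum_norm_sq_virtualRun_le (f : Fin N → Bool) :
    ∑' w : Run N R, ENNReal.ofReal (‖virtualRun src V f w‖ ^ 2) ≤ 1 := by
  have h1 := hasSum_fiberPoint (ENNReal.summable (f := fun w : Run N R =>
    ENNReal.ofReal (‖virtualRun src V f w‖ ^ 2))).hasSum
  have h2 := hasSum_fiberPoint (ENNReal.summable (f := fun w : Run N R =>
    ENNReal.ofReal ((1 / 2) ^ (3 * N) * ‖actualRun src V w‖ ^ 2))).hasSum
  have h3 : ∀ φ : (Fin N → Fin 3 → R) × (Fin N → Outcome),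
      ∑ γ, ENNReal.ofReal (‖virtualRun src V f (fiberPoint φ γ)‖ ^ 2) =
      ∑ γ, ENNReal.ofReal ((1 / 2) ^ (3 * N) * ‖actualRun src V (fiberPoint φ γ)‖ ^ 2) := by
    intro φ
    rw [← ENNReal.ofReal_sum_of_nonneg fun _ _ => by positivity,
      ← ENNReal.ofReal_sum_of_nonneg fun _ _ => by positivity, sum_norm_sq_virtualRun]
  simp_rw [h3] at h1
  have h4 := h1.unique h2
  rw [nsmul_eq_mul, nsmul_eq_mul] at h4
  have h5 := (ENNReal.mul_right_inj (by simp) (by simp)).mp h4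
  rw [h5]
  have h6 : ∀ w : Run N R, ENNReal.ofReal ((1 / 2) ^ (3 * N) * ‖actualRun src V w‖ ^ 2) =
      (2 ^ (3 * N))⁻¹ * ENNReal.ofReal (‖actualRun src V w‖ ^ 2) := by
    intro w
    rw [ENNReal.ofReal_mul (by positivity), one_div, inv_pow, ENNReal.ofReal_inv_of_pos (by positivity),
      ENNReal.ofReal_pow (by norm_num), ENNReal.ofReal_ofNat]
  simp_rw [h6]
  rw [ENNReal.tsum_mul_left]
  calc _ ≤ (2 ^ (3 * N))⁻¹ * (2 : ℝ≥0∞) ^ (3 * N) := by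
        gcongr
        exact tsum_norm_sq_actualVec_total_le src V
    _ = 1 := ENNReal.inv_mul_cancel (by simp) (by simp)

lemma summable_norm_sq_virtualRun (f : Fin N → Bool) :
    Summable fun w : Run N R => ‖virtualRun src V f w‖ ^ 2 := by
  have h2 := ENNReal.summable_toReal
    (ne_top_of_le_ne_top ENNReal.one_ne_top (tsum_norm_sq_virtualRun_le src V f))
  refine h2.congr fun w => ?_
  rw [ENNReal.toReal_ofReal (by positivity)]

lemma tsum_norm_sq_virtualRun_le_one (f : Fin N → Bool) :
    ∑' w : Run N R, ‖virtualRun src V f w‖ ^ 2 ≤ 1 := by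
  have h := tsum_norm_sq_virtualRun_le src V f
  rwa [← ENNReal.ofReal_tsum_of_nonneg (fun w => by positivity)
    (summable_norm_sq_virtualRun src V f), ENNReal.ofReal_le_one] at h

/-- The runs with the public data `τ` and too many phase errors. -/
def BadRun (f : Fin N → Bool) (τ : Transcript N) (w : Run N R) : Prop :=
  transcript w.1 w.2.2 f = τ ∧ (NphU τ : ℝ) < nPh τ w.1 w.2.2

/-- The runs with the public data `τ` and few phase errors. -/
def GoodRun (f : Fin N → Bool) (τ : Transcript N) (w : Run N R) : Prop :=
  transcript w.1 w.2.2 f = τ ∧ ¬ (NphU τ : ℝ) < nPh τ w.1 w.2.2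

open Classical in
/-- Restriction of Eve's vectors in the virtual protocol. -/
def restrictRun (f : Fin N → Bool) (p : Run N R → Prop) (w : Run N R) : H :=
  if p w then virtualRun src V f w else 0

lemma norm_restrictRun_le (f : Fin N → Bool) (p : Run N R → Prop) (w : Run N R) :
    ‖restrictRun src V f p w‖ ^ 2 ≤ ‖virtualRun src V f w‖ ^ 2 := by
  rw [restrictRun]
  split_ifs
  · rfl
  · simp

lemma summable_restrictRun (f : Fin N → Bool) (p : Run N R → Prop) :
    Summable fun w => ‖restrictRun src V f p w‖ ^ 2 :=
  (summable_norm_sq_virtualRun src V f).of_nonneg_of_le (fun _ => sq_nonneg _)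
    (norm_restrictRun_le src V f p)

/-- The probability of a set of runs in the virtual protocol. -/
def runWeight (f : Fin N → Bool) (p : Run N R → Prop) : ℝ := ∑' w, ‖restrictRun src V f p w‖ ^ 2

lemma runWeight_nonneg (f : Fin N → Bool) (p : Run N R → Prop) : 0 ≤ runWeight src V f p :=
  tsum_nonneg fun _ => by positivity

/-- The contribution of a set of runs to Eve's vectors in the actual protocol. -/
def runPart (f : Fin N → Bool) (p : Run N R → Prop)
    (φ : (Fin N → Fin 3 → R) × (Fin N → Outcome)) (γ : Fiber N) : H :=
  fiberTransform (codeFlags f φ.2) (fun γ' => restrictRun src V f p (fiberPoint φ γ')) γ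

/-- Since the kernel never mixes different public data, restricting the virtual runs to `τ` before
the transform amounts to restricting the actual runs to `τ` after it. -/
lemma runPart_add (f : Fin N → Bool) (τ : Transcript N)
    (φ : (Fin N → Fin 3 → R) × (Fin N → Outcome)) (γ : Fiber N) :
    runPart src V f (GoodRun NphU f τ) φ γ + runPart src V f (BadRun NphU f τ) φ γ =
      if transcript (fiberPoint φ γ).1 (fiberPoint φ γ).2.2 f = τ then
        ((1 / (√2 : ℝ) : ℂ) ^ (3 * N)) • actualRun src V (fiberPoint φ γ) else 0 := by
  rw [runPart, runPart, ← fiberTransform_add, ← fiberTransform_virtualRun src V f]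
  have h1 : ∀ γ', (fiberKernel (codeFlags f φ.2) γ γ' : ℂ) •
      (restrictRun src V f (GoodRun NphU f τ) (fiberPoint φ γ') +
        restrictRun src V f (BadRun NphU f τ) (fiberPoint φ γ')) =
      if transcript (fiberPoint φ γ).1 (fiberPoint φ γ).2.2 f = τ then
        (fiberKernel (codeFlags f φ.2) γ γ' : ℂ) • virtualRun src V f (fiberPoint φ γ') else 0 := by
    intro γ'
    by_cases hk : fiberKernel (codeFlags f φ.2) γ γ' = 0
    · simp [hk]
    · rw [transcript_eq_of_fiberKernel_ne_zero f φ hk, restrictRun, restrictRun]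
      by_cases h2 : transcript (fiberPoint φ γ').1 (fiberPoint φ γ').2.2 f = τ
      · by_cases h3 : (NphU τ : ℝ) < nPh τ (fiberPoint φ γ').1 (fiberPoint φ γ').2.2
        · rw [if_neg fun h => h.2 h3, if_pos ⟨h2, h3⟩, if_pos h2, zero_add]
        · rw [if_pos ⟨h2, h3⟩, if_neg fun h => h3 h.2, if_pos h2, add_zero]
      · rw [if_neg fun h => h2 h.1, if_neg fun h => h2 h.1, if_neg h2, add_zero, smul_zero]
  refine (Finset.sum_congr rfl fun γ' _ => h1 γ').trans ?_
  rw [fiberTransform]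
  split_ifs <;> simp

lemma sum_norm_sq_runPart (f : Fin N → Bool) (p : Run N R → Prop)
    (φ : (Fin N → Fin 3 → R) × (Fin N → Outcome)) :
    ∑ γ, ‖runPart src V f p φ γ‖ ^ 2 = ∑ γ, ‖restrictRun src V f p (fiberPoint φ γ)‖ ^ 2 :=
  sum_norm_sq_fiberTransform _ _

/-- Before the transform the two parts have disjoint supports. After it they overlap, but their
inner products still cancel over the whole fiber, which is all that `decoupling` needs. -/
lemma sum_inner_runPart (f : Fin N → Bool) (τ : Transcript N)
    (φ : (Fin N → Fin 3 → R) × (Fin N → Outcome)) :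
    ∑ γ, inner ℂ (runPart src V f (GoodRun NphU f τ) φ γ) (runPart src V f (BadRun NphU f τ) φ γ) =
      0 := by
  refine (sum_inner_fiberTransform _ _ _).trans (Finset.sum_eq_zero fun γ _ => ?_)
  rw [restrictRun, restrictRun]
  by_cases h1 : GoodRun NphU f τ (fiberPoint φ γ)
  · rw [if_neg fun h : BadRun NphU f τ (fiberPoint φ γ) => h1.2 h.2, inner_zero_right]
  · rw [if_neg h1, inner_zero_left]

lemma sum_restrictRun_le (f : Fin N → Bool) (p : Run N R → Prop)
    (Φ : Finset ((Fin N → Fin 3 → R) × (Fin N → Outcome))) :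
    ∑ φ ∈ Φ, ∑ γ, ‖restrictRun src V f p (fiberPoint φ γ)‖ ^ 2 ≤ 2 ^ N * runWeight src V f p := by
  have h := hasSum_fiberPoint (summable_restrictRun src V f p).hasSum
  rw [nsmul_eq_mul] at h
  push_cast at h
  exact sum_le_hasSum Φ (fun φ _ => Finset.sum_nonneg fun γ _ => by positivity) h

/-- The domination of the distribution of the sifted key for runs with few phase errors. -/
lemma sum_runPart_key_le (f : Fin N → Bool) (τ : Transcript N)
    (φ : (Fin N → Fin 3 → R) × (Fin N → Outcome)) (u : H) (k : Sifted τ) :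
    ∑ γ, (if siftedA τ (fiberPoint φ γ).1 = k then
        ‖inner ℂ u (runPart src V f (GoodRun NphU f τ) φ γ)‖ ^ 2 else 0) ≤
      (goodErrors NphU τ).card / 2 ^ nCode τ *
        ∑ γ, ‖inner ℂ u (runPart src V f (GoodRun NphU f τ) φ γ)‖ ^ 2 := by
  simp_rw [runPart, inner_fiberTransform_right]
  set ξ : Fiber N → ℂ := fun γ => inner ℂ u (restrictRun src V f (GoodRun NphU f τ) (fiberPoint φ γ))
    with hξ
  by_cases hz : ξ = 0
  · rw [hz]
    simp [fiberTransform_zero]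
  have hgood : ∀ γ, ξ γ ≠ 0 → GoodRun NphU f τ (fiberPoint φ γ) := by
    intro γ hγ
    by_contra h
    exact hγ (by simp [hξ, restrictRun, h])
  -- One good run with data `τ` identifies the code rounds of the whole fiber with `codeSet τ`.
  obtain ⟨γ₀, hγ₀⟩ : ∃ γ, ξ γ ≠ 0 := by
    by_contra h4; push Not at h4; exact hz (funext h4)
  have hC : codeFlags f φ.2 = fun i => decide (i ∈ codeSet τ) := by
    funext i
    rw [← isCode_transcript f φ γ₀ i, (hgood γ₀ hγ₀).1]
    simp [codeSet]
  rw [hC, sum_norm_sq_fiberTransform]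
  have h := sum_fiberTransform_key_le (codeSet τ) (fun i => (τ i).slot) (goodErrors NphU τ) ξ ?_ k
  · simp_rw [fiberKey_eq_siftedA] at h
    exact h
  · intro γ hγ
    have hg := hgood γ hγ
    simp only [goodErrors, Finset.mem_filter, Finset.mem_univ, true_and]
    rw [card_fiberError f φ γ τ hg.1]
    exact not_lt.mp hg.2

/-- The distance from an ideal key, given the public data and the choice of the code rounds. -/
lemma tsum_advantage_le [CompleteSpace H] {Ω Z : Type*} [Fintype Ω] [Fintype Z] [Nonempty Z]
    [DecidableEq Z] (f : Fin N → Bool) (τ : Transcript N)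
    {p : Ω → ℝ} (hp0 : ∀ G, 0 ≤ p G) (hp1 : ∑ G, p G = 1) {hash : Ω → Sifted τ → Z}
    (huniv : ∀ k k', k ≠ k' →
      ∑ G, (if hash G k = hash G k' then p G else 0) ≤ (Fintype.card Z : ℝ)⁻¹)
    {a : Run N R → ℝ} (ha0 : ∀ w, 0 ≤ a w) (ha1 : ∀ w, a w ≤ 1) {h : ℝ}
    (hh0 : 0 < h) (hh1 : h ≤ 1)
    (hlam : Fintype.card Z * ((goodErrors NphU τ).card / 2 ^ nCode τ : ℝ) ≤ h ^ 2)
    {U : Ω → Z → H →L[ℂ] H} (hU : ∀ G k, IsSelfAdjoint (U G k)) (hU1 : ∀ G k, ‖U G k‖ ≤ 1)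
    {θ : ℝ} (hθ0 : 0 ≤ θ) (hθ1 : θ ≤ 1) :
    ∑' w : Run N R, (if transcript w.1 w.2.2 f = τ then
      (1 / 2) ^ (3 * N) * (a w * advantage p hash U (siftedA τ w.1) (actualRun src V w)) else 0) ≤
      2 * advantageBound θ h (runWeight src V f (BadRun NphU f τ))
        (runWeight src V f (GoodRun NphU f τ)) := by
  set g : Run N R → ℝ := fun w => if transcript w.1 w.2.2 f = τ then
      (1 / 2) ^ (3 * N) * (a w * advantage p hash U (siftedA τ w.1) (actualRun src V w)) else 0
    with hg
  have hB0 := runWeight_nonneg src V f (BadRun NphU f τ)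
  have hG0 := runWeight_nonneg src V f (GoodRun NphU f τ)
  by_cases hs : Summable g
  swap
  · rw [tsum_eq_zero_of_not_summable hs]
    exact mul_nonneg zero_le_two (advantageBound_nonneg hθ0 hθ1 hh0.le hB0 hG0)
  have h1 := hasSum_fiberPoint hs.hasSum
  -- `decoupling` concerns finite families, so it is applied to finitely many fibers at once; the
  -- bound is uniform in their choice.
  have h2 : (2 ^ N : ℝ) * ∑' w, g w ≤ 2 ^ N * (2 * advantageBound θ h
      (runWeight src V f (BadRun NphU f τ)) (runWeight src V f (GoodRun NphU f τ))) := by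
    rw [nsmul_eq_mul] at h1
    push_cast at h1
    refine hasSum_le_of_sum_le h1 fun Φ => ?_
    have h3 := sum_advantage_le hp0 hp1 huniv (W := Φ × Fiber N)
      (x := fun w => runPart src V f (GoodRun NphU f τ) w.1 w.2)
      (y := fun w => runPart src V f (BadRun NphU f τ) w.1 w.2) ?_
      (κ := fun w => siftedA τ (fiberPoint w.1.1 w.2).1)
      (a := fun w => a (fiberPoint w.1.1 w.2)) (fun w => ha0 _) (fun w => ha1 _)
      (lam := (goodErrors NphU τ).card / 2 ^ nCode τ) ?_ hh0 hh1 hlam hU hU1 hθ0 hθ1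
    · rw [Fintype.sum_prod_type, Fintype.sum_prod_type, Fintype.sum_prod_type] at h3
      simp only [sum_norm_sq_runPart, runPart_add] at h3
      rw [Finset.sum_coe_sort Φ fun φ => ∑ γ,
          ‖restrictRun src V f (BadRun NphU f τ) (fiberPoint φ γ)‖ ^ 2,
        Finset.sum_coe_sort Φ fun φ => ∑ γ,
          ‖restrictRun src V f (GoodRun NphU f τ) (fiberPoint φ γ)‖ ^ 2] at h3
      refine le_trans (le_of_eq ?_) (h3.trans ?_)
      · rw [← Finset.sum_coe_sort Φ]
        refine Finset.sum_congr rfl fun φ _ => Finset.sum_congr rfl fun γ _ => ?_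
        simp only [hg]
        split_ifs
        · rw [advantage_smul, norm_sq_inv_sqrt_two_pow]
          ring
        · simp [advantage]
      · rw [mul_left_comm, ← advantageBound_mul (c := (2 : ℝ) ^ N) (by positivity)]
        refine mul_le_mul_of_nonneg_left ?_ zero_le_two
        exact advantageBound_mono hθ0 hθ1 hh0.le
          (Finset.sum_nonneg fun _ _ => Finset.sum_nonneg fun _ _ => by positivity)
          (Finset.sum_nonneg fun _ _ => Finset.sum_nonneg fun _ _ => by positivity)
          (sum_restrictRun_le src V f (BadRun NphU f τ) Φ)
          (sum_restrictRun_le src V f (GoodRun NphU f τ) Φ)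
    · rw [Fintype.sum_prod_type]
      refine Finset.sum_eq_zero fun φ _ => ?_
      rw [← Complex.re_sum]
      exact congrArg Complex.re (sum_inner_runPart src V NphU f τ φ.1)
    · intro k u
      rw [Fintype.sum_prod_type, Fintype.sum_prod_type, Finset.mul_sum]
      refine Finset.sum_le_sum fun φ _ => ?_
      convert sum_runPart_key_le src V NphU f τ φ.1 u k
  exact le_of_mul_le_mul_left h2 (by positivity)

end Runs

/-! ### Random functions -/

lemma sum_pmf_toReal {α : Type*} [Fintype α] (p : PMF α) : ∑ x, (p x).toReal = 1 := by
  rw [← ENNReal.toReal_sum fun x _ => p.apply_ne_top x, ← tsum_fintype (L := .unconditional _),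
    p.tsum_coe, ENNReal.toReal_one]

lemma IsUniversal₂.sum_le {α β : Type*} [Fintype β] [Fintype (α → β)] [DecidableEq β]
    {p : PMF (α → β)} (hp : IsUniversal₂ p) {x y : α} (hxy : x ≠ y) :
    ∑ F, (if F x = F y then (p F).toReal else 0) ≤ (Fintype.card β : ℝ)⁻¹ := by
  have h1 := hp x y hxy
  rw [PMF.toOuterMeasure_apply_fintype] at h1
  -- For empty `β` the inverse cardinality would be `⊤`; a function in the support excludes this.
  have hβ : (Fintype.card β : ℝ≥0∞) ≠ 0 := by
    obtain ⟨F, _⟩ := p.support_nonempty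
    have : Nonempty β := ⟨F x⟩
    exact_mod_cast Fintype.card_ne_zero
  have h2 := ENNReal.toReal_mono (ENNReal.inv_ne_top.mpr hβ) h1
  rw [ENNReal.toReal_inv, ENNReal.toReal_natCast, ENNReal.toReal_sum] at h2
  · refine le_trans (le_of_eq ?_) h2
    refine Finset.sum_congr rfl fun F _ => ?_
    by_cases h : F x = F y
    · rw [if_pos h, Set.indicator_of_mem (by exact h)]
    · rw [if_neg h, Set.indicator_of_notMem (by exact h), ENNReal.toReal_zero]
  · intro F _
    by_cases h : F x = F y
    · rw [Set.indicator_of_mem (by exact h)]; exact p.apply_ne_top F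
    · rw [Set.indicator_of_notMem (by exact h)]; exact ENNReal.zero_ne_top

lemma coinWeight_nonneg {N : ℕ} {t : ℝ} (h0 : 0 < t) (h1 : t < 1) (f : Fin N → Bool) :
    0 ≤ coinWeight t f := by
  refine Finset.prod_nonneg fun i _ => ?_
  split_ifs <;> linarith

lemma sum_coinWeight {N : ℕ} (t : ℝ) : ∑ f : Fin N → Bool, coinWeight t f = 1 := by
  have h := Finset.prod_univ_sum (fun _ : Fin N => (Finset.univ : Finset Bool))
    (fun _ (c : Bool) => if c then t else 1 - t)
  rw [Fintype.piFinset_univ] at h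
  simp only [coinWeight]
  rw [← h]
  simp

lemma card_key (n : ℕ) : (Fintype.card (Key n) : ℝ)⁻¹ = (1 / 2) ^ n := by
  simp [ZMod.card]

lemma sum_key_const (n : ℕ) : ∑ _k : Key n, ((1 : ℝ) / 2) ^ n = 1 := by
  rw [Finset.sum_const, Finset.card_univ, nsmul_eq_mul, ← card_key, mul_inv_cancel₀]
  exact_mod_cast Fintype.card_ne_zero

lemma sum_triple {A B E M : Type*} [Fintype A] [Fintype B] [Fintype E] [AddCommMonoid M]
    (F : A × B × E → M) : ∑ i, F i = ∑ e, ∑ a, ∑ b, F (a, b, e) := by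
  rw [Fintype.sum_prod_type]
  simp_rw [Fintype.sum_prod_type]
  rw [Finset.sum_comm (s := (Finset.univ : Finset E))]
  exact Finset.sum_congr rfl fun a _ => Finset.sum_comm

/-! ### The final and ideal states as weighted sums over runs. -/

namespace Protocol

variable {N ζ' : ℕ} (P : Protocol N ζ')

/-- The probability of the keys and the public data `i` given the run `w`, including the prior
probability of Alice's bits. -/
def outcomeWeight {R : Type*} (n : ℕ) (i : Key n × Key n × P.Public n) (w : Run N R) : ℝ :=
  match i with
  | (kA, kB, ⟨τ, _, F, _, acc, G⟩) =>
    (∑ f, if transcript w.1 w.2.2 f = τ then coinWeight P.t f else 0) *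
      ((1 / 2) ^ (3 * N) * (1 / 2) ^ P.nEC τ * (1 / 2) ^ ζ' * (P.verHash τ F).toReal *
        (P.paHash τ n G).toReal) *
      (if acc = decide (F (siftedA τ w.1) =
          F (P.reconciled τ (siftedA τ w.1) (siftedB τ w.2.2))) ∧
        n = (if acc then P.finLen τ else 0) ∧ kA = G (siftedA τ w.1) ∧
        kB = G (P.reconciled τ (siftedA τ w.1) (siftedB τ w.2.2)) then 1 else 0)

/-- One-time pad: exactly one pad explains a given ciphertext, so summing over the pads removes the
dependence on the message. -/
lemma sum_ite_add_eq {n : ℕ} (s t : Key n) (Q : Prop) [Decidable Q] (x : ℝ) :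
    ∑ p : Key n, (if s = t + p ∧ Q then x else 0) = if Q then x else 0 := by
  rw [Finset.sum_eq_single (s - t)]
  · simp
  · intro p _ hp
    rw [if_neg]
    rintro ⟨h, _⟩
    exact hp (by rw [h, add_sub_cancel_left])
  · simp

variable {S R H : Type*} [NormedAddCommGroup H] [InnerProductSpace ℂ H]
variable (src : Source S R) (V : Attack S N H)

/-- Once the pads are summed out, the weights no longer depend on the two ciphertexts. -/
lemma finBlock_eq_tsum (n : ℕ) (i : Key n × Key n × P.Public n) :
    P.finBlock src V n i = ∑' w : Run N R, (P.outcomeWeight n i w : ℂ) •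
      InnerProductSpace.rankOne ℂ (actualRun src V w) (actualRun src V w) := by
  classical
  obtain ⟨kA, kB, τ, s, F, v, acc, G⟩ := i
  simp only [finBlock]
  refine tsum_congr fun w => ?_
  have h1 : P.outcomeWeight n (kA, kB, ⟨τ, s, F, v, acc, G⟩) w =
      ∑ f : Fin N → Bool, ∑ p₁ : Key (P.nEC τ), ∑ p₂ : Key ζ',
        if transcript w.1 w.2.2 f = τ ∧ s = P.syndrome τ (siftedA τ w.1) + p₁ ∧
            v = F (siftedA τ w.1) + p₂ ∧
            acc = decide (F (siftedA τ w.1) =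
              F (P.reconciled τ (siftedA τ w.1) (siftedB τ w.2.2))) ∧
            n = (if acc then P.finLen τ else 0) ∧
            kA = G (siftedA τ w.1) ∧
            kB = G (P.reconciled τ (siftedA τ w.1) (siftedB τ w.2.2)) then
          (1 / 2) ^ (3 * N) * coinWeight P.t f * (1 / 2) ^ P.nEC τ * (1 / 2) ^ ζ' *
            (P.verHash τ F).toReal * (P.paHash τ n G).toReal else 0 := by
    rw [outcomeWeight, Finset.sum_mul, Finset.sum_mul]
    refine Finset.sum_congr rfl fun f _ => ?_
    simp_rw [and_left_comm (a := transcript w.1 w.2.2 f = τ)]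
    simp_rw [and_left_comm (b := v = F (siftedA τ w.1) + _)]
    have h2 : ∀ (p₁ : Key (P.nEC τ)) (Q : Prop) [Decidable Q] (x : ℝ),
        ∑ p₂ : Key ζ', (if v = F (siftedA τ w.1) + p₂ ∧ s = P.syndrome τ (siftedA τ w.1) + p₁ ∧ Q
          then x else 0) = if s = P.syndrome τ (siftedA τ w.1) + p₁ ∧ Q then x else 0 :=
      fun p₁ Q _ x => sum_ite_add_eq _ _ _ _
    simp_rw [h2, sum_ite_add_eq]
    by_cases h3 : transcript w.1 w.2.2 f = τ
    · simp only [h3, true_and, if_true]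
      split_ifs <;> ring
    · simp [h3]
  rw [h1]
  push_cast
  simp_rw [Finset.sum_smul]
  refine Finset.sum_congr rfl fun f _ => Finset.sum_congr rfl fun p₁ _ =>
    Finset.sum_congr rfl fun p₂ _ => ?_
  rw [actualRun]
  split_ifs <;> simp

lemma abs_outcomeWeight_le (n : ℕ) (i : Key n × Key n × P.Public n) (w : Run N R) :
    |P.outcomeWeight n i w| ≤ 1 := by
  obtain ⟨kA, kB, τ, s, F, v, acc, G⟩ := i
  have h1 : |∑ f, if transcript w.1 w.2.2 f = τ then coinWeight P.t f else 0| ≤ 1 := by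
    have h2 : ∀ f, 0 ≤ if transcript w.1 w.2.2 f = τ then coinWeight P.t f else 0 := by
      intro f
      split_ifs
      · exact coinWeight_nonneg P.t_pos P.t_lt_one f
      · rfl
    rw [abs_of_nonneg (Finset.sum_nonneg fun f _ => h2 f), ← sum_coinWeight (N := N) P.t]
    refine Finset.sum_le_sum fun f _ => ?_
    split_ifs
    · rfl
    · exact coinWeight_nonneg P.t_pos P.t_lt_one f
  have h3 : ∀ {α : Type _} (p : PMF α) (x : α), |(p x).toReal| ≤ 1 := by
    intro α p x
    rw [abs_of_nonneg ENNReal.toReal_nonneg]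
    exact ENNReal.toReal_le_of_le_ofReal zero_le_one (by simpa using p.coe_le_one x)
  have h4 : ∀ k : ℕ, |((1 : ℝ) / 2) ^ k| ≤ 1 := by
    intro k
    rw [abs_of_nonneg (by positivity)]
    exact pow_le_one₀ (by norm_num) (by norm_num)
  have hmul : ∀ {x y : ℝ}, |x| ≤ 1 → |y| ≤ 1 → |x * y| ≤ 1 := by
    intro x y hx hy
    rw [abs_mul]
    exact mul_le_one₀ hx (abs_nonneg _) hy
  rw [outcomeWeight]
  refine hmul (hmul h1 (hmul (hmul (hmul (hmul (h4 _) (h4 _)) (h4 _)) (h3 _ _)) (h3 _ _))) ?_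
  split_ifs <;> simp

lemma summable_smul_rankOne [CompleteSpace H] {c : Run N R → ℝ} {B : ℝ} (hc : ∀ w, |c w| ≤ B) :
    Summable fun w => (c w : ℂ) •
      InnerProductSpace.rankOne ℂ (actualRun src V w) (actualRun src V w) := by
  refine Summable.of_norm_bounded (g := fun w => B * ‖actualRun src V w‖ ^ 2)
    ((summable_norm_sq_actualVec src V).mul_left B) fun w => ?_
  rw [norm_smul, Complex.norm_real, Real.norm_eq_abs, InnerProductSpace.norm_rankOne, ← sq]
  exact mul_le_mul_of_nonneg_right (hc w) (sq_nonneg _)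

/-- The weights of the ideal state. -/
def idealWeight (n : ℕ) (i : Key n × Key n × P.Public n) (w : Run N R) : ℝ :=
  if i.1 = i.2.1 then (1 / 2) ^ n * ∑ k : Key n × Key n, P.outcomeWeight n (k.1, k.2, i.2.2) w
  else 0

lemma abs_idealWeight_le (n : ℕ) (i : Key n × Key n × P.Public n) (w : Run N R) :
    |P.idealWeight n i w| ≤ Fintype.card (Key n × Key n) := by
  rw [idealWeight]
  split_ifs
  · rw [abs_mul]
    have h1 : |((1 : ℝ) / 2) ^ n| ≤ 1 := by
      rw [abs_of_nonneg (by positivity)]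
      exact pow_le_one₀ (by norm_num) (by norm_num)
    have h2 : |∑ k : Key n × Key n, P.outcomeWeight n (k.1, k.2, i.2.2) w| ≤
        Fintype.card (Key n × Key n) := by
      refine (Finset.abs_sum_le_sum_abs _ _).trans
        ((Finset.sum_le_sum fun k _ => P.abs_outcomeWeight_le n _ w).trans ?_)
      simp
    calc _ ≤ 1 * |∑ k : Key n × Key n, P.outcomeWeight n (k.1, k.2, i.2.2) w| := by gcongr
      _ ≤ _ := by rw [one_mul]; exact h2
  · simp

lemma idealBlock_eq_tsum [CompleteSpace H] (n : ℕ) (i : Key n × Key n × P.Public n) :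
    P.idealBlock src V n i = ∑' w : Run N R, (P.idealWeight n i w : ℂ) •
      InnerProductSpace.rankOne ℂ (actualRun src V w) (actualRun src V w) := by
  obtain ⟨kA, kB, e⟩ := i
  by_cases h : kA = kB
  · simp only [idealBlock, idealWeight, if_pos h, finBlock_eq_tsum]
    rw [← Summable.tsum_finsetSum fun k _ => summable_smul_rankOne src V
      (P.abs_outcomeWeight_le n (k.1, k.2, e)), ← tsum_const_smul'' ((1 / 2 : ℂ) ^ n)]
    refine tsum_congr fun w => ?_
    rw [← Finset.sum_smul, smul_smul]
    push_cast
    rfl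
  · simp [idealBlock, idealWeight, h]

lemma cqOp_sub {ι : Type*} [Fintype ι] (X Y : ι → H →L[ℂ] H) :
    cqOp X - cqOp Y = cqOp (fun i => X i - Y i) := by
  ext v i
  simp [cqOp]

lemma traceNorm_zero [CompleteSpace H] : traceNorm (0 : H →L[ℂ] H) = 0 := by
  simp [traceNorm, opTrace]

/-- There is only one key of length zero, so aborted runs do not contribute to the distance. -/
lemma idealBlock_zero : P.idealBlock src V 0 = P.finBlock src V 0 := by
  funext i
  obtain ⟨kA, kB, e⟩ := i
  have h : kA = kB := Subsingleton.elim _ _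
  simp only [idealBlock, if_pos h, pow_zero, one_smul]
  rw [Fintype.sum_eq_single (kA, kB) fun x hx => absurd (Subsingleton.elim _ _) hx]

end Protocol

/-! ### Total weights over all public data. -/

section Runs

variable {S R H : Type*} [NormedAddCommGroup H] [InnerProductSpace ℂ H] {N : ℕ}
variable (src : Source S R) (V : Attack S N H)

/-- The probability density of the runs with the public data `τ`. -/
def massRun (f : Fin N → Bool) (τ : Transcript N) (w : Run N R) : ℝ :=
  if transcript w.1 w.2.2 f = τ then (1 / 2) ^ (3 * N) * ‖actualRun src V w‖ ^ 2 else 0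

lemma massRun_nonneg (f : Fin N → Bool) (τ : Transcript N) (w : Run N R) :
    0 ≤ massRun src V f τ w := by
  rw [massRun]
  split_ifs
  · positivity
  · rfl

lemma summable_massRun (f : Fin N → Bool) (τ : Transcript N) : Summable (massRun src V f τ) := by
  refine Summable.of_nonneg_of_le (massRun_nonneg src V f τ) (fun w => ?_)
    ((summable_norm_sq_actualVec src V).mul_left ((1 / 2) ^ (3 * N)))
  rw [massRun]
  split_ifs
  · rfl
  · positivity

lemma sum_tsum_massRun_le (f : Fin N → Bool) : ∑ τ, ∑' w, massRun src V f τ w ≤ 1 := by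
  rw [← Summable.tsum_finsetSum fun τ _ => summable_massRun src V f τ]
  have h1 : ∀ w : Run N R, ∑ τ, massRun src V f τ w =
      (1 / 2) ^ (3 * N) * ‖actualVec src V w.1 w.2.1 w.2.2‖ ^ 2 := by
    intro w
    simp [massRun, actualRun]
  simp_rw [h1]
  have h2 := tsum_norm_sq_actualVec_total_le src V
  rw [← ENNReal.ofReal_tsum_of_nonneg (fun w => by positivity)
    (summable_norm_sq_actualVec src V)] at h2
  have h3 : ∑' w : Run N R, ‖actualVec src V w.1 w.2.1 w.2.2‖ ^ 2 ≤ 2 ^ (3 * N) := by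
    rw [← ENNReal.ofReal_le_ofReal_iff (by positivity), ENNReal.ofReal_pow (by norm_num),
      ENNReal.ofReal_ofNat]
    exact h2
  rw [tsum_mul_left]
  calc _ ≤ ((1 : ℝ) / 2) ^ (3 * N) * 2 ^ (3 * N) := by gcongr
    _ = 1 := by rw [← mul_pow]; norm_num

/-- Every run has one transcript and is either good or bad for it. -/
lemma sum_runWeight_le (NphU : Transcript N → ℝ≥0) (f : Fin N → Bool) :
    ∑ τ, (runWeight src V f (BadRun NphU f τ) + runWeight src V f (GoodRun NphU f τ)) ≤ 1 := by
  refine le_trans ?_ (tsum_norm_sq_virtualRun_le_one src V f)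
  simp_rw [runWeight, ← Summable.tsum_add (summable_restrictRun src V f _)
    (summable_restrictRun src V f _)]
  rw [← Summable.tsum_finsetSum fun τ _ => (summable_restrictRun src V f _).add
    (summable_restrictRun src V f _)]
  refine Summable.tsum_le_tsum (fun w => ?_) (summable_sum fun τ _ =>
    (summable_restrictRun src V f _).add (summable_restrictRun src V f _))
    (summable_norm_sq_virtualRun src V f)
  rw [Finset.sum_eq_single (transcript w.1 w.2.2 f)]
  · rw [restrictRun, restrictRun]
    by_cases h : (NphU (transcript w.1 w.2.2 f) : ℝ) < nPh (transcript w.1 w.2.2 f) w.1 w.2.2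
    · rw [if_pos ⟨rfl, h⟩, if_neg fun h' => h'.2 h]
      simp
    · rw [if_neg fun h' => h h'.2, if_pos ⟨rfl, h⟩]
      simp
  · intro τ _ hτ
    rw [restrictRun, restrictRun, if_neg fun h => hτ h.1.symm, if_neg fun h => hτ h.1.symm]
    simp
  · simp

lemma phaseErrorProb_eq {t : ℝ} (ht0 : 0 < t) (ht1 : t < 1) (NphU : Transcript N → ℝ≥0) :
    phaseErrorProb src V t NphU =
      ENNReal.ofReal (∑ f, coinWeight t f * ∑ τ, runWeight src V f (BadRun NphU f τ)) := by
  rw [phaseErrorProb, ENNReal.ofReal_sum_of_nonneg fun f _ => mul_nonneg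
    (coinWeight_nonneg ht0 ht1 f) (Finset.sum_nonneg fun τ _ => runWeight_nonneg src V f _)]
  refine Finset.sum_congr rfl fun f _ => ?_
  simp_rw [runWeight]
  rw [← Summable.tsum_finsetSum fun τ _ => summable_restrictRun src V f _, ← tsum_mul_left,
    ENNReal.ofReal_tsum_of_nonneg (fun w => mul_nonneg (coinWeight_nonneg ht0 ht1 f)
      (Finset.sum_nonneg fun τ _ => sq_nonneg _))
      ((summable_sum fun τ _ => summable_restrictRun src V f _).mul_left _)]
  refine tsum_congr fun w => ?_
  rw [Finset.sum_eq_single (transcript w.1 w.2.2 f)]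
  · rw [restrictRun]
    by_cases h : (NphU (transcript w.1 w.2.2 f) : ℝ) < nPh (transcript w.1 w.2.2 f) w.1 w.2.2
    · rw [if_pos h, if_pos ⟨rfl, h⟩]
      rfl
    · rw [if_neg h, if_neg fun h' => h h'.2]
      simp
  · intro τ _ hτ
    rw [restrictRun, if_neg fun h => hτ h.1.symm]
    simp
  · simp

end Runs

/-- Joint concavity: the only nonlinear term is `√(e q)`, for which this is Cauchy–Schwarz. A phase
error bound that holds only on average over the public data is therefore enough. -/
lemma sum_advantageBound_le {I : Type*} (s : Finset I) {θ h : ℝ} (hθ1 : θ ≤ 1)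
    {c e q : I → ℝ} (hc : ∀ i, 0 ≤ c i) (he : ∀ i, 0 ≤ e i) (hq : ∀ i, 0 ≤ q i) :
    ∑ i ∈ s, c i * advantageBound θ h (e i) (q i) ≤
      advantageBound θ h (∑ i ∈ s, c i * e i) (∑ i ∈ s, c i * q i) := by
  have h1 := Real.sum_sqrt_mul_sqrt_le s (f := fun i => c i * e i) (g := fun i => c i * q i)
    (fun i => mul_nonneg (hc i) (he i)) (fun i => mul_nonneg (hc i) (hq i))
  have h2 : ∀ i, √(c i * e i) * √(c i * q i) = c i * √(e i * q i) := by
    intro i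
    rw [← Real.sqrt_mul (mul_nonneg (hc i) (he i)),
      show c i * e i * (c i * q i) = c i ^ 2 * (e i * q i) by ring,
      Real.sqrt_mul (sq_nonneg _), Real.sqrt_sq (hc i)]
  simp_rw [h2] at h1
  rw [← Real.sqrt_mul (Finset.sum_nonneg fun i _ => mul_nonneg (hc i) (he i))] at h1
  have h3 : ∑ i ∈ s, c i * advantageBound θ h (e i) (q i) =
      ∑ i ∈ s, c i * e i + θ ^ 2 * ∑ i ∈ s, c i * q i +
        (1 - θ ^ 2) * (h / 2 * ∑ i ∈ s, c i * q i) +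
        (1 - θ) * (√(1 + √2 * h) * ∑ i ∈ s, c i * √(e i * q i)) := by
    simp only [advantageBound, Finset.mul_sum, ← Finset.sum_add_distrib]
    exact Finset.sum_congr rfl fun i _ => by ring
  rw [h3, advantageBound]
  have h4 : 0 ≤ 1 - θ := by linarith
  gcongr

/-! ### Reduction to Alice's sifted key and the security bound. -/

namespace Protocol

variable {N ζ' : ℕ} (P : Protocol N ζ')

/-- The replacement of the keys by a uniform common key is moved from the state to the tests, so
both states are compared with the same weights. -/
lemma sum_idealWeight_mul {R : Type*} (n : ℕ) (d : Key n × Key n × P.Public n → ℝ) (w : Run N R) :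
    ∑ i, P.idealWeight n i w * d i =
      ∑ i : Key n × Key n × P.Public n,
        P.outcomeWeight n i w * ((1 / 2) ^ n * ∑ k, d (k, k, i.2.2)) := by
  rw [sum_triple, sum_triple]
  refine Finset.sum_congr rfl fun e _ => ?_
  simp only [idealWeight]
  simp_rw [← Finset.sum_mul, ite_mul, zero_mul, Finset.sum_ite_eq, Finset.mem_univ, if_true]
  rw [← Finset.mul_sum, Fintype.sum_prod_type]
  ring

/-- A nonzero length forces the verification to succeed and the transcript to have exactly this
final length. -/
lemma sum_outcomeWeight_mul {R : Type*} {n : ℕ} (hn : n ≠ 0)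
    (D : Key n × Key n × P.Public n → ℝ) (w : Run N R) :
    ∑ i, P.outcomeWeight n i w * D i = ∑ τ, if P.finLen τ = n then
      (∑ f, if transcript w.1 w.2.2 f = τ then coinWeight P.t f else 0) * ((1 / 2) ^ (3 * N) *
        ∑ s, ∑ F, ∑ v, ((1 / 2) ^ P.nEC τ * (1 / 2) ^ ζ' * (P.verHash τ F).toReal) *
          ((if F (siftedA τ w.1) = F (P.reconciled τ (siftedA τ w.1) (siftedB τ w.2.2))
            then 1 else 0) * ∑ G, (P.paHash τ n G).toReal *
              D (G (siftedA τ w.1), G (P.reconciled τ (siftedA τ w.1) (siftedB τ w.2.2)),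
                ⟨τ, s, F, v, true, G⟩))) else 0 := by
  rw [sum_triple, Fintype.sum_sigma]
  refine Finset.sum_congr rfl fun τ _ => ?_
  have h1 : ∀ (s : Key (P.nEC τ)) (F : Sifted τ → Key ζ') (v : Key ζ') (acc : Bool)
      (G : Sifted τ → Key n),
      ∑ kA, ∑ kB, P.outcomeWeight n (kA, kB, ⟨τ, s, F, v, acc, G⟩) w *
        D (kA, kB, ⟨τ, s, F, v, acc, G⟩) =
      if acc = decide (F (siftedA τ w.1) =
          F (P.reconciled τ (siftedA τ w.1) (siftedB τ w.2.2))) ∧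
        n = (if acc then P.finLen τ else 0) then
      (∑ f, if transcript w.1 w.2.2 f = τ then coinWeight P.t f else 0) *
      ((1 / 2) ^ (3 * N) * (1 / 2) ^ P.nEC τ * (1 / 2) ^ ζ' * (P.verHash τ F).toReal *
        (P.paHash τ n G).toReal) * D (G (siftedA τ w.1),
          G (P.reconciled τ (siftedA τ w.1) (siftedB τ w.2.2)), ⟨τ, s, F, v, acc, G⟩) else 0 := by
    intro s F v acc G
    rw [Finset.sum_eq_single (G (siftedA τ w.1)), Finset.sum_eq_single
      (G (P.reconciled τ (siftedA τ w.1) (siftedB τ w.2.2)))]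
    · simp only [outcomeWeight, and_true]
      split_ifs <;> simp
    · intro kB _ h
      simp [outcomeWeight, h]
    · simp
    · intro kA _ h
      refine Finset.sum_eq_zero fun kB _ => ?_
      simp [outcomeWeight, h]
    · simp
  simp_rw [Fintype.sum_prod_type, h1, Fintype.sum_bool]
  by_cases hτ : P.finLen τ = n
  · rw [if_pos hτ]
    simp only [Finset.mul_sum]
    refine Finset.sum_congr rfl fun s _ => Finset.sum_congr rfl fun F _ =>
      Finset.sum_congr rfl fun v _ => ?_
    simp only [hτ, hn, if_true, Bool.false_eq_true, if_false, and_true, and_false,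
      Finset.sum_const_zero, add_zero, eq_comm (a := true), decide_eq_true_eq]
    split_ifs
    · exact Finset.sum_congr rfl fun G _ => by ring
    · simp
  · rw [if_neg hτ]
    simp [Ne.symm hτ, hn]

end Protocol

namespace Protocol

variable {N ζ' : ℕ} (P : Protocol N ζ')
variable {S R H : Type*} [NormedAddCommGroup H] [InnerProductSpace ℂ H]
variable (src : Source S R) (V : Attack S N H)

lemma sum_pads {α : Type*} [Fintype α] (m l : ℕ) (p Y : α → ℝ) :
    ∑ _s : Key m, ∑ F, ∑ _v : Key l, ((1 / 2) ^ m * (1 / 2) ^ l * p F) * Y F = ∑ F, p F * Y F := by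
  have h1 : ∀ F, ∑ _v : Key l, ((1 / 2) ^ m * (1 / 2) ^ l * p F) * Y F =
      (1 / 2) ^ m * (p F * Y F) := by
    intro F
    have h2 : ∀ _v : Key l, ((1 / 2) ^ m * (1 / 2) ^ l * p F) * Y F =
        (1 / 2) ^ l * ((1 / 2) ^ m * (p F * Y F)) := fun _ => by ring
    rw [Finset.sum_congr rfl fun v _ => h2 v, ← Finset.sum_mul, sum_key_const, one_mul]
  simp only [h1]
  rw [Finset.sum_congr rfl fun s _ => (Finset.mul_sum _ _ _).symm, ← Finset.sum_mul, sum_key_const,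
    one_mul]

/-- The contribution to the distance from an ideal state of the runs with the public data `τ` for
which the verification succeeds, if both parties used Alice's sifted key. -/
def testRun {n : ℕ} (U : Key n × Key n × P.Public n → H →L[ℂ] H) (f : Fin N → Bool)
    (τ : Transcript N) (s : Key (P.nEC τ)) (F : Sifted τ → Key ζ') (v : Key ζ') (w : Run N R) : ℝ :=
  if transcript w.1 w.2.2 f = τ then
    (1 / 2) ^ (3 * N) * ((if F (siftedA τ w.1) =
        F (P.reconciled τ (siftedA τ w.1) (siftedB τ w.2.2)) then 1 else 0) *
      advantage (fun G => (P.paHash τ n G).toReal) (fun G => G)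
        (fun G k => U (k, k, ⟨τ, s, F, v, true, G⟩)) (siftedA τ w.1) (actualRun src V w)) else 0

lemma sum_verHash_mismatch_le (τ : Transcript N) (κ κ' : Sifted τ) {x : ℝ} (hx : 0 ≤ x) :
    ∑ F, (P.verHash τ F).toReal * ((if F κ = F κ' then 1 else 0) * (if κ = κ' then 0 else x)) ≤
      (1 / 2) ^ ζ' * x := by
  by_cases h : κ = κ'
  · simp only [h, if_true, mul_zero, Finset.sum_const_zero]
    positivity
  · have h1 := (P.verHash_universal τ).sum_le h
    rw [card_key] at h1
    -- Distinct keys pass the verification with at most the collision probability of the universal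
    -- hash.
    refine le_trans (le_of_eq ?_) (mul_le_mul_of_nonneg_right h1 hx)
    rw [Finset.sum_mul]
    refine Finset.sum_congr rfl fun F _ => ?_
    rw [if_neg h]
    split_ifs <;> simp

/-- When the reconciled key is wrong, replacing it by Alice's changes the test of a contraction by
at most `2 ‖a‖²`. -/
lemma sum_paHash_le {n : ℕ} {U : Key n × Key n × P.Public n → H →L[ℂ] H} (hU1 : ∀ i, ‖U i‖ ≤ 1)
    (τ : Transcript N) (s : Key (P.nEC τ)) (F : Sifted τ → Key ζ') (v : Key ζ') (κ κ' : Sifted τ)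
    (a : H) :
    ∑ G, (P.paHash τ n G).toReal *
      ((1 / 2) ^ n * ∑ k, (inner ℂ a (U (k, k, ⟨τ, s, F, v, true, G⟩) a)).re -
        (inner ℂ a (U (G κ, G κ', ⟨τ, s, F, v, true, G⟩) a)).re) ≤
      advantage (fun G => (P.paHash τ n G).toReal) (fun G => G)
        (fun G k => U (k, k, ⟨τ, s, F, v, true, G⟩)) κ a +
      (if κ = κ' then 0 else 2 * ‖a‖ ^ 2) := by
  rw [advantage]
  by_cases h : κ = κ'
  · subst h
    simp only [if_true, add_zero, card_key]
    exact le_rfl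
  · rw [if_neg h]
    have h1 : 2 * ‖a‖ ^ 2 = ∑ G, (P.paHash τ n G).toReal * (2 * ‖a‖ ^ 2) := by
      rw [← Finset.sum_mul, sum_pmf_toReal, one_mul]
    rw [h1, ← Finset.sum_add_distrib]
    refine Finset.sum_le_sum fun G _ => ?_
    rw [← mul_add, card_key]
    refine mul_le_mul_of_nonneg_left ?_ ENNReal.toReal_nonneg
    have h2 := abs_le.mp (abs_re_inner_apply_le (hU1 (G κ, G κ, ⟨τ, s, F, v, true, G⟩)) a)
    have h3 := abs_le.mp (abs_re_inner_apply_le (hU1 (G κ, G κ', ⟨τ, s, F, v, true, G⟩)) a)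
    linarith [h2.1, h2.2, h3.1, h3.2]

/-- A bound for each run separately, before any summation over runs: the first term is the distance
for Alice's key alone, the second the cost of undetected errors. -/
lemma sum_weight_sub_le {n : ℕ} (hn : n ≠ 0) {U : Key n × Key n × P.Public n → H →L[ℂ] H}
    (hU1 : ∀ i, ‖U i‖ ≤ 1) (w : Run N R) :
    ∑ i, (P.idealWeight n i w - P.outcomeWeight n i w) *
        (inner ℂ (actualRun src V w) (U i (actualRun src V w))).re ≤
      ∑ τ, if P.finLen τ = n then ∑ f, coinWeight P.t f *
        (∑ s, ∑ F, ∑ v, ((1 / 2) ^ P.nEC τ * (1 / 2) ^ ζ' * (P.verHash τ F).toReal) *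
          P.testRun src V U f τ s F v w + 2 * (1 / 2) ^ ζ' * massRun src V f τ w) else 0 := by
  set a := actualRun src V w with ha
  simp_rw [sub_mul]
  rw [Finset.sum_sub_distrib, sum_idealWeight_mul P n (fun i => (inner ℂ a (U i a)).re),
    ← Finset.sum_sub_distrib]
  simp_rw [← mul_sub]
  rw [sum_outcomeWeight_mul P hn (fun i => (1 / 2) ^ n *
    ∑ k, (inner ℂ a (U (k, k, i.2.2) a)).re - (inner ℂ a (U i a)).re)]
  refine Finset.sum_le_sum fun τ _ => ?_
  split_ifs with hτ
  swap
  · rfl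
  rw [Finset.sum_mul]
  refine Finset.sum_le_sum fun f _ => ?_
  by_cases htr : transcript w.1 w.2.2 f = τ
  swap
  · simp [htr, testRun, massRun]
  rw [if_pos htr]
  refine mul_le_mul_of_nonneg_left ?_ (coinWeight_nonneg P.t_pos P.t_lt_one f)
  simp only [testRun, massRun, if_pos htr]
  set κ := siftedA τ w.1
  set κ' := P.reconciled τ κ (siftedB τ w.2.2)
  have h1 : ∀ (s : Key (P.nEC τ)) (F : Sifted τ → Key ζ') (v : Key ζ'),
      ((1 / 2) ^ P.nEC τ * (1 / 2) ^ ζ' * (P.verHash τ F).toReal) *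
          ((if F κ = F κ' then 1 else 0) * ∑ G, (P.paHash τ n G).toReal *
            ((1 / 2) ^ n * ∑ k, (inner ℂ a (U (k, k, ⟨τ, s, F, v, true, G⟩) a)).re -
              (inner ℂ a (U (G κ, G κ', ⟨τ, s, F, v, true, G⟩) a)).re)) ≤
      ((1 / 2) ^ P.nEC τ * (1 / 2) ^ ζ' * (P.verHash τ F).toReal) *
        ((if F κ = F κ' then 1 else 0) * advantage (fun G => (P.paHash τ n G).toReal) (fun G => G)
          (fun G k => U (k, k, ⟨τ, s, F, v, true, G⟩)) κ a) +
      ((1 / 2) ^ P.nEC τ * (1 / 2) ^ ζ' * (P.verHash τ F).toReal) *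
        ((if F κ = F κ' then 1 else 0) * (if κ = κ' then 0 else 2 * ‖a‖ ^ 2)) := by
    intro s F v
    rw [← mul_add, ← mul_add]
    refine mul_le_mul_of_nonneg_left (mul_le_mul_of_nonneg_left
      (P.sum_paHash_le hU1 τ s F v κ κ' a) ?_) ?_
    · split_ifs <;> norm_num
    · have := ENNReal.toReal_nonneg (a := P.verHash τ F)
      positivity
  have h2 : ∑ _s : Key (P.nEC τ), ∑ F, ∑ _v : Key ζ',
      ((1 / 2) ^ P.nEC τ * (1 / 2) ^ ζ' * (P.verHash τ F).toReal) *
        ((if F κ = F κ' then 1 else 0) * (if κ = κ' then 0 else 2 * ‖a‖ ^ 2)) ≤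
      (1 / 2) ^ ζ' * (2 * ‖a‖ ^ 2) := by
    rw [sum_pads (P.nEC τ) ζ' (fun F => (P.verHash τ F).toReal)
      fun F => (if F κ = F κ' then 1 else 0) * (if κ = κ' then 0 else 2 * ‖a‖ ^ 2)]
    exact P.sum_verHash_mismatch_le τ κ κ' (by positivity)
  have h3 := Finset.sum_le_sum fun (s : Key (P.nEC τ)) (_ : s ∈ Finset.univ) =>
    Finset.sum_le_sum fun (F : Sifted τ → Key ζ') (_ : F ∈ Finset.univ) =>
    Finset.sum_le_sum fun (v : Key ζ') (_ : v ∈ Finset.univ) => h1 s F v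
  simp only [Finset.sum_add_distrib] at h3
  have h4 : ∑ s : Key (P.nEC τ), ∑ F, ∑ v : Key ζ',
      ((1 / 2) ^ P.nEC τ * (1 / 2) ^ ζ' * (P.verHash τ F).toReal) *
        ((1 / 2) ^ (3 * N) * ((if F κ = F κ' then 1 else 0) *
          advantage (fun G => (P.paHash τ n G).toReal) (fun G => G)
          (fun G k => U (k, k, ⟨τ, s, F, v, true, G⟩)) κ a)) =
      (1 / 2) ^ (3 * N) * ∑ s : Key (P.nEC τ), ∑ F, ∑ v : Key ζ',
      ((1 / 2) ^ P.nEC τ * (1 / 2) ^ ζ' * (P.verHash τ F).toReal) *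
        ((if F κ = F κ' then 1 else 0) * advantage (fun G => (P.paHash τ n G).toReal) (fun G => G)
          (fun G k => U (k, k, ⟨τ, s, F, v, true, G⟩)) κ a) := by
    simp only [Finset.mul_sum]
    exact Finset.sum_congr rfl fun s _ => Finset.sum_congr rfl fun F _ =>
      Finset.sum_congr rfl fun v _ => by ring
  rw [h4]
  calc _ ≤ (1 / 2) ^ (3 * N) * (_ + (1 / 2) ^ ζ' * (2 * ‖a‖ ^ 2)) :=
        mul_le_mul_of_nonneg_left (h3.trans (add_le_add_right h2 _)) (by positivity)
    _ = _ := by ring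

lemma summable_testRun {n : ℕ} {U : Key n × Key n × P.Public n → H →L[ℂ] H}
    (hU1 : ∀ i, ‖U i‖ ≤ 1) (f : Fin N → Bool) (τ : Transcript N) (s : Key (P.nEC τ))
    (F : Sifted τ → Key ζ') (v : Key ζ') :
    Summable fun w : Run N R => P.testRun src V U f τ s F v w := by
  refine Summable.of_norm_bounded (g := fun w => 2 * massRun src V f τ w)
    ((summable_massRun src V f τ).mul_left 2) fun w => ?_
  rw [testRun, massRun]
  split_ifs with h1 h2
  · have h3 := abs_advantage_le (fun G => ENNReal.toReal_nonneg) (sum_pmf_toReal (P.paHash τ n))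
      (fun G => G) (U := fun G k => U (k, k, ⟨τ, s, F, v, true, G⟩)) (fun G k => hU1 _)
      (siftedA τ w.1) (actualRun src V w)
    rw [one_mul, Real.norm_eq_abs, abs_mul, abs_of_nonneg (by positivity : (0:ℝ) ≤ (1 / 2) ^ (3 * N))]
    calc _ ≤ (1 / 2 : ℝ) ^ (3 * N) * (2 * ‖actualRun src V w‖ ^ 2) := by gcongr
      _ = _ := by ring
  · simp
  · simp

lemma tsum_testRun_le [CompleteSpace H] (NphU : Transcript N → ℝ≥0) {n : ℕ}
    {U : Key n × Key n × P.Public n → H →L[ℂ] H}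
    (hU : ∀ i, IsSelfAdjoint (U i)) (hU1 : ∀ i, ‖U i‖ ≤ 1) (f : Fin N → Bool) (τ : Transcript N)
    (hτ : P.finLen τ = n) (s : Key (P.nEC τ)) (F : Sifted τ → Key ζ') (v : Key ζ') {h : ℝ}
    (hh0 : 0 < h) (hh1 : h ≤ 1)
    (hlam : Fintype.card (Key n) * ((goodErrors NphU τ).card / 2 ^ nCode τ : ℝ) ≤ h ^ 2)
    {θ : ℝ} (hθ0 : 0 ≤ θ) (hθ1 : θ ≤ 1) :
    ∑' w : Run N R, P.testRun src V U f τ s F v w ≤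
      2 * advantageBound θ h (runWeight src V f (BadRun NphU f τ))
        (runWeight src V f (GoodRun NphU f τ)) := by
  have hle : n ≤ nCode τ := hτ ▸ Nat.sub_le _ _
  refine tsum_advantage_le src V NphU f τ (p := fun G => (P.paHash τ n G).toReal)
    (fun G => ENNReal.toReal_nonneg) (sum_pmf_toReal _)
    (fun k k' hk => (P.paHash_universal τ n hle).sum_le hk)
    -- The success of the verification, which involves Bob's key, enters only as a weight in `[0,
    -- 1]`; `decoupling` allows arbitrary such weights.
    (a := fun w => if F (siftedA τ w.1) =
        F (P.reconciled τ (siftedA τ w.1) (siftedB τ w.2.2)) then 1 else 0)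
    (fun w => ?_) (fun w => ?_) hh0 hh1 hlam (fun G k => hU _) (fun G k => hU1 _) hθ0 hθ1
  · split_ifs <;> norm_num
  · split_ifs <;> norm_num

/-- The bound on the distance from an ideal state given the public data `τ` and the choice `f`. -/
def distBound (NphU : Transcript N → ℝ≥0) (θ h : ℝ) (τ : Transcript N) (f : Fin N → Bool) : ℝ :=
  2 * advantageBound θ h (runWeight src V f (BadRun NphU f τ))
    (runWeight src V f (GoodRun NphU f τ)) + 2 * (1 / 2) ^ ζ' * ∑' w, massRun src V f τ w

lemma tsum_sum_weight_sub_le [CompleteSpace H] (NphU : Transcript N → ℝ≥0) {n : ℕ} (hn : n ≠ 0)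
    {U : Key n × Key n × P.Public n → H →L[ℂ] H}
    (hU : ∀ i, IsSelfAdjoint (U i)) (hU1 : ∀ i, ‖U i‖ ≤ 1) {h : ℝ} (hh0 : 0 < h) (hh1 : h ≤ 1)
    (hlam : ∀ τ, P.finLen τ = n →
      Fintype.card (Key n) * ((goodErrors NphU τ).card / 2 ^ nCode τ : ℝ) ≤ h ^ 2)
    {θ : ℝ} (hθ0 : 0 ≤ θ) (hθ1 : θ ≤ 1) :
    ∑' w, ∑ i, (P.idealWeight n i w - P.outcomeWeight n i w) *
        (inner ℂ (actualRun src V w) (U i (actualRun src V w))).re ≤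
      ∑ τ, if P.finLen τ = n then
        ∑ f, coinWeight P.t f * distBound (ζ' := ζ') src V NphU θ h τ f else 0 := by
  have h1 : HasSum (fun w : Run N R => ∑ τ, if P.finLen τ = n then ∑ f, coinWeight P.t f *
        (∑ s, ∑ F, ∑ v, ((1 / 2) ^ P.nEC τ * (1 / 2) ^ ζ' * (P.verHash τ F).toReal) *
          P.testRun src V U f τ s F v w + 2 * (1 / 2) ^ ζ' * massRun src V f τ w) else 0)
      (∑ τ, if P.finLen τ = n then ∑ f, coinWeight P.t f *
        (∑ s, ∑ F, ∑ v, ((1 / 2) ^ P.nEC τ * (1 / 2) ^ ζ' * (P.verHash τ F).toReal) *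
          ∑' w, P.testRun src V U f τ s F v w +
          2 * (1 / 2) ^ ζ' * ∑' w, massRun src V f τ w) else 0) := by
    refine hasSum_sum fun τ _ => ?_
    split_ifs
    · exact hasSum_sum fun f _ => ((hasSum_sum fun s _ => hasSum_sum fun F _ => hasSum_sum fun v _ =>
        (P.summable_testRun src V hU1 f τ s F v).hasSum.mul_left _).add
        ((summable_massRun src V f τ).hasSum.mul_left _)).mul_left _
    · exact hasSum_zero
  have h2 : Summable fun w : Run N R => ∑ i, (P.idealWeight n i w - P.outcomeWeight n i w) *
        (inner ℂ (actualRun src V w) (U i (actualRun src V w))).re := by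
    refine summable_sum fun i _ => Summable.of_norm_bounded
      ((summable_norm_sq_actualVec src V).mul_left (Fintype.card (Key n × Key n) + 1 : ℝ))
      fun w => ?_
    rw [Real.norm_eq_abs, abs_mul]
    exact mul_le_mul ((abs_sub _ _).trans (add_le_add (P.abs_idealWeight_le n i w)
      (P.abs_outcomeWeight_le n i w))) (abs_re_inner_apply_le (hU1 i) _) (abs_nonneg _)
      (by positivity)
  refine (hasSum_le (fun w => P.sum_weight_sub_le src V hn hU1 w) h2.hasSum h1).trans ?_
  refine Finset.sum_le_sum fun τ _ => ?_
  split_ifs with hτ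
  swap
  · rfl
  refine Finset.sum_le_sum fun f _ => mul_le_mul_of_nonneg_left ?_
    (coinWeight_nonneg P.t_pos P.t_lt_one f)
  rw [distBound]
  refine add_le_add_left ?_ _
  calc _ ≤ ∑ s : Key (P.nEC τ), ∑ F, ∑ v : Key ζ',
        ((1 / 2) ^ P.nEC τ * (1 / 2) ^ ζ' * (P.verHash τ F).toReal) *
          (2 * advantageBound θ h (runWeight src V f (BadRun NphU f τ))
        (runWeight src V f (GoodRun NphU f τ))) := by
        refine Finset.sum_le_sum fun s _ => Finset.sum_le_sum fun F _ =>
          Finset.sum_le_sum fun v _ => mul_le_mul_of_nonneg_left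
            (P.tsum_testRun_le src V NphU hU hU1 f τ hτ s F v hh0 hh1 (hlam τ hτ) hθ0 hθ1) ?_
        have := ENNReal.toReal_nonneg (a := P.verHash τ F)
        positivity
    _ = _ := by
        rw [sum_pads (P.nEC τ) ζ' (fun F => (P.verHash τ F).toReal) fun _ => _, ← Finset.sum_mul,
          sum_pmf_toReal, one_mul]

lemma traceNorm_sub_le [CompleteSpace H] (NphU : Transcript N → ℝ≥0) {n : ℕ} (hn : n ≠ 0)
    {h : ℝ} (hh0 : 0 < h) (hh1 : h ≤ 1)
    (hlam : ∀ τ, P.finLen τ = n →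
      Fintype.card (Key n) * ((goodErrors NphU τ).card / 2 ^ nCode τ : ℝ) ≤ h ^ 2)
    {θ : ℝ} (hθ0 : 0 ≤ θ) (hθ1 : θ ≤ 1) :
    traceNorm (cqOp (P.idealBlock src V n) - cqOp (P.finBlock src V n)) ≤
      ENNReal.ofReal (∑ τ, if P.finLen τ = n then
        ∑ f, coinWeight P.t f * distBound (ζ' := ζ') src V NphU θ h τ f else 0) := by
  rw [cqOp_sub]
  refine traceNorm_cqOp_le (a := actualRun src V) (summable_norm_sq_actualVec src V)
    (c := fun w i => P.idealWeight n i w - P.outcomeWeight n i w)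
    (B := Fintype.card (Key n × Key n) + 1) (fun w i => (abs_sub _ _).trans (add_le_add
      (P.abs_idealWeight_le n i w) (P.abs_outcomeWeight_le n i w))) (fun i => ?_)
    fun U hU hU1 => P.tsum_sum_weight_sub_le src V NphU hn hU hU1 hh0 hh1 hlam hθ0 hθ1
  rw [idealBlock_eq_tsum, finBlock_eq_tsum, ← Summable.tsum_sub
    (summable_smul_rankOne src V (P.abs_idealWeight_le n i))
    (summable_smul_rankOne src V (P.abs_outcomeWeight_le n i))]
  refine tsum_congr fun w => ?_
  push_cast
  rw [sub_smul]

/-- Each transcript contributes only to the length `finLen τ`, so the bounds add up without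
repetition. -/
lemma tsum_traceNorm_sub_le [CompleteSpace H] (NphU : Transcript N → ℝ≥0)
    {h : ℝ} (hh0 : 0 < h) (hh1 : h ≤ 1)
    (hlam : ∀ τ, P.finLen τ ≠ 0 →
      Fintype.card (Key (P.finLen τ)) * ((goodErrors NphU τ).card / 2 ^ nCode τ : ℝ) ≤ h ^ 2)
    {θ : ℝ} (hθ0 : 0 ≤ θ) (hθ1 : θ ≤ 1) :
    ∑' n, traceNorm (cqOp (P.idealBlock src V n) - cqOp (P.finBlock src V n)) ≤
      ENNReal.ofReal (∑ τ, ∑ f, coinWeight P.t f * distBound (ζ' := ζ') src V NphU θ h τ f) := by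
  have hd : ∀ τ, 0 ≤ ∑ f, coinWeight P.t f * distBound (ζ' := ζ') src V NphU θ h τ f := by
    refine fun τ => Finset.sum_nonneg fun f _ => mul_nonneg
      (coinWeight_nonneg P.t_pos P.t_lt_one f) (add_nonneg (mul_nonneg zero_le_two
        (advantageBound_nonneg hθ0 hθ1 hh0.le (runWeight_nonneg _ _ _ _)
          (runWeight_nonneg _ _ _ _))) (mul_nonneg (by positivity)
            (tsum_nonneg (massRun_nonneg src V f τ))))
  calc _ ≤ ∑' n, ∑ τ, (if n = P.finLen τ then ENNReal.ofReal
        (∑ f, coinWeight P.t f * distBound (ζ' := ζ') src V NphU θ h τ f) else 0) := by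
        refine ENNReal.tsum_le_tsum fun n => ?_
        by_cases hn : n = 0
        · subst hn
          rw [idealBlock_zero, sub_self, traceNorm_zero]
          exact bot_le
        · refine (P.traceNorm_sub_le src V NphU hn hh0 hh1 (fun τ hτ => ?_) hθ0 hθ1).trans
            (le_of_eq ?_)
          · subst hτ
            exact hlam τ hn
          · rw [ENNReal.ofReal_sum_of_nonneg]
            · refine Finset.sum_congr rfl fun τ _ => ?_
              simp only [eq_comm (a := n)]
              split_ifs <;> simp
            · intro τ _
              split_ifs
              · exact hd τ
              · rfl
    _ = _ := by
        rw [Summable.tsum_finsetSum fun τ _ => ENNReal.summable,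
          ENNReal.ofReal_sum_of_nonneg fun τ _ => hd τ]
        refine Finset.sum_congr rfl fun τ _ => ?_
        rw [tsum_ite_eq]

/-- The exponents add up to `N_fin + N_code h - N_code = N_code h - N_PA`, at most `-ζ` by the
choice of `N_PA`. A nonzero final length ensures that the subtraction of naturals is exact and that
the division by `nCode τ` is genuine. -/
lemma card_mul_card_goodErrors_le (NphU : Transcript N → ℝ≥0) {ζ : ℝ} (τ : Transcript N)
    (hPA : P.nPA τ = ⌈(nCode τ : ℝ) * entropyFn ((NphU τ : ℝ) / nCode τ) + ζ⌉₊)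
    (hτ : P.finLen τ ≠ 0) :
    Fintype.card (Key (P.finLen τ)) * ((goodErrors NphU τ).card / 2 ^ nCode τ : ℝ) ≤
      ((2 : ℝ) ^ (-ζ / 2)) ^ 2 := by
  have h1 : P.finLen τ + P.nPA τ = nCode τ := by
    rw [finLen] at hτ ⊢
    omega
  have h2 : 0 < nCode τ := by omega
  have h3 := card_goodErrors_le NphU τ h2
  have h4 : (nCode τ : ℝ) * entropyFn ((NphU τ : ℝ) / nCode τ) + ζ ≤ P.nPA τ := by
    rw [hPA]; exact Nat.le_ceil _
  have h5 : (P.finLen τ : ℝ) + P.nPA τ = nCode τ := by exact_mod_cast h1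
  have h6 : (Fintype.card (Key (P.finLen τ)) : ℝ) = 2 ^ (P.finLen τ : ℝ) := by
    simp [ZMod.card]
  rw [h6, ← Real.rpow_natCast 2 (nCode τ), ← Real.rpow_natCast _ 2, ← Real.rpow_mul zero_le_two]
  calc _ ≤ (2 : ℝ) ^ (P.finLen τ : ℝ) * (2 ^ ((nCode τ : ℝ) * entropyFn ((NphU τ : ℝ) / nCode τ)) /
        2 ^ (nCode τ : ℝ)) := by gcongr
    _ = 2 ^ ((P.finLen τ : ℝ) + ((nCode τ : ℝ) * entropyFn ((NphU τ : ℝ) / nCode τ) -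
        (nCode τ : ℝ))) := by
        rw [Real.rpow_add two_pos, Real.rpow_sub two_pos]
    _ ≤ _ := by
        refine Real.rpow_le_rpow_of_exponent_le one_le_two ?_
        push_cast
        linarith

lemma sum_distBound_le [CompleteSpace H] (NphU : Transcript N → ℝ≥0) {h ε : ℝ} (hh0 : 0 < h)
    (hε0 : 0 ≤ ε) (hε : phaseErrorProb src V P.t NphU ≤ ENNReal.ofReal ε) :
    ∃ θ : ℝ, 0 ≤ θ ∧ θ ≤ 1 ∧
      ∑ τ, ∑ f, coinWeight P.t f * distBound (ζ' := ζ') src V NphU θ h τ f ≤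
        2 * ((1 / 2) ^ ζ' + √2 * √(ε + h ^ 2)) := by
  set E := ∑ f, coinWeight P.t f * ∑ τ, runWeight src V f (BadRun NphU f τ) with hE
  set Q := ∑ f, coinWeight P.t f * ∑ τ, runWeight src V f (GoodRun NphU f τ) with hQ
  have hcoin := fun f => coinWeight_nonneg P.t_pos P.t_lt_one (N := N) f
  have hE0 : 0 ≤ E := Finset.sum_nonneg fun f _ => mul_nonneg (hcoin f)
    (Finset.sum_nonneg fun τ _ => runWeight_nonneg _ _ _ _)
  have hQ0 : 0 ≤ Q := Finset.sum_nonneg fun f _ => mul_nonneg (hcoin f)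
    (Finset.sum_nonneg fun τ _ => runWeight_nonneg _ _ _ _)
  have hEε : E ≤ ε := by
    rwa [phaseErrorProb_eq src V P.t_pos P.t_lt_one, ENNReal.ofReal_le_ofReal_iff hε0] at hε
  have hEQ : E + Q ≤ 1 := by
    rw [hE, hQ, ← Finset.sum_add_distrib, ← sum_coinWeight (N := N) P.t]
    refine Finset.sum_le_sum fun f _ => ?_
    rw [← mul_add, ← Finset.sum_add_distrib]
    exact mul_le_of_le_one_right (hcoin f) (sum_runWeight_le src V NphU f)
  have hsq : √E ^ 2 = E := Real.sq_sqrt hE0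
  have hE1 : √E ≤ 1 := by rw [Real.sqrt_le_one]; linarith
  have hs0 := Real.sqrt_nonneg E
  -- `θ = e / 2` as in `decoupling_bound_le`, with `e²` the true probability `E` of too many phase
  -- errors; `ε` replaces `E` only at the end, by monotonicity.
  refine ⟨√E / 2, by positivity, by linarith, ?_⟩
  have hadv : ∑ τ, ∑ f, coinWeight P.t f * advantageBound (√E / 2) h
      (runWeight src V f (BadRun NphU f τ)) (runWeight src V f (GoodRun NphU f τ)) ≤
      √2 * √(ε + h ^ 2) := by
    have h1 := sum_advantageBound_le (I := Transcript N × (Fin N → Bool)) Finset.univ (θ := √E / 2)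
      (h := h) (by linarith) (c := fun i => coinWeight P.t i.2)
      (e := fun i => runWeight src V i.2 (BadRun NphU i.2 i.1))
      (q := fun i => runWeight src V i.2 (GoodRun NphU i.2 i.1))
      (fun i => hcoin i.2) (fun i => runWeight_nonneg _ _ _ _) (fun i => runWeight_nonneg _ _ _ _)
    simp only [Fintype.sum_prod_type] at h1
    refine h1.trans ?_
    have h2 : ∑ τ, ∑ f, coinWeight P.t f * runWeight src V f (BadRun NphU f τ) = E := by
      rw [Finset.sum_comm]; simp_rw [← Finset.mul_sum]; rfl
    have h3 : ∑ τ, ∑ f, coinWeight P.t f * runWeight src V f (GoodRun NphU f τ) = Q := by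
      rw [Finset.sum_comm]; simp_rw [← Finset.mul_sum]; rfl
    rw [h2, h3]
    have h4 := decoupling_bound_le (e := √E) (h := h) (Q := Q) hs0 hE1 hh0.le hQ0
      (by rw [hsq]; linarith)
    rw [hsq] at h4
    rw [advantageBound]
    refine h4.trans ?_
    gcongr
  have hmass : ∑ τ, ∑ f, coinWeight P.t f * ∑' w, massRun src V f τ w ≤ 1 := by
    rw [Finset.sum_comm, ← sum_coinWeight (N := N) P.t]
    refine Finset.sum_le_sum fun f _ => ?_
    rw [← Finset.mul_sum]
    exact mul_le_of_le_one_right (hcoin f) (sum_tsum_massRun_le src V f)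
  have hsplit : ∑ τ, ∑ f, coinWeight P.t f * distBound (ζ' := ζ') src V NphU (√E / 2) h τ f =
      2 * ∑ τ, ∑ f, coinWeight P.t f * advantageBound (√E / 2) h
      (runWeight src V f (BadRun NphU f τ)) (runWeight src V f (GoodRun NphU f τ)) +
      2 * (1 / 2) ^ ζ' * ∑ τ, ∑ f, coinWeight P.t f * ∑' w, massRun src V f τ w := by
    simp only [distBound, Finset.mul_sum, ← Finset.sum_add_distrib]
    exact Finset.sum_congr rfl fun τ _ => Finset.sum_congr rfl fun f _ => by
      rw [← tsum_mul_left, ← tsum_mul_left, mul_add, tsum_mul_left, tsum_mul_left]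
      ring
  rw [hsplit]
  have h5 : 2 * ((1 : ℝ) / 2) ^ ζ' * ∑ τ, ∑ f, coinWeight P.t f * ∑' w, massRun src V f τ w ≤
      2 * (1 / 2) ^ ζ' := mul_le_of_le_one_right (by positivity) hmass
  linarith

/-- Security from a bound on the number of phase errors. -/
theorem isSecure_of_phaseErrorProb_le [CompleteSpace H] (NphU : Transcript N → ℝ≥0) {ζ ε : ℝ}
    (hζ : 0 < ζ) (hε0 : 0 ≤ ε)
    (hPA : ∀ τ, P.nPA τ = ⌈(nCode τ : ℝ) * entropyFn ((NphU τ : ℝ) / nCode τ) + ζ⌉₊)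
    (hε : phaseErrorProb src V P.t NphU ≤ ENNReal.ofReal ε) :
    P.IsSecure src V ((2 : ℝ) ^ (-(ζ' : ℝ)) + √2 * √(ε + (2 : ℝ) ^ (-ζ))) := by
  -- `h = 2^(-ζ/2)`, so that `h²` is the bound on `|Z| λ` in the decoupling lemma.
  have hh0 : 0 < (2 : ℝ) ^ (-ζ / 2) := by positivity
  have hh1 : (2 : ℝ) ^ (-ζ / 2) ≤ 1 := Real.rpow_le_one_of_one_le_of_nonpos one_le_two (by linarith)
  obtain ⟨θ, hθ0, hθ1, hle⟩ := P.sum_distBound_le src V NphU hh0 hε0 hε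
  have h1 := P.tsum_traceNorm_sub_le src V NphU hh0 hh1
    (fun τ hτ => P.card_mul_card_goodErrors_le NphU τ (hPA τ) hτ) hθ0 hθ1
  have h2 : ((2 : ℝ) ^ (-ζ / 2)) ^ 2 = 2 ^ (-ζ) := by
    rw [← Real.rpow_natCast _ 2, ← Real.rpow_mul zero_le_two]
    congr 1
    push_cast
    ring
  have h3 : ((1 : ℝ) / 2) ^ ζ' = 2 ^ (-(ζ' : ℝ)) := by
    rw [Real.rpow_neg zero_le_two, Real.rpow_natCast, one_div, inv_pow]
  rw [h2, h3] at hle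
  rw [IsSecure]
  calc _ ≤ (1 / 2 : ℝ≥0∞) * ENNReal.ofReal
        (2 * ((2 : ℝ) ^ (-(ζ' : ℝ)) + √2 * √(ε + (2 : ℝ) ^ (-ζ)))) := by
        gcongr
        exact h1.trans (ENNReal.ofReal_le_ofReal hle)
    _ = _ := by
        rw [ENNReal.ofReal_mul zero_le_two, ENNReal.ofReal_ofNat, ← mul_assoc, one_div,
          ENNReal.inv_mul_cancel (by simp) (by simp), one_mul]

/-- `m - ⌈x⌉ = ⌊m - x⌋` for an integer `m`. Nonnegativity of `m - x` gives `⌈x⌉ ≤ m`, so the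
subtraction of naturals is not truncated. -/
lemma netLength_eq (NphU : Transcript N → ℝ≥0) {ζ : ℝ} (hζ : 0 < ζ) (τ : Transcript N)
    (hPA : P.nPA τ = ⌈(nCode τ : ℝ) * entropyFn ((NphU τ : ℝ) / nCode τ) + ζ⌉₊)
    (h0 : 0 ≤ (nCode τ : ℝ) * (1 - entropyFn ((NphU τ : ℝ) / nCode τ)) - ζ) :
    P.netLength τ = ⌊(nCode τ : ℝ) * (1 - entropyFn ((NphU τ : ℝ) / nCode τ)) - ζ⌋ -
      (P.nEC τ : ℤ) - (ζ' : ℤ) := by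
  set x := (nCode τ : ℝ) * entropyFn ((NphU τ : ℝ) / nCode τ) + ζ with hx
  have h1 : 0 ≤ x := add_nonneg (mul_nonneg (Nat.cast_nonneg _)
    (entropyFn_nonneg (by positivity))) hζ.le
  have h2 : (nCode τ : ℝ) * (1 - entropyFn ((NphU τ : ℝ) / nCode τ)) - ζ = nCode τ - x := by
    rw [hx]; ring
  rw [h2] at h0 ⊢
  have h3 : P.nPA τ ≤ nCode τ := by
    rw [hPA, Nat.ceil_le]
    linarith
  rw [netLength, finLen, Nat.cast_sub h3, hPA, Int.natCast_ceil_eq_ceil h1, sub_eq_add_neg (_ : ℝ),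
    Int.floor_natCast_add, Int.floor_neg, ← sub_eq_add_neg]

end Protocol

end DPSQKD

end

theorem corollary1 {S R H : Type*} [NormedAddCommGroup H] [InnerProductSpace ℂ H] [CompleteSpace H]
    {N : ℕ} (src : Source S R) (ζ : ℝ) (ζ' : ℕ) (hζ : 0 < ζ) (hζ' : 0 < ζ')
    (P : Protocol N ζ') (NphU : Transcript N → ℝ≥0) (ε : ℝ) (hε0 : 0 ≤ ε) (hε1 : ε ≤ 1)
    (hPA : ∀ τ, P.nPA τ = ⌈(nCode τ : ℝ) * entropyFn ((NphU τ : ℝ) / nCode τ) + ζ⌉₊) :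
    (∀ τ, 0 ≤ (nCode τ : ℝ) * (1 - entropyFn ((NphU τ : ℝ) / nCode τ)) - ζ →
      P.netLength τ =
        ⌊(nCode τ : ℝ) * (1 - entropyFn ((NphU τ : ℝ) / nCode τ)) - ζ⌋ - (P.nEC τ : ℤ) - (ζ' : ℤ)) ∧
    ∀ V : Attack S N H,
      phaseErrorProb src V P.t NphU ≤ ENNReal.ofReal ε →
        P.IsSecure src V
          ((2 : ℝ) ^ (-(ζ' : ℝ)) + √2 * √(ε + (2 : ℝ) ^ (-ζ))) := by
  exact ⟨fun τ h0 => P.netLength_eq NphU hζ τ (hPA τ) h0,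
    fun V hε => P.isSecure_of_phaseErrorProb_le src V NphU hζ hε0 hPA hε⟩
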